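/- **Setting.** Let $\gamma_{lg},\mathcal R>0$ and $\gamma_{sl},\gamma_{sg},\zeta,\rho,g\in\mathbb R$ be constants, $\sigma=\frac{\gamma_{sl}-\gamma_{sg}}{\gamma_{lg}}$, $\varsigma=\frac{\rho g}{\gamma_{lg}}$. A droplet is a pair $(D,u)$ of a bounded open set $D\subset\mathbb R^2$ and a function $u\ge 0$ in $H^1_0(D)$; its free energy is $$\mathcal F(D,u)=\gamma_{lg}\int_D\sqrt{1+|\nabla u|^2}\,dx\,dy+(\gamma_{sl}-\gamma_{sg})|D|+\rho g\int_D\frac{u^2}{2}\,dx\,dy .$$ A *droplet trajectory* on a compact time interval $J$ is a family $(D(t),u(\cdot,t))_{t\in J}$ of droplets such that $D(t)=\Phi_t(D_0)$ for a fixed set $D_0$ and a $C^1$ isotopy $(\Phi_t)$ of the plane ($\Phi_t$ is a $C^1$ diffeomorphism, and $\Phi_t$ and $D\Phi_t$ are continuously differentiable in $t$), and $t\mapsto u(\Phi_t(\cdot),t)$ is differentiable as a curve in $H^1(D_0)$. If $\Gamma(t)=\partial D(t)$ is a $C^1$ Jordan curve with outer unit normal $n_{cl}$, then $v_{cl}=n_{cl}\cdot(\partial_t\Phi_t)\circ\Phi_t^{-1}$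 on $\Gamma(t)$ is the contact line speed. Let $T>0$, and let $(\Gamma(t),u(\cdot,t),\lambda(t))$, $t\in[0,T]$, be a droplet trajectory with $\Gamma(t)=\partial D(t)$ a $C^1$ Jordan curve and $u(\cdot,t)\in H^2(D(t))\cap H^1_0(D(t))$ for every $t$, which solves $$\frac{\zeta}{\gamma_{lg}}\frac{\partial_t u}{\sqrt{1+|\nabla u|^2}}=\nabla\cdot\Big(\frac{\nabla u}{\sqrt{1+|\nabla u|^2}}\Big)-\varsigma u+\frac{\lambda(t)}{\gamma_{lg}}\ \text{ a.e. in }D(t),\qquad u=0\ \text{ on }\Gamma(t),$$ $$\frac{\mathcal R}{\gamma_{lg}}v_{cl}=-\sigma-\frac{1}{\sqrt{1+|\nabla u|^2}}\ \text{ on }\Gamma(t),\qquad \int_{D(t)}u\,dx\,dy=V .$$ Here $\partial_t u$ is the (distributional) time derivative at fixed points of $D(t)$, values of $\nabla u$ and $\partial_tu$ on $\Gamma(t)$ are traces, and relations on $\Gamma(t)$ hold almost everywhere with respect to arc length. Then, for every $t\in[0,T]$: (i) $\partial_tu(\cdot,t)\in H^1(D(t))$ and $\partial_t u=-(\nabla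 u\cdot n_{cl})\,v_{cl}=|\nabla u|\,v_{cl}$ on $\Gamma(t)$; indeed $-\nabla u\cdot n_{cl}=|\nabla u|$ there. (ii) $t\mapsto\mathcal F(D(t),u(\cdot,t))$ is differentiable on $[0,T]$ (one-sidedly at the end points) and $$\frac{d}{dt}\mathcal F=-\mathcal R\int_{\Gamma(t)}v_{cl}^2\,ds-\zeta\int_{D(t)}\frac{(\partial_tu)^2}{\sqrt{1+|\nabla u|^2}}\,dx\,dy .$$ (iii) If $\zeta=0$, the dynamics is a gradient flow of $\Gamma(t)$: $$\mathcal R v_{cl}=-\frac{\delta\mathcal F}{\delta\Gamma}=-\gamma_{lg}\Big(\sigma+\frac1{\sqrt{1+|\nabla u|^2}}\Big)\quad\text{on }\Gamma(t),$$ where $u(\cdot,t)\in H^2(D(t))\cap H^1_0(D(t))$ solves the quasi-static problem $\nabla\cdot\big(\frac{\nabla u}{\sqrt{1+|\nabla u|^2}}\big)-\varsigma u+\frac{\lambda(t)}{\gamma_{lg}}=0$ in $D(t)$, $\int_{D(t)}u=V$. Here $\delta=\frac{\delta\mathcal F}{\delta\Gamma}$ means that for every droplet trajectory $(\tilde D(s),\tilde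 u(\cdot,s))$ of constant volume $V$ (quasi-static or not), on a nondegenerate compact interval containing $t$, with $\tilde D(t)=D(t)$, $\tilde u(\cdot,t)=u(\cdot,t)$ and contact line speed $\tilde v_{cl}$ at time $t$, one has $\frac{d}{ds}\big|_{s=t}\mathcal F(\tilde D(s),\tilde u(\cdot,s))=\int_{\Gamma(t)}\delta\,\tilde v_{cl}\,ds$. (iv) Let $\theta_{cl}\in[0,\frac\pi2)$, $\tan\theta_{cl}=|\nabla u|$ on $\Gamma(t)$, be the contact angle, and suppose $\theta_Y\in[0,\pi]$ is Young's angle, $\cos\theta_Y=-\sigma$ (it exists if and only if $|\sigma|\le1$). Then on $\Gamma(t)$ the equilibrium angle is $\theta_Y$, that is, $v_{cl}=0$ if and only if $\theta_{cl}=\theta_Y$, and $$v_{cl}=\frac{\gamma_{lg}}{\mathcal R}(\cos\theta_Y-\cos\theta_{cl})\ \begin{cases}>0,&\theta_{cl}>\theta_Y,\\<0,&\theta_{cl}<\theta_Y.\end{cases}$$ -/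

import Mathlib

open MeasureTheory Set Filter Topology

noncomputable section

/-- The substrate plane `ℝ²` with its Euclidean norm. -/
abbrev Plane := EuclideanSpace ℝ (Fin 2)

/-! ### Weak derivatives and Sobolev spaces on an open set `D ⊆ ℝ²` -/

/-- Compactly supported `C¹` test functions on the open set `D`. -/
def IsTestFun (D : Set Plane) (φ : Plane → ℝ) : Prop :=
  ContDiff ℝ 1 φ ∧ HasCompactSupport φ ∧ tsupport φ ⊆ D

/-- `g` is a weak gradient of `f` on `D`. -/
def HasWeakGrad (D : Set Plane) (f : Plane → ℝ) (g : Plane → Plane) : Prop :=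
  LocallyIntegrableOn f D ∧ LocallyIntegrableOn g D ∧
    ∀ φ, IsTestFun D φ → ∫ x in D, f x • gradient φ x = -∫ x in D, φ x • g x

/-- `d` is the weak divergence of the vector field `F` on `D`. -/
def HasWeakDiv (D : Set Plane) (F : Plane → Plane) (d : Plane → ℝ) : Prop :=
  LocallyIntegrableOn F D ∧ LocallyIntegrableOn d D ∧
    ∀ φ, IsTestFun D φ → ∫ x in D, inner ℝ (F x) (gradient φ x) = -∫ x in D, d x * φ x

open Classical in
/-- The weak gradient `∇f` on `D` (determined up to null sets of `D` when it exists). -/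
def weakGrad (D : Set Plane) (f : Plane → ℝ) : Plane → Plane :=
  if h : ∃ g, HasWeakGrad D f g then h.choose else 0

/-- `f ∈ H¹(D)`. -/
def MemH1 (D : Set Plane) (f : Plane → ℝ) : Prop :=
  MemLp f 2 (volume.restrict D) ∧ (∃ g, HasWeakGrad D f g) ∧
    MemLp (weakGrad D f) 2 (volume.restrict D)

/-- `f ∈ H²(D)`: `f` and both components of `∇f` lie in `H¹(D)`. -/
def MemH2 (D : Set Plane) (f : Plane → ℝ) : Prop :=
  MemH1 D f ∧ ∀ i : Fin 2, MemH1 D (fun x => weakGrad D f x i)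

/-- The norm of `H¹(D)`, used only for elements of `H¹(D)`. -/
def h1Norm (D : Set Plane) (f : Plane → ℝ) : ENNReal :=
  eLpNorm f 2 (volume.restrict D) + eLpNorm (weakGrad D f) 2 (volume.restrict D)

/-- `f ∈ H¹₀(D)`, the closure of the test functions in `H¹(D)`. -/
def MemH10 (D : Set Plane) (f : Plane → ℝ) : Prop :=
  MemH1 D f ∧ ∃ φ : ℕ → Plane → ℝ, (∀ k, IsTestFun D (φ k)) ∧
    Tendsto (fun k => h1Norm D (fun x => φ k x - f x)) atTop (𝓝 0)

/-! ### Domains bounded by a `C¹` Jordan curve, boundary integrals and traces -/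

/-- The unit normal to the right of the tangent of the curve `c`; it is the outer normal of the
enclosed domain when `c` is positively oriented. -/
def outerNormal (c : ℝ → Plane) (θ : ℝ) : Plane :=
  ‖deriv c θ‖⁻¹ • !₂[deriv c θ 1, -(deriv c θ 0)]

/-- `D` is a bounded open set whose boundary is the `C¹` Jordan curve `Γ = c([0,1))`, where `c` is
a regular, simple, closed, positively oriented `C¹` parametrization of period `1`. -/
structure IsC1JordanDomain (D : Set Plane) (c : ℝ → Plane) : Prop where
  isOpen : IsOpen D
  isBounded : Bornology.IsBounded D
  contDiff : ContDiff ℝ 1 c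
  periodic : Function.Periodic c 1
  injOn : InjOn c (Ico 0 1)
  regular : ∀ θ, deriv c θ ≠ 0
  frontier_eq : frontier D = range c
  oriented : ∀ θ, ∀ᶠ s in 𝓝[>] (0 : ℝ), c θ - s • outerNormal c θ ∈ D

/-- Functions on `Γ` are written as functions of the parameter `θ ∈ (0,1]` of `c`. As
`|c'|` is bounded above and below, `dθ` and arc length have the same null sets and the same
`L²` functions. -/
def paramMeasure : Measure ℝ := volume.restrict (Ioc 0 1)

/-- The arc length integral `∫_Γ h ds`. -/
def arcIntegral (c : ℝ → Plane) (h : ℝ → ℝ) : ℝ :=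
  ∫ θ, h θ * ‖deriv c θ‖ ∂paramMeasure

/-- `g ∈ L²(Γ)` is the trace on `Γ` of `f ∈ H¹(D)`: the limit in `L²(Γ)` of the boundary values of
`C¹` functions on the plane that converge to `f` in `H¹(D)`. -/
def HasTrace (D : Set Plane) (c : ℝ → Plane) (f : Plane → ℝ) (g : ℝ → ℝ) : Prop :=
  MemH1 D f ∧ MemLp g 2 paramMeasure ∧
    ∃ ψ : ℕ → Plane → ℝ, (∀ k, ContDiff ℝ 1 (ψ k)) ∧
      Tendsto (fun k => h1Norm D (fun x => ψ k x - f x)) atTop (𝓝 0) ∧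
      Tendsto (fun k => eLpNorm (fun θ => ψ k (c θ) - g θ) 2 paramMeasure) atTop (𝓝 0)

/-! ### Moving domains -/

/-- The Lagrangian velocity `∂ₜΦₜ(y)` of the moving points `Φₜ(y)`, `t ∈ J`. -/
def lagrangianVelocity (J : Set ℝ) (Φ : ℝ → Plane ≃ₜ Plane) (t : ℝ) (y : Plane) : Plane :=
  derivWithin (fun s => Φ s y) J t

/-- `(Φₜ)`, `t ∈ J`, is a `C¹` isotopy of the plane: the `Φₜ` are `C¹` diffeomorphisms, and `Φₜ`
and its differential are continuously differentiable in time. -/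
structure IsC1Isotopy (J : Set ℝ) (Φ : ℝ → Plane ≃ₜ Plane) : Prop where
  contDiff : ∀ t ∈ J, ContDiff ℝ 1 (Φ t)
  contDiff_symm : ∀ t ∈ J, ContDiff ℝ 1 (Φ t).symm
  differentiable : ∀ t ∈ J, ∀ y, DifferentiableWithinAt ℝ (fun s => Φ s y) J t
  contDiff_velocity : ∀ t ∈ J, ContDiff ℝ 1 (lagrangianVelocity J Φ t)
  hasDeriv_fderiv : ∀ t ∈ J, ∀ y,
    HasDerivWithinAt (fun s => fderiv ℝ (Φ s) y) (fderiv ℝ (lagrangianVelocity J Φ t) y) J t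
  continuous_velocity :
    ContinuousOn (fun p : ℝ × Plane => lagrangianVelocity J Φ p.1 p.2) (J ×ˢ univ)
  continuous_fderiv_velocity :
    ContinuousOn (fun p : ℝ × Plane => fderiv ℝ (lagrangianVelocity J Φ p.1) p.2) (J ×ˢ univ)

/-- The normal velocity, in the direction of the outer normal, at the point `c θ` of the boundary
curve `c` carried by the isotopy `Φ` at time `t`. -/
def normalSpeed (J : Set ℝ) (Φ : ℝ → Plane ≃ₜ Plane) (t : ℝ) (c : ℝ → Plane) (θ : ℝ) : ℝ :=
  inner ℝ (lagrangianVelocity J Φ t ((Φ t).symm (c θ))) (outerNormal c θ)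

/-- The curve `t ↦ U t ∈ H¹(D₀)`, `t ∈ J`, has the derivative `U' ∈ H¹(D₀)` at the time `t`, with
respect to the norm of `H¹(D₀)`. -/
def HasH1DerivWithinAt (D₀ : Set Plane) (U : ℝ → Plane → ℝ) (U' : Plane → ℝ) (J : Set ℝ) (t : ℝ) :
    Prop :=
  (∀ s ∈ J, MemH1 D₀ (U s)) ∧ MemH1 D₀ U' ∧
    Tendsto (fun s => h1Norm D₀ (fun y => (s - t)⁻¹ * (U s y - U t y) - U' y))
      (𝓝[J \ {t}] t) (𝓝 0)

/-- `w` is the Eulerian time derivative `∂ₜu(·,t)` on `D t`, in the sense of distributions on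
`D t`; a test function on `D t` is supported in `D s` for `s` near `t` when `D` moves
continuously. -/
def HasTimeDeriv (J : Set ℝ) (D : ℝ → Set Plane) (u : ℝ → Plane → ℝ) (t : ℝ) (w : Plane → ℝ) :
    Prop :=
  LocallyIntegrableOn w (D t) ∧ ∀ φ, IsTestFun (D t) φ →
    HasDerivWithinAt (fun s => ∫ x in D s, u s x * φ x) (∫ x in D t, w x * φ x) J t

/-! ### Droplets -/

/-- Physical constants: the surface tensions `γlg, γsl, γsg`, the density `ρ`, the
gravitational acceleration `g` (of either sign: sessile or pendant droplets), and the friction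
coefficients `R` of the contact line and `ζ` of the capillary surface. -/
structure DropletParams where
  γlg : ℝ
  γsl : ℝ
  γsg : ℝ
  ρ : ℝ
  g : ℝ
  R : ℝ
  ζ : ℝ

/-- The relative adhesion coefficient `σ = (γsl - γsg) / γlg`. -/
def DropletParams.σ (P : DropletParams) : ℝ := (P.γsl - P.γsg) / P.γlg

/-- The capillary coefficient `ς = ρ g / γlg`. -/
def DropletParams.capillary (P : DropletParams) : ℝ := P.ρ * P.g / P.γlg

/-- The surface element `√(1 + |p|²)` of a graph with gradient `p`. -/
def areaElt (p : Plane) : ℝ := √(1 + ‖p‖ ^ 2)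

/-- The free energy `γlg ∫_D √(1+|∇u|²) + (γsl - γsg) |D| + ρ g ∫_D u²/2`. -/
def energy (P : DropletParams) (D : Set Plane) (u : Plane → ℝ) : ℝ :=
  P.γlg * (∫ x in D, areaElt (weakGrad D u x)) + (P.γsl - P.γsg) * volume.real D
    + P.ρ * P.g * ∫ x in D, u x ^ 2 / 2

/-- The field `∇u / √(1+|∇u|²)`, whose divergence is the mean curvature of the graph of `u`. -/
def curvatureFlux (D : Set Plane) (u : Plane → ℝ) (x : Plane) : Plane :=
  (areaElt (weakGrad D u x))⁻¹ • weakGrad D u x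

/-- A differentiable trajectory `t ↦ (D t, u t)`, `t ∈ J`, of droplet configurations:
`u t ∈ H¹₀(D t)`, `u t ≥ 0`, the domains `D t` are the images of a reference domain `D₀` under a
`C¹` isotopy `Φ`, and the pulled back profiles `u t ∘ Φ t` form a differentiable curve in
`H¹(D₀)`. -/
structure IsDropletTrajectory (J : Set ℝ) (D₀ : Set Plane) (Φ : ℝ → Plane ≃ₜ Plane)
    (D : ℝ → Set Plane) (u : ℝ → Plane → ℝ) : Prop where
  isotopy : IsC1Isotopy J Φ
  image_eq : ∀ t ∈ J, D t = Φ t '' D₀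
  memH10 : ∀ t ∈ J, MemH10 (D t) (u t)
  nonneg : ∀ t ∈ J, ∀ᵐ x ∂(volume.restrict (D t)), 0 ≤ u t x
  differentiable : ∀ t ∈ J, ∃ U', HasH1DerivWithinAt D₀ (fun s y => u s (Φ s y)) U' J t

/-- `(Γ(t), u(t), λ(t))`, `t ∈ [0,T]`, solves the dynamic droplet problem with volume `V`. Here
`Γ(t) = ∂D(t)` is parametrized by `c t`, `ut t` is `∂ₜu(·,t)`, and `q t` is the trace of the
gradient `∇u(·,t)` on `Γ(t)`. -/
structure IsDropletSolution (P : DropletParams) (T V : ℝ) (D₀ : Set Plane)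
    (Φ : ℝ → Plane ≃ₜ Plane) (D : ℝ → Set Plane) (c : ℝ → ℝ → Plane) (u ut : ℝ → Plane → ℝ)
    (q : ℝ → ℝ → Plane) (lam : ℝ → ℝ) : Prop where
  trajectory : IsDropletTrajectory (Icc 0 T) D₀ Φ D u
  jordan : ∀ t ∈ Icc 0 T, IsC1JordanDomain (D t) (c t)
  memH2 : ∀ t ∈ Icc 0 T, MemH2 (D t) (u t)
  timeDeriv : ∀ t ∈ Icc 0 T, HasTimeDeriv (Icc 0 T) D u t (ut t)
  gradTrace : ∀ t ∈ Icc 0 T, ∀ i : Fin 2,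
    HasTrace (D t) (c t) (fun x => weakGrad (D t) (u t) x i) (fun θ => q t θ i)
  /-- `(ζ/γlg) ∂ₜu / √(1+|∇u|²) = ∇·(∇u / √(1+|∇u|²)) - ς u + λ/γlg` in `D(t)` -/
  surface : ∀ t ∈ Icc 0 T, ∃ d, HasWeakDiv (D t) (curvatureFlux (D t) (u t)) d ∧
    ∀ᵐ x ∂(volume.restrict (D t)),
      P.ζ / P.γlg * (ut t x / areaElt (weakGrad (D t) (u t) x)) =
        d x - P.capillary * u t x + 1 / P.γlg * lam t
  /-- `(R/γlg) v_cl = -σ - 1 / √(1+|∇u|²)` on `Γ(t)` -/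
  contactLine : ∀ t ∈ Icc 0 T, ∀ᵐ θ ∂paramMeasure,
    P.R / P.γlg * normalSpeed (Icc 0 T) Φ t (c t) θ = -P.σ - 1 / areaElt (q t θ)
  volume_eq : ∀ t ∈ Icc 0 T, ∫ x in D t, u t x = V

/-- `δ` represents the first variation `δF/δΓ` at the droplet `(D, u)` of volume `V`:
along every virtual trajectory of droplets of volume `V` through `(D, u)`, in particular along
every one made of quasi-static profiles, the energy changes at the rate `∫_Γ δ ṽ_cl ds`. -/
def IsFirstVariation (P : DropletParams) (V : ℝ) (D : Set Plane) (c : ℝ → Plane)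
    (u : Plane → ℝ) (δ : ℝ → ℝ) : Prop :=
  ∀ a b t : ℝ, a < b → t ∈ Icc a b →
    ∀ (D₀' : Set Plane) (Φ' : ℝ → Plane ≃ₜ Plane) (D' : ℝ → Set Plane) (u' : ℝ → Plane → ℝ),
      IsDropletTrajectory (Icc a b) D₀' Φ' D' u' →
      (∀ s ∈ Icc a b, ∫ x in D' s, u' s x = V) →
      D' t = D → u' t =ᵐ[volume.restrict D] u →
      HasDerivWithinAt (fun s => energy P (D' s) (u' s))
        (arcIntegral c (fun θ => δ θ * normalSpeed (Icc a b) Φ' t c θ)) (Icc a b) t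

/-- `u` is the quasi-static profile on `D` with volume `V` and multiplier `l`:
`u ∈ H²(D) ∩ H¹₀(D)` and `∇·(∇u / √(1+|∇u|²)) - ς u + l/γlg = 0` in `D`. -/
def IsQuasiStaticProfile (P : DropletParams) (V : ℝ) (D : Set Plane) (u : Plane → ℝ) (l : ℝ) :
    Prop :=
  MemH2 D u ∧ MemH10 D u ∧ ∫ x in D, u x = V ∧
    ∃ d, HasWeakDiv D (curvatureFlux D u) d ∧
      ∀ᵐ x ∂(volume.restrict D), d x - P.capillary * u x + 1 / P.γlg * l = 0

/-- The contact angle `θ_cl ∈ [0, π/2)` at a boundary point where `∇u = p`: `tan θ_cl = |p|`. -/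
def contactAngle (p : Plane) : ℝ := Real.arctan ‖p‖

end

/-!
The energy is a functional of a moving domain, so everything is computed after freezing the domain:
at a given time `t` the configuration at the time `t` is taken as the reference (`isotopyFrom`), and
the profiles `u (Ψ s ·) s` become a curve with values in a fixed `H¹₀(D)`. Its derivative `U'` again
belongs to `H¹₀(D)`, because this space is closed (`IsDropletTrajectory.exists_hasLpDeriv`). Area
element, volume and gravitational energy are then differentiated under the integral sign, as curves
in `Lᵖ` (`HasLpDeriv`, `HasLpDeriv.sqrt`, `IsC1Isotopy.hasDerivWithinAt_setIntegral`).

Back at fixed points of the plane the time derivative is `w = U' - ∇u·V`, where `V` is the velocity of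
the isotopy. As `u ∈ H²`, this is a function in `H¹(D)`, and as `U'` vanishes on the boundary, its
trace is `-∇u·V`. On the boundary curve `∇u = -|∇u| n` (`trace_grad_eq`), so the trace of `w` is
`|∇u| v_cl`. The formula `∇u = -|∇u| n` has two halves. The tangential component vanishes because the
rotated gradient is divergence free (`tangential_eq_zero`). The normal component has the right sign
because `u ≥ 0` (`normal_nonpos`): for `φ ≥ 0`, the integral of `div (φ ∇u)` over `{u > 0}` is the
limit of its integrals against functions of `u` that vanish on the boundary, which makes it
nonpositive, while `div (φ ∇u)` vanishes almost everywhere on `{u = 0}`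
(`HasSobolevTrace.grad_eq_zero`).

Integrating by parts once more turns the derivative of the energy into a boundary integral of
`γ_lg (σ + 1 / √(1 + |∇u|²)) v_cl` and the integral of `w` against the Euler–Lagrange expression
(`area_variation`, `IsDropletTrajectory.exists_eulerian`). For a solution the latter expression is
`-ζ ∂ₜu / √(1 + |∇u|²)` plus the multiplier, and the multiplier drops out because constancy of the
volume means `∫ w = 0` (`IsDropletSolution.first_variation`). This holds for every trajectory of
constant volume through the given droplet, not only for the solution itself; with the contact line
law it yields the dissipation identity and, for `ζ = 0`, the gradient flow. The statement on Young's
angle is the contact line law together with the monotonicity of the cosine.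

Integration by parts rests on the Gauss–Green formula for domains bounded by a `C¹` Jordan curve
(`IsC1JordanDomain.gaussGreen`). The curve is only `C¹`, so there are no normal coordinates; the strip
charts `(θ, s) ↦ c θ + s N` with a constant vector `N` have a Jacobian independent of `s`, and in them
the formula is Fubini's theorem and the fundamental theorem of calculus. Sobolev functions with a
trace are handled as limits of `C¹` functions on the plane (`HasSobolevTrace`).
-/

noncomputable section

/-! ### Planar linear algebra -/

/-- The standard basis vector `e_i` of the plane. -/
abbrev planeBasis (i : Fin 2) : Plane := EuclideanSpace.single i (1 : ℝ)

/-- The determinant of two vectors of the plane. -/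
def det2 (a b : Plane) : ℝ := a 0 * b 1 - a 1 * b 0

lemma plane_eq_sum (v : Plane) : v = v 0 • planeBasis 0 + v 1 • planeBasis 1 := by
  ext i; fin_cases i <;> simp

lemma plane_inner (v w : Plane) : inner ℝ v w = v 0 * w 0 + v 1 * w 1 := by
  simp [PiLp.inner_apply, Fin.sum_univ_two, mul_comm]

lemma plane_norm_sq (v : Plane) : ‖v‖ ^ 2 = v 0 ^ 2 + v 1 ^ 2 := by
  rw [← real_inner_self_eq_norm_sq, plane_inner]; ring

lemma plane_abs_apply_le (v : Plane) (i : Fin 2) : |v i| ≤ ‖v‖ := by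
  simpa using PiLp.norm_apply_le v i

lemma plane_clm_det (A : Plane →L[ℝ] Plane) :
    A.det = det2 (A (planeBasis 0)) (A (planeBasis 1)) := by
  have h := LinearMap.det_toMatrix (EuclideanSpace.basisFun (Fin 2) ℝ).toBasis (A : Plane →ₗ[ℝ] Plane)
  rw [ContinuousLinearMap.det, ← h, Matrix.det_fin_two]
  simp [LinearMap.toMatrix_apply, det2]
  ring

/-- Cramer's rule. -/
lemma det2_smul_eq (a b v : Plane) : det2 a b • v = det2 v b • a + det2 a v • b := by
  ext i; fin_cases i <;> simp [det2] <;> ring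

lemma det2_continuous : Continuous fun p : Plane × Plane => det2 p.1 p.2 := by
  unfold det2; fun_prop

lemma inner_outerNormal (c : ℝ → Plane) (θ : ℝ) (v : Plane) :
    inner ℝ v (outerNormal c θ) * ‖deriv c θ‖ = - det2 (deriv c θ) v := by
  unfold outerNormal det2
  rw [inner_smul_right, plane_inner]
  by_cases h : deriv c θ = 0
  · simp [h]
  · have := norm_ne_zero_iff.2 h
    simp
    field_simp
    ring

lemma det2_neg_outerNormal (c : ℝ → Plane) (θ : ℝ) (h : deriv c θ ≠ 0) :
    0 < det2 (deriv c θ) (-outerNormal c θ) := by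
  have hn := norm_pos_iff.2 h
  have h1 := inner_outerNormal c θ (-outerNormal c θ)
  have h2 : inner ℝ (-outerNormal c θ) (outerNormal c θ) = -1 := by
    rw [inner_neg_left, real_inner_self_eq_norm_sq, plane_norm_sq]
    unfold outerNormal
    have h3 := plane_norm_sq (deriv c θ)
    simp
    field_simp
    linarith
  rw [h2] at h1
  linarith

/-! ### Strip charts along a `C¹` curve -/

/-- The parametrization `(θ, s) ↦ c θ + s N` of a strip around the curve `c`, for a fixed
transversal vector `N`. Its Jacobian `det (c' θ, N)` does not depend on `s`. -/
def stripMap (c : ℝ → Plane) (N : Plane) (y : Plane) : Plane := c (y 0) + y 1 • N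

/-- The differential of `stripMap c N` at points with first coordinate `θ`. -/
def stripDeriv (c : ℝ → Plane) (N : Plane) (θ : ℝ) : Plane →L[ℝ] Plane :=
  (EuclideanSpace.proj 0 : Plane →L[ℝ] ℝ).smulRight (deriv c θ) +
    (EuclideanSpace.proj 1 : Plane →L[ℝ] ℝ).smulRight N

lemma stripDeriv_apply (c : ℝ → Plane) (N : Plane) (θ : ℝ) (v : Plane) :
    stripDeriv c N θ v = v 0 • deriv c θ + v 1 • N := by
  simp [stripDeriv]

lemma stripDeriv_det (c : ℝ → Plane) (N : Plane) (θ : ℝ) :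
    (stripDeriv c N θ).det = det2 (deriv c θ) N := by
  rw [plane_clm_det]; simp [stripDeriv_apply]

lemma contDiff_stripMap {c : ℝ → Plane} (hc : ContDiff ℝ 1 c) (N : Plane) :
    ContDiff ℝ 1 (stripMap c N) := by
  have h0 : ∀ i, ContDiff ℝ 1 (fun y : Plane => y i) := fun i =>
    (EuclideanSpace.proj i : Plane →L[ℝ] ℝ).contDiff
  exact (hc.comp (h0 0)).add ((h0 1).smul contDiff_const)

lemma hasFDerivAt_stripMap {c : ℝ → Plane} (hc : ContDiff ℝ 1 c) (N : Plane) (y : Plane) :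
    HasFDerivAt (stripMap c N) (stripDeriv c N (y 0)) y := by
  have h0 : ∀ i, HasFDerivAt (fun y : Plane => y i) (EuclideanSpace.proj i : Plane →L[ℝ] ℝ) y :=
    fun i => (EuclideanSpace.proj i : Plane →L[ℝ] ℝ).hasFDerivAt
  have h1 : HasDerivAt c (deriv c (y 0)) (y 0) := (hc.differentiable one_ne_zero _).hasDerivAt
  have h2 := (h1.hasFDerivAt.comp y (h0 0)).add ((h0 1).smul_const N)
  refine h2.congr_fderiv ?_
  ext1 v
  simp [stripDeriv_apply]

/-- The open rectangle of half widths `ε, η` around `(θ₀, 0)`. -/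
def stripBox (θ₀ ε η : ℝ) : Set Plane := {y | |y 0 - θ₀| < ε ∧ |y 1| < η}

/-- The closed rectangle of half widths `ε, η` around `(θ₀, 0)`. -/
def closedStripBox (θ₀ ε η : ℝ) : Set Plane := {y | |y 0 - θ₀| ≤ ε ∧ |y 1| ≤ η}

/-- `stripMap c N` is a chart on the rectangle of half widths `ε, η` around `(θ₀, 0)`, and the
chart domain contains no part of the closed curve `c` but the arc `|θ - θ₀| < ε`. -/
structure IsStripChart (c : ℝ → Plane) (N : Plane) (θ₀ ε η : ℝ) : Prop where
  ε_pos : 0 < ε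
  ε_lt : ε < 1 / 2
  η_pos : 0 < η
  injOn : InjOn (stripMap c N) (closedStripBox θ₀ ε η)
  isOpen : IsOpen (stripMap c N '' stripBox θ₀ ε η)
  det_pos : ∀ θ, |θ - θ₀| ≤ ε → 0 < det2 (deriv c θ) N
  arc : ∀ θ ∈ Icc (θ₀ - 1 / 2) (θ₀ + 1 / 2), c θ ∈ stripMap c N '' stripBox θ₀ ε η → |θ - θ₀| < ε

lemma isOpen_stripBox (θ₀ ε η : ℝ) : IsOpen (stripBox θ₀ ε η) := by
  have h1 : IsOpen {y : Plane | |y 0 - θ₀| < ε} := isOpen_lt (by fun_prop) continuous_const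
  have h2 : IsOpen {y : Plane | |y 1| < η} := isOpen_lt (by fun_prop) continuous_const
  exact h1.inter h2

lemma stripBox_subset_closed (θ₀ ε η : ℝ) : stripBox θ₀ ε η ⊆ closedStripBox θ₀ ε η :=
  fun _ h => ⟨h.1.le, h.2.le⟩

lemma closedStripBox_mem_nhds_subset {θ₀ : ℝ} {U : Set Plane} (hU : U ∈ 𝓝 (!₂[θ₀, 0] : Plane)) :
    ∃ ε > 0, ∀ ε' η', ε' ≤ ε → η' ≤ ε → closedStripBox θ₀ ε' η' ⊆ U := by
  obtain ⟨r, hr, hrU⟩ := Metric.mem_nhds_iff.1 hU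
  refine ⟨r / 2, by positivity, fun ε' η' h1 h2 y hy => hrU ?_⟩
  rw [Metric.mem_ball, dist_eq_norm]
  have h3 := plane_norm_sq (y - !₂[θ₀, 0])
  simp at h3
  have h4 : (y 0 - θ₀) ^ 2 ≤ (r / 2) ^ 2 := sq_le_sq' (by linarith [abs_le.1 hy.1]) (by linarith [abs_le.1 hy.1])
  have h5 : (y 1) ^ 2 ≤ (r / 2) ^ 2 := sq_le_sq' (by linarith [abs_le.1 hy.2]) (by linarith [abs_le.1 hy.2])
  refine lt_of_pow_lt_pow_left₀ 2 hr.le ?_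
  rw [h3]; nlinarith

/-- Strip charts exist at every boundary point: the inverse function theorem gives a chart near the
point, and by injectivity the rest of the closed curve has a positive distance from the point, so that
a smaller box meets the curve only in its middle line. -/
theorem exists_isStripChart {D : Set Plane} {c : ℝ → Plane} (h : IsC1JordanDomain D c) (θ₀ : ℝ) :
    ∃ ε η, IsStripChart c (-outerNormal c θ₀) θ₀ ε η := by
  set N := -outerNormal c θ₀ with hN
  have hdet : 0 < det2 (deriv c θ₀) N := det2_neg_outerNormal c θ₀ (h.regular θ₀)
  set p : Plane := !₂[θ₀, 0] with hp
  have hFp : stripMap c N p = c θ₀ := by simp [stripMap, hp]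
  have hstrict : HasStrictFDerivAt (stripMap c N) (stripDeriv c N θ₀) p := by
    have := (contDiff_stripMap h.contDiff N).contDiffAt.hasStrictFDerivAt' (x := p)
      (hasFDerivAt_stripMap h.contDiff N p) one_ne_zero
    simpa [hp] using this
  have hunit : (stripDeriv c N θ₀).det ≠ 0 := by rw [stripDeriv_det]; exact hdet.ne'
  have hstrict' : HasStrictFDerivAt (stripMap c N)
      (((stripDeriv c N θ₀).toContinuousLinearEquivOfDetNeZero hunit : Plane ≃L[ℝ] Plane) :
        Plane →L[ℝ] Plane) p := by
    simpa using hstrict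
  set e := hstrict'.toOpenPartialHomeomorph (stripMap c N) with he
  have hsrc : e.source ∈ 𝓝 p := e.open_source.mem_nhds hstrict'.mem_toOpenPartialHomeomorph_source
  have hecoe : ⇑e = stripMap c N := hstrict'.toOpenPartialHomeomorph_coe
  obtain ⟨ε₁, hε₁, hbox₁⟩ := closedStripBox_mem_nhds_subset hsrc
  have hcont : Continuous (fun θ => det2 (deriv c θ) N) := by
    have : Continuous (deriv c) := h.contDiff.continuous_deriv le_rfl
    exact det2_continuous.comp (this.prodMk continuous_const)
  obtain ⟨ε₂, hε₂, hpos⟩ := Metric.eventually_nhds_iff.1 ((hcont.tendsto θ₀).eventually_const_lt hdet)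
  set ε := min (min (ε₁ / 2) (ε₂ / 2)) (1 / 4) with hε
  have hεpos : 0 < ε := by positivity
  -- the rest of the curve has a positive distance to `c θ₀`
  set K := {θ | θ ∈ Icc (θ₀ - 1 / 2) (θ₀ + 1 / 2) ∧ ε ≤ |θ - θ₀|} with hK
  have hKc : IsCompact K :=
    isCompact_Icc.inter_right
      (isClosed_le continuous_const ((continuous_id.sub continuous_const).abs))
  have hcK : IsClosed (c '' K) := (hKc.image h.contDiff.continuous).isClosed
  have hnot : c θ₀ ∉ c '' K := by
    rintro ⟨θ, ⟨hθ, hθε⟩, hθc⟩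
    have hper : ∀ x, c (Int.fract x) = c x := fun x => by
      have := h.periodic.sub_zsmul_eq ⌊x⌋ (x := x)
      rwa [zsmul_one, Int.self_sub_floor] at this
    have hfr : Int.fract θ = Int.fract θ₀ :=
      h.injOn ⟨Int.fract_nonneg _, Int.fract_lt_one _⟩ ⟨Int.fract_nonneg _, Int.fract_lt_one _⟩
        (by rw [hper, hper, hθc])
    obtain ⟨z, hz⟩ := Int.fract_eq_fract.1 hfr
    have h1 : |(z : ℝ)| < 1 := by
      rw [← hz]; refine lt_of_le_of_lt (abs_le.2 ⟨by linarith [hθ.1], by linarith [hθ.2]⟩) (by norm_num : (1 / 2 : ℝ) < 1)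
    have h2 : z = 0 := by
      have : |z| < 1 := by exact_mod_cast h1
      exact Int.abs_lt_one_iff.1 this
    rw [hz, h2] at hθε
    simp at hθε
    linarith
  have hnb : stripMap c N ⁻¹' (c '' K)ᶜ ∈ 𝓝 p :=
    (contDiff_stripMap h.contDiff N).continuous.continuousAt.preimage_mem_nhds
      (by rw [hFp]; exact hcK.isOpen_compl.mem_nhds hnot)
  obtain ⟨ε₃, hε₃, hbox₃⟩ := closedStripBox_mem_nhds_subset hnb
  set δ := min ε ε₃ with hδ
  have hδpos : 0 < δ := lt_min hεpos hε₃
  have hδε : δ ≤ ε := min_le_left _ _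
  have hεε₁ : ε ≤ ε₁ := by
    have : ε ≤ ε₁ / 2 := (min_le_left _ _).trans (min_le_left _ _)
    linarith
  have hεε₂ : ε < ε₂ := by
    have : ε ≤ ε₂ / 2 := (min_le_left _ _).trans (min_le_right _ _)
    linarith
  have hε4 : ε ≤ 1 / 4 := min_le_right _ _
  have hinj : InjOn (stripMap c N) (closedStripBox θ₀ ε ε) := by
    have := e.injOn
    rw [hecoe] at this
    exact this.mono (hbox₁ _ _ hεε₁ hεε₁)
  have hsub : closedStripBox θ₀ δ δ ⊆ closedStripBox θ₀ ε ε := fun y hy => ⟨hy.1.trans hδε, hy.2.trans hδε⟩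
  refine ⟨δ, δ, hδpos, by linarith, hδpos, hinj.mono hsub, ?_, ?_, ?_⟩
  · have := e.isOpen_image_of_subset_source (isOpen_stripBox θ₀ δ δ)
      ((stripBox_subset_closed _ _ _).trans (hsub.trans (hbox₁ _ _ hεε₁ hεε₁)))
    rwa [hecoe] at this
  · intro θ hθ
    refine hpos ?_
    rw [Real.dist_eq]; linarith
  · rintro θ hθ ⟨y, hy, hyc⟩
    have hθε : |θ - θ₀| < ε := by
      by_contra hcon
      have h1 : c θ ∈ c '' K := ⟨θ, ⟨hθ, not_lt.1 hcon⟩, rfl⟩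
      exact hbox₃ δ δ (min_le_right _ _) (min_le_right _ _) (stripBox_subset_closed _ _ _ hy) (hyc ▸ h1)
    have h2 : stripMap c N y = stripMap c N !₂[θ, 0] := by rw [hyc]; simp [stripMap]
    have h3 := hinj (hsub (stripBox_subset_closed _ _ _ hy)) (show !₂[θ, 0] ∈ closedStripBox θ₀ ε ε from
      ⟨by simpa using hθε.le, by simpa using hεpos.le⟩) h2
    have := hy.1
    rw [h3] at this
    simpa using this

/-! ### The domain near its boundary curve -/

lemma IsC1JordanDomain.closure_eq {D : Set Plane} {c : ℝ → Plane} (h : IsC1JordanDomain D c) :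
    closure D = D ∪ range c := by
  rw [closure_eq_self_union_frontier, h.frontier_eq]

lemma IsC1JordanDomain.curve_notMem {D : Set Plane} {c : ℝ → Plane} (h : IsC1JordanDomain D c)
    (θ : ℝ) : c θ ∉ D := by
  have h1 : c θ ∈ frontier D := h.frontier_eq ▸ mem_range_self θ
  rw [h.isOpen.frontier_eq] at h1
  exact h1.2

lemma subset_or_disjoint_of_isPreconnected {X : Type*} [TopologicalSpace X] {D S : Set X}
    (hD : IsOpen D) (hS : IsPreconnected S) (h : Disjoint S (frontier D)) : S ⊆ D ∨ Disjoint S D := by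
  have h2 := hS.subset_or_subset hD (isClosed_closure (s := D)).isOpen_compl
    (disjoint_compl_right.mono_right (compl_subset_compl.2 subset_closure)) (fun x hx => by
      by_cases hxD : x ∈ D
      · exact Or.inl hxD
      · right
        intro hcl
        exact disjoint_left.1 h hx (by rw [hD.frontier_eq]; exact ⟨hcl, hxD⟩))
  refine h2.imp id fun h3 => disjoint_left.2 fun x hx hxD => h3 hx (subset_closure hxD)

section Chart
variable {D : Set Plane} {c : ℝ → Plane} {N : Plane} {θ₀ ε η : ℝ}

lemma IsC1JordanDomain.exists_shift (h : IsC1JordanDomain D c) (θ₀ θ : ℝ) :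
    ∃ θ' ∈ Icc (θ₀ - 1 / 2) (θ₀ + 1 / 2), c θ' = c θ := by
  obtain ⟨y, hy, hyc⟩ := h.periodic.exists_mem_Ico one_pos θ (θ₀ - 1 / 2)
  exact ⟨y, ⟨hy.1, by linarith [hy.2]⟩, hyc.symm⟩

/-- Inside a strip chart the boundary curve is the axis `s = 0`. -/
lemma IsStripChart.mem_range_iff (h : IsC1JordanDomain D c) (hch : IsStripChart c N θ₀ ε η)
    {y : Plane} (hy : y ∈ stripBox θ₀ ε η) : stripMap c N y ∈ range c ↔ y 1 = 0 := by
  constructor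
  · rintro ⟨θ, hθ⟩
    obtain ⟨θ', hθ', hc⟩ := h.exists_shift θ₀ θ
    have hmem : c θ' ∈ stripMap c N '' stripBox θ₀ ε η := ⟨y, hy, by rw [hc, hθ]⟩
    have h1 := hch.arc θ' hθ' hmem
    have h2 : stripMap c N y = stripMap c N !₂[θ', 0] := by rw [← hθ, ← hc]; simp [stripMap]
    have h3 := hch.injOn (stripBox_subset_closed _ _ _ hy) (show !₂[θ', 0] ∈ closedStripBox θ₀ ε η from
      ⟨by simpa using h1.le, by simpa using hch.η_pos.le⟩) h2
    rw [h3]; simp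
  · intro h0
    exact ⟨y 0, by simp [stripMap, h0]⟩

lemma isPreconnected_halfBox (hc : ContDiff ℝ 1 c) (θ₀ ε a b : ℝ) :
    IsPreconnected (stripMap c N '' {y | |y 0 - θ₀| < ε ∧ a < y 1 ∧ y 1 < b}) := by
  refine IsPreconnected.image ?_ _ (contDiff_stripMap hc N).continuous.continuousOn
  have hconv : Convex ℝ {y : Plane | |y 0 - θ₀| < ε ∧ a < y 1 ∧ y 1 < b} := by
    have h0 : {y : Plane | |y 0 - θ₀| < ε ∧ a < y 1 ∧ y 1 < b} =
        (EuclideanSpace.proj 0 : Plane →L[ℝ] ℝ) ⁻¹' Ioo (θ₀ - ε) (θ₀ + ε) ∩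
        (EuclideanSpace.proj 1 : Plane →L[ℝ] ℝ) ⁻¹' Ioo a b := by
      ext y
      simp [abs_lt]
      intros
      constructor <;> rintro ⟨h1, h2⟩ <;> constructor <;> linarith
    rw [h0]
    exact ((convex_Ioo _ _).linear_preimage (EuclideanSpace.proj 0 : Plane →L[ℝ] ℝ).toLinearMap).inter
      ((convex_Ioo _ _).linear_preimage (EuclideanSpace.proj 1 : Plane →L[ℝ] ℝ).toLinearMap)
  exact hconv.isPreconnected

lemma IsStripChart.disjoint_frontier (h : IsC1JordanDomain D c) (hch : IsStripChart c N θ₀ ε η)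
    {S : Set Plane} (hS : S ⊆ stripBox θ₀ ε η) (h0 : ∀ y ∈ S, y 1 ≠ 0) :
    Disjoint (stripMap c N '' S) (frontier D) := by
  rw [h.frontier_eq, disjoint_left]
  rintro _ ⟨y, hy, rfl⟩ hr
  exact h0 y hy ((hch.mem_range_iff h (hS hy)).1 hr)

/-- The inner half of the strip lies in the domain, by the orientation of the curve. -/
lemma IsStripChart.inner_subset (h : IsC1JordanDomain D c)
    (hch : IsStripChart c (-outerNormal c θ₀) θ₀ ε η) :
    stripMap c (-outerNormal c θ₀) '' {y | |y 0 - θ₀| < ε ∧ 0 < y 1 ∧ y 1 < η} ⊆ D := by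
  have hsub : {y : Plane | |y 0 - θ₀| < ε ∧ 0 < y 1 ∧ y 1 < η} ⊆ stripBox θ₀ ε η := fun y hy =>
    ⟨hy.1, abs_lt.2 ⟨by linarith [hy.2.1, hch.η_pos], hy.2.2⟩⟩
  rcases subset_or_disjoint_of_isPreconnected h.isOpen (isPreconnected_halfBox h.contDiff θ₀ ε 0 η)
    (hch.disjoint_frontier h hsub fun y hy => hy.2.1.ne') with h1 | h1
  · exact h1
  · exfalso
    obtain ⟨s, hs1, hs2, hs3⟩ := ((h.oriented θ₀).and (Ioo_mem_nhdsGT hch.η_pos)).exists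
    refine disjoint_left.1 h1 ⟨!₂[θ₀, s], ⟨by simpa using hch.ε_pos, by simpa using hs2, by simpa using hs3⟩, ?_⟩ hs1
    simp [stripMap, sub_eq_add_neg]

/-- The closure of a bounded planar open set with boundary a closed curve does not fill a
neighbourhood of a point of the curve: otherwise it would do so along the whole curve, and the
closure would be open and closed. -/
lemma IsC1JordanDomain.curve_notMem_interior (h : IsC1JordanDomain D c) (θ : ℝ) :
    c θ ∉ interior (closure D) := by
  set O := {θ | c θ ∈ interior (closure D)} with hO
  have hopen : IsOpen O := isOpen_interior.preimage h.contDiff.continuous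
  have hcompl : IsOpen Oᶜ := by
    rw [isOpen_iff_mem_nhds]
    intro θ₀ hθ₀
    obtain ⟨ε, η, hch⟩ := exists_isStripChart h θ₀
    set N := -outerNormal c θ₀
    have hin := hch.inner_subset h
    have hsub : {y : Plane | |y 0 - θ₀| < ε ∧ -η < y 1 ∧ y 1 < 0} ⊆ stripBox θ₀ ε η := fun y hy =>
      ⟨hy.1, abs_lt.2 ⟨hy.2.1, by linarith [hy.2.2, hch.η_pos]⟩⟩
    have hdisj := hch.disjoint_frontier h hsub fun y hy => hy.2.2.ne
    rcases subset_or_disjoint_of_isPreconnected h.isOpen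
      (isPreconnected_halfBox h.contDiff θ₀ ε (-η) 0) hdisj with h1 | h1
    · exfalso
      apply hθ₀
      refine mem_interior.2 ⟨_, ?_, hch.isOpen, ⟨!₂[θ₀, 0], ⟨by simpa using hch.ε_pos, by simpa using hch.η_pos⟩, by simp [stripMap]⟩⟩
      rintro _ ⟨y, hy, rfl⟩
      rcases lt_trichotomy (y 1) 0 with hy0 | hy0 | hy0
      · exact subset_closure (h1 ⟨y, ⟨hy.1, (abs_lt.1 hy.2).1, hy0⟩, rfl⟩)
      · rw [h.closure_eq]; exact Or.inr ((hch.mem_range_iff h hy).2 hy0)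
      · exact subset_closure (hin ⟨y, ⟨hy.1, hy0, (abs_lt.1 hy.2).2⟩, rfl⟩)
    · have : {θ | |θ - θ₀| < ε} ∈ 𝓝 θ₀ := by
        have := Metric.ball_mem_nhds θ₀ hch.ε_pos
        simpa [Metric.ball, Real.dist_eq] using this
      filter_upwards [this] with θ hθ hint
      have hlim : Tendsto (fun s : ℝ => stripMap c N !₂[θ, s]) (𝓝[<] 0) (𝓝 (c θ)) := by
        have : Continuous (fun s : ℝ => c θ + s • N) := by fun_prop
        have := this.tendsto 0
        simp only [zero_smul, add_zero] at this
        simpa [stripMap] using this.mono_left nhdsWithin_le_nhds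
      have hev := hlim.eventually (isOpen_interior.mem_nhds hint)
      obtain ⟨s, hs1, hs2, hs3⟩ :=
        (hev.and (Ioo_mem_nhdsLT (show -η < 0 by linarith [hch.η_pos]))).exists
      have hmem : stripMap c N !₂[θ, s] ∈ stripMap c N '' {y : Plane | |y 0 - θ₀| < ε ∧ -η < y 1 ∧ y 1 < 0} :=
        ⟨_, ⟨by simpa using hθ, by simpa using hs2, by simpa using hs3⟩, rfl⟩
      have hcl := interior_subset hs1
      rw [closure_eq_self_union_frontier] at hcl
      exact hcl.elim (disjoint_left.1 h1 hmem) (disjoint_left.1 hdisj hmem)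
  rcases isClopen_iff.1 (⟨⟨hcompl⟩, hopen⟩ : IsClopen O) with hemp | huniv
  · intro hθ
    have : θ ∈ O := hθ
    rw [hemp] at this
    exact this
  · exfalso
    have hclopen : IsClopen (closure D) := by
      refine ⟨isClosed_closure, ?_⟩
      rw [← subset_interior_iff_isOpen]
      conv_lhs => rw [h.closure_eq]
      refine union_subset ?_ ?_
      · rw [← h.isOpen.interior_eq]; exact interior_mono (h.isOpen.interior_eq.symm ▸ subset_closure)
      · rintro _ ⟨θ, rfl⟩
        have : θ ∈ O := huniv ▸ mem_univ θ
        exact this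
    rcases isClopen_iff.1 hclopen with h1 | h1
    · have : c 0 ∈ closure D := by rw [h.closure_eq]; exact Or.inr ⟨0, rfl⟩
      rw [h1] at this
      exact this
    · have := h.isBounded.closure
      rw [h1] at this
      exact NormedSpace.unbounded_univ ℝ Plane this

/-- The outer half of the strip lies outside the domain. -/
lemma IsStripChart.outer_disjoint (h : IsC1JordanDomain D c)
    (hch : IsStripChart c (-outerNormal c θ₀) θ₀ ε η) :
    Disjoint (stripMap c (-outerNormal c θ₀) '' {y | |y 0 - θ₀| < ε ∧ -η < y 1 ∧ y 1 < 0}) D := by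
  have hsub : {y : Plane | |y 0 - θ₀| < ε ∧ -η < y 1 ∧ y 1 < 0} ⊆ stripBox θ₀ ε η := fun y hy =>
    ⟨hy.1, abs_lt.2 ⟨hy.2.1, by linarith [hy.2.2, hch.η_pos]⟩⟩
  have hdisj := hch.disjoint_frontier h hsub fun y hy => hy.2.2.ne
  refine (subset_or_disjoint_of_isPreconnected h.isOpen
      (isPreconnected_halfBox h.contDiff θ₀ ε (-η) 0) hdisj).resolve_left fun h1 => ?_
  apply h.curve_notMem_interior θ₀
  refine mem_interior.2 ⟨_, ?_, hch.isOpen, ⟨!₂[θ₀, 0], ⟨by simpa using hch.ε_pos, by simpa using hch.η_pos⟩, by simp [stripMap]⟩⟩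
  rintro _ ⟨y, hy, rfl⟩
  rcases lt_trichotomy (y 1) 0 with hy0 | hy0 | hy0
  · exact subset_closure (h1 ⟨y, ⟨hy.1, (abs_lt.1 hy.2).1, hy0⟩, rfl⟩)
  · rw [h.closure_eq]; exact Or.inr ((hch.mem_range_iff h hy).2 hy0)
  · exact subset_closure (hch.inner_subset h ⟨y, ⟨hy.1, hy0, (abs_lt.1 hy.2).2⟩, rfl⟩)

/-- In a strip chart the domain is exactly the half on the side of the inner normal. -/
lemma IsStripChart.inter_eq (h : IsC1JordanDomain D c)
    (hch : IsStripChart c (-outerNormal c θ₀) θ₀ ε η) :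
    D ∩ stripMap c (-outerNormal c θ₀) '' stripBox θ₀ ε η =
      stripMap c (-outerNormal c θ₀) '' {y | |y 0 - θ₀| < ε ∧ 0 < y 1 ∧ y 1 < η} := by
  apply Subset.antisymm
  · rintro _ ⟨hD, y, hy, rfl⟩
    rcases lt_trichotomy (y 1) 0 with hy0 | hy0 | hy0
    · exact absurd hD (disjoint_left.1 (hch.outer_disjoint h) ⟨y, ⟨hy.1, (abs_lt.1 hy.2).1, hy0⟩, rfl⟩)
    · obtain ⟨θ, hθ⟩ := (hch.mem_range_iff h hy).2 hy0
      exact absurd (hθ ▸ hD) (h.curve_notMem θ)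
    · exact ⟨y, ⟨hy.1, hy0, (abs_lt.1 hy.2).2⟩, rfl⟩
  · exact subset_inter (hch.inner_subset h) (image_mono fun y hy =>
      ⟨hy.1, abs_lt.2 ⟨by linarith [hy.2.1, hch.η_pos], hy.2.2⟩⟩)
end Chart

/-! ### The Gauss–Green formula for a `C¹` Jordan domain -/

lemma integrableOn_of_continuous_of_isBounded {E : Type*} [NormedAddCommGroup E] {D : Set Plane}
    {f : Plane → E} (hf : Continuous f) (hD : Bornology.IsBounded D) : IntegrableOn f D :=
  (hf.continuousOn.integrableOn_compact hD.isCompact_closure).mono_set subset_closure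

lemma continuous_fderiv_apply {ψ : Plane → ℝ} (hψ : ContDiff ℝ 1 ψ) (e : Plane) :
    Continuous fun x => fderiv ℝ ψ x e :=
  (hψ.continuous_fderiv one_ne_zero).clm_apply continuous_const

lemma measurePreserving_plane_prod :
    MeasurePreserving (fun y : Plane => (y 0, y 1)) volume volume := by
  have h1 := EuclideanSpace.volume_preserving_symm_measurableEquiv_toLp (Fin 2)
  exact (volume_preserving_finTwoArrow ℝ).comp h1

lemma measurableEmbedding_plane_prod : MeasurableEmbedding (fun y : Plane => (y 0, y 1)) :=
  (MeasurableEquiv.finTwoArrow (α := ℝ)).measurableEmbedding.comp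
    (MeasurableEquiv.toLp 2 (Fin 2 → ℝ)).symm.measurableEmbedding

lemma integral_plane_rectangle {a b a' b' : ℝ} (hab : a ≤ b) (hab' : a' ≤ b') {g : ℝ × ℝ → ℝ}
    (hg : Continuous g) :
    ∫ y in {y : Plane | y 0 ∈ Ioo a b ∧ y 1 ∈ Ioo a' b'}, g (y 0, y 1) =
      ∫ x in a..b, ∫ z in a'..b', g (x, z) := by
  have hint : IntegrableOn g (Ioo a b ×ˢ Ioo a' b') (volume.prod volume) :=
    (hg.continuousOn.integrableOn_compact (isCompact_Icc.prod isCompact_Icc)).mono_set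
      (prod_mono Ioo_subset_Icc_self Ioo_subset_Icc_self)
  have h1 := measurePreserving_plane_prod.setIntegral_preimage_emb measurableEmbedding_plane_prod
    g (Ioo a b ×ˢ Ioo a' b')
  have h2 : (fun y : Plane => (y 0, y 1)) ⁻¹' (Ioo a b ×ˢ Ioo a' b') =
      {y : Plane | y 0 ∈ Ioo a b ∧ y 1 ∈ Ioo a' b'} := rfl
  rw [h2] at h1
  rw [h1]
  refine (setIntegral_prod g hint).trans ?_
  rw [intervalIntegral.integral_of_le hab, integral_Ioc_eq_integral_Ioo]
  simp_rw [intervalIntegral.integral_of_le hab', integral_Ioc_eq_integral_Ioo]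

lemma integral_rectangle_swap {a b a' b' : ℝ} (hab : a ≤ b) (hab' : a' ≤ b') {g : ℝ × ℝ → ℝ}
    (hg : Continuous g) :
    ∫ x in a..b, ∫ z in a'..b', g (x, z) = ∫ z in a'..b', ∫ x in a..b, g (x, z) := by
  have hint : IntegrableOn g (Ioc a b ×ˢ Ioc a' b') (volume.prod volume) :=
    (hg.continuousOn.integrableOn_compact (isCompact_Icc.prod isCompact_Icc)).mono_set
      (prod_mono Ioc_subset_Icc_self Ioc_subset_Icc_self)
  rw [IntegrableOn, ← Measure.prod_restrict] at hint
  simp_rw [intervalIntegral.integral_of_le hab, intervalIntegral.integral_of_le hab']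
  exact integral_integral_swap hint

lemma fderiv_eq_zero_of_notMem_tsupport {ψ : Plane → ℝ} {x : Plane} (hx : x ∉ tsupport ψ) :
    fderiv ℝ ψ x = 0 := by
  by_contra h
  exact hx (support_fderiv_subset ℝ h)

lemma integral_fderiv_apply_eq_zero {ψ : Plane → ℝ} (hψ : ContDiff ℝ 1 ψ) (hc : HasCompactSupport ψ)
    (e : Plane) : ∫ x, fderiv ℝ ψ x e = 0 := by
  have h := integral_mul_fderiv_eq_neg_fderiv_mul_of_integrable (μ := (volume : Measure Plane))
    (f := fun _ => (1 : ℝ)) (g := ψ) (v := e) (by simp)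
    (by simpa using (continuous_fderiv_apply hψ e).integrable_of_hasCompactSupport (hc.fderiv_apply ℝ e))
    (by simpa using hψ.continuous.integrable_of_hasCompactSupport hc)
    (fun x _ => differentiableAt_const _) (fun x _ => hψ.differentiable one_ne_zero x)
  simpa using h

section
variable {D : Set Plane} {c : ℝ → Plane}

lemma IsC1JordanDomain.continuous_deriv (h : IsC1JordanDomain D c) : Continuous (deriv c) :=
  h.contDiff.continuous_deriv le_rfl

lemma IsC1JordanDomain.periodic_deriv (h : IsC1JordanDomain D c) :
    Function.Periodic (deriv c) 1 := fun x => by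
  have h1 : (fun y => c (y + 1)) = c := funext h.periodic
  have h2 := deriv_comp_add_const c 1 x
  rw [h1] at h2
  exact h2.symm

lemma setIntegral_fderiv_eq_of_tsupport_subset (h : IsC1JordanDomain D c) {ψ : Plane → ℝ}
    (hψ : ContDiff ℝ 1 ψ) (hs : tsupport ψ ⊆ D) (e : Plane) :
    ∫ x in D, fderiv ℝ ψ x e = 0 := by
  have hcs : HasCompactSupport ψ := h.isBounded.isCompact_closure.of_isClosed_subset
    (isClosed_tsupport ψ) (hs.trans subset_closure)
  rw [setIntegral_eq_integral_of_forall_compl_eq_zero, integral_fderiv_apply_eq_zero hψ hcs]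
  intro x hx
  rw [fderiv_eq_zero_of_notMem_tsupport (fun hx' => hx (hs hx'))]; rfl

/-- The Gauss–Green formula for functions supported in a strip chart. With
`∂_e ψ det (c', N) = ∂_{c'} ψ det (e, N) + ∂_N ψ det (c', e)`, the transformed integrand is a sum of
a `θ`-derivative and an `s`-derivative. -/
lemma IsStripChart.gaussGreen {θ₀ ε η : ℝ} (h : IsC1JordanDomain D c)
    (hch : IsStripChart c (-outerNormal c θ₀) θ₀ ε η) {ψ : Plane → ℝ} (hψ : ContDiff ℝ 1 ψ)
    (hs : tsupport ψ ⊆ stripMap c (-outerNormal c θ₀) '' stripBox θ₀ ε η) (e : Plane) :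
    ∫ x in D, fderiv ℝ ψ x e = ∫ θ in (0 : ℝ)..1, - (det2 (deriv c θ) e * ψ (c θ)) := by
  set N := -outerNormal c θ₀ with hN
  set H : Set Plane := {y | y 0 ∈ Ioo (θ₀ - ε) (θ₀ + ε) ∧ y 1 ∈ Ioo 0 η} with hH
  have hHeq : {y : Plane | |y 0 - θ₀| < ε ∧ 0 < y 1 ∧ y 1 < η} = H := by
    ext y
    simp only [hH, mem_ofPred_eq, mem_Ioo, abs_lt]
    constructor <;> rintro ⟨⟨h1, h2⟩, h3⟩ <;> exact ⟨⟨by linarith, by linarith⟩, h3⟩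
  have hHsub : H ⊆ stripBox θ₀ ε η := by
    rw [← hHeq]
    exact fun y hy => ⟨hy.1, abs_lt.2 ⟨by linarith [hy.2.1, hch.η_pos], hy.2.2⟩⟩
  have hHopen : IsOpen H := by
    have h1 : IsOpen {y : Plane | y 0 ∈ Ioo (θ₀ - ε) (θ₀ + ε)} :=
      isOpen_Ioo.preimage (by fun_prop : Continuous fun y : Plane => y 0)
    have h2 : IsOpen {y : Plane | y 1 ∈ Ioo 0 η} :=
      isOpen_Ioo.preimage (by fun_prop : Continuous fun y : Plane => y 1)
    exact h1.inter h2
  have hcd := h.contDiff.continuous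
  have hc' := h.continuous_deriv
  have hzero : ∀ y ∈ closedStripBox θ₀ ε η, y ∉ stripBox θ₀ ε η → ψ (stripMap c N y) = 0 := by
    intro y hy hy'
    by_contra hne
    obtain ⟨y', hy1, hy2⟩ := hs (subset_tsupport ψ hne)
    exact hy' (hch.injOn (stripBox_subset_closed _ _ _ hy1) hy hy2 ▸ hy1)
  -- transformation to the rectangle
  have e1 : ∫ x in D, fderiv ℝ ψ x e =
      ∫ y in H, det2 (deriv c (y 0)) N * fderiv ℝ ψ (c (y 0) + y 1 • N) e := by
    have s1 : ∫ x in D, fderiv ℝ ψ x e = ∫ x in stripMap c N '' H, fderiv ℝ ψ x e := by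
      rw [← hHeq, ← hch.inter_eq h]
      refine setIntegral_eq_of_subset_of_forall_sdiff_eq_zero h.isOpen.measurableSet
        inter_subset_left fun x hx => ?_
      rw [fderiv_eq_zero_of_notMem_tsupport (fun hx' => hx.2 ⟨hx.1, hs hx'⟩)]; rfl
    rw [s1, integral_image_eq_integral_abs_det_fderiv_smul volume hHopen.measurableSet
      (fun y _ => (hasFDerivAt_stripMap h.contDiff N y).hasFDerivWithinAt)
      (hch.injOn.mono (hHsub.trans (stripBox_subset_closed _ _ _)))]
    refine setIntegral_congr_fun hHopen.measurableSet fun y hy => ?_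
    simp only [stripDeriv_det, smul_eq_mul]
    rw [abs_of_pos (hch.det_pos _ (hHsub hy).1.le)]; rfl
  have hcontF : Continuous fun p : ℝ × ℝ => c p.1 + p.2 • N := by fun_prop
  have hdF : Continuous fun p : ℝ × ℝ => fderiv ℝ ψ (c p.1 + p.2 • N) :=
    (hψ.continuous_fderiv one_ne_zero).comp hcontF
  have hdc : Continuous fun p : ℝ × ℝ => deriv c p.1 := hc'.comp continuous_fst
  set A : ℝ × ℝ → ℝ := fun p => det2 e N * fderiv ℝ ψ (c p.1 + p.2 • N) (deriv c p.1) with hA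
  set B : ℝ × ℝ → ℝ := fun p => det2 (deriv c p.1) e * fderiv ℝ ψ (c p.1 + p.2 • N) N with hB
  have hAc : Continuous A := continuous_const.mul (hdF.clm_apply hdc)
  have hBc : Continuous B :=
    (det2_continuous.comp (hdc.prodMk continuous_const)).mul (hdF.clm_apply continuous_const)
  have e2 : ∫ y in H, det2 (deriv c (y 0)) N * fderiv ℝ ψ (c (y 0) + y 1 • N) e =
      (∫ y in H, A (y 0, y 1)) + ∫ y in H, B (y 0, y 1) := by
    have hHb : Bornology.IsBounded H := by
      refine (Metric.isBounded_iff_subset_closedBall (!₂[θ₀, 0] : Plane)).2 ⟨ε + η, fun y hy => ?_⟩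
      have hb := stripBox_subset_closed _ _ _ (hHsub hy)
      rw [mem_closedBall_iff_norm]
      have h3 := plane_norm_sq (y - !₂[θ₀, 0])
      simp at h3
      have hε := hch.ε_pos
      have hη := hch.η_pos
      refine le_of_sq_le_sq ?_ (by positivity)
      rw [h3]
      have h4 := sq_le_sq.2 (by rw [abs_of_pos hε]; exact hb.1 : |y 0 - θ₀| ≤ |ε|)
      have h5 := sq_le_sq.2 (by rw [abs_of_pos hη]; exact hb.2 : |y 1| ≤ |η|)
      nlinarith
    have hp : Continuous fun y : Plane => (y 0, y 1) := by fun_prop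
    refine Eq.trans ?_ (integral_add
      (integrableOn_of_continuous_of_isBounded (hAc.comp hp) hHb)
      (integrableOn_of_continuous_of_isBounded (hBc.comp hp) hHb))
    refine integral_congr_ae (Eventually.of_forall fun y => ?_)
    have := congrArg (fderiv ℝ ψ (c (y 0) + y 1 • N)) (det2_smul_eq (deriv c (y 0)) N e)
    simpa [hA, hB] using this
  have hε := hch.ε_pos
  have hη := hch.η_pos
  have hψd := hψ.differentiable one_ne_zero
  have e3 : ∫ y in H, A (y 0, y 1) = 0 := by
    rw [integral_plane_rectangle (by linarith) hη.le hAc,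
      integral_rectangle_swap (by linarith) hη.le hAc]
    rw [intervalIntegral.integral_of_le hη.le]
    refine setIntegral_eq_zero_of_forall_eq_zero fun s hs' => ?_
    have hd : ∀ θ : ℝ, HasDerivAt (fun θ => det2 e N * ψ (c θ + s • N)) (A (θ, s)) θ := fun θ => by
      have h1 : HasDerivAt (fun θ => c θ + s • N) (deriv c θ) θ :=
        ((h.contDiff.differentiable one_ne_zero θ).hasDerivAt).add_const _
      exact ((hψd _).hasFDerivAt.comp_hasDerivAt θ h1).const_mul _
    rw [intervalIntegral.integral_eq_sub_of_hasDerivAt (fun θ _ => hd θ)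
      ((hAc.comp (by fun_prop : Continuous fun θ : ℝ => (θ, s))).intervalIntegrable _ _)]
    have hz : ∀ θ, |θ - θ₀| = ε → ψ (c θ + s • N) = 0 := fun θ hθ => by
      have := hzero !₂[θ, s] ⟨by simpa using hθ.le, by simpa [abs_of_pos hs'.1] using hs'.2⟩
        (fun hm => by have := hm.1; simp [hθ] at this)
      simpa [stripMap] using this
    rw [hz (θ₀ + ε) (by simp [abs_of_pos hε]), hz (θ₀ - ε) (by simp [abs_of_pos hε])]
    simp
  have e4 : ∫ y in H, B (y 0, y 1) =
      ∫ θ in (θ₀ - ε)..(θ₀ + ε), - (det2 (deriv c θ) e * ψ (c θ)) := by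
    rw [integral_plane_rectangle (by linarith) hη.le hBc]
    refine intervalIntegral.integral_congr fun θ hθ => ?_
    rw [uIcc_of_le (by linarith)] at hθ
    have hd : ∀ s : ℝ, HasDerivAt (fun s => det2 (deriv c θ) e * ψ (c θ + s • N)) (B (θ, s)) s :=
      fun s => by
        have h1 : HasDerivAt (fun s : ℝ => c θ + s • N) N s := by
          simpa using ((hasDerivAt_id s).smul_const N).const_add (c θ)
        exact ((hψd _).hasFDerivAt.comp_hasDerivAt s h1).const_mul _
    rw [intervalIntegral.integral_eq_sub_of_hasDerivAt (fun s _ => hd s)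
      ((hBc.comp (by fun_prop : Continuous fun s : ℝ => (θ, s))).intervalIntegrable _ _)]
    have hz : ψ (c θ + η • N) = 0 := by
      have := hzero !₂[θ, η] ⟨by simpa [abs_le] using ⟨by linarith [hθ.1], by linarith [hθ.2]⟩,
        by simp [abs_of_pos hη]⟩ (fun hm => by have := hm.2; simp [abs_of_pos hη] at this)
      simpa [stripMap] using this
    rw [hz]; simp
  -- the rest of the curve does not meet the support
  have e5 : ∫ θ in (θ₀ - ε)..(θ₀ + ε), - (det2 (deriv c θ) e * ψ (c θ)) =
      ∫ θ in (θ₀ - 1 / 2)..(θ₀ - 1 / 2 + 1), - (det2 (deriv c θ) e * ψ (c θ)) := by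
    have hε2 := hch.ε_lt
    rw [intervalIntegral.integral_of_le (by linarith), intervalIntegral.integral_of_le (by linarith)]
    symm
    refine setIntegral_eq_of_subset_of_forall_sdiff_eq_zero measurableSet_Ioc
      (Ioc_subset_Ioc (by linarith) (by linarith)) fun θ hθ => ?_
    have : ψ (c θ) = 0 := by
      by_contra hne
      have h1 := hch.arc θ ⟨hθ.1.1.le, by linarith [hθ.1.2]⟩ (hs (subset_tsupport ψ hne))
      rw [abs_lt] at h1
      exact hθ.2 ⟨by linarith, by linarith⟩
    simp [this]
  have hper : Function.Periodic (fun θ => - (det2 (deriv c θ) e * ψ (c θ))) 1 := fun θ => by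
    simp [h.periodic θ, h.periodic_deriv θ]
  rw [e1, e2, e3, e4, e5, zero_add, hper.intervalIntegral_add_eq _ 0, zero_add]

/-- The Gauss–Green formula on a `C¹` Jordan domain, for functions of class `C¹` on the plane. -/
theorem IsC1JordanDomain.gaussGreen (h : IsC1JordanDomain D c) {ψ : Plane → ℝ}
    (hψ : ContDiff ℝ 1 ψ) (e : Plane) :
    ∫ x in D, fderiv ℝ ψ x e = arcIntegral c fun θ => ψ (c θ) * inner ℝ e (outerNormal c θ) := by
  -- the length element cancels the normalization of the outer normal
  have hrhs : arcIntegral c (fun θ => ψ (c θ) * inner ℝ e (outerNormal c θ)) =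
      ∫ θ in (0 : ℝ)..1, - (det2 (deriv c θ) e * ψ (c θ)) := by
    rw [intervalIntegral.integral_of_le zero_le_one]
    unfold arcIntegral paramMeasure
    refine integral_congr_ae (Eventually.of_forall fun θ => ?_)
    simp only
    rw [mul_assoc, inner_outerNormal]; ring
  rw [hrhs]
  choose ε η hch using exists_isStripChart h
  -- a partition of unity for the cover by `D` and the strips localizes the formula
  set U : Option ℝ → Set Plane := fun o => o.elim D fun θ₀ =>
    stripMap c (-outerNormal c θ₀) '' stripBox θ₀ (ε θ₀) (η θ₀) with hU
  have hUo : ∀ o, IsOpen (U o) := fun o => by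
    cases o with
    | none => exact h.isOpen
    | some θ₀ => exact (hch θ₀).isOpen
  have hcov : closure D ⊆ ⋃ o, U o := by
    rw [h.closure_eq]
    rintro x (hx | ⟨θ, rfl⟩)
    · exact mem_iUnion.2 ⟨none, hx⟩
    · refine mem_iUnion.2 ⟨some θ, !₂[θ, 0], ⟨by simpa using (hch θ).ε_pos, by simpa using (hch θ).η_pos⟩, by simp [stripMap]⟩
  obtain ⟨t, ht⟩ := h.isBounded.isCompact_closure.elim_finite_subcover U hUo hcov
  obtain ⟨f, hf⟩ := SmoothPartitionOfUnity.exists_isSubordinate (modelWithCornersSelf ℝ Plane)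
    isClosed_closure (fun o : t => U o) (fun o => hUo o)
    (by simpa [iUnion_subtype] using ht)
  have hfC : ∀ i, ContDiff ℝ 1 (fun x => f i x) := fun i =>
    ((f i).contMDiff.contDiff).of_le (by exact_mod_cast le_top)
  have hfψ : ∀ i, ContDiff ℝ 1 (fun x => f i x * ψ x) := fun i => (hfC i).mul hψ
  have hloc : ∀ i : t, ∫ x in D, fderiv ℝ (fun x => f i x * ψ x) x e =
      ∫ θ in (0 : ℝ)..1, - (det2 (deriv c θ) e * (f i (c θ) * ψ (c θ))) := by
    rintro ⟨o, ho⟩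
    have hsupp : tsupport (fun x => f ⟨o, ho⟩ x * ψ x) ⊆ U o :=
      (tsupport_mul_subset_left).trans (hf ⟨o, ho⟩)
    cases o with
    | none =>
      rw [setIntegral_fderiv_eq_of_tsupport_subset h (hfψ _) hsupp]
      symm
      rw [intervalIntegral.integral_of_le zero_le_one]
      refine setIntegral_eq_zero_of_forall_eq_zero fun θ _ => ?_
      have : f ⟨none, ho⟩ (c θ) * ψ (c θ) = 0 := by
        by_contra hne
        exact h.curve_notMem θ (hsupp (subset_tsupport (fun x => f ⟨none, ho⟩ x * ψ x) hne))
      rw [this]; simp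
    | some θ₀ => exact (hch θ₀).gaussGreen h (hfψ _) hsupp e
  have hsum : ∀ x ∈ closure D, ∑ i, f i x = 1 := fun x hx => by
    rw [← finsum_eq_sum_of_fintype]; exact f.sum_eq_one hx
  have hD : ∫ x in D, fderiv ℝ ψ x e =
      ∑ i, ∫ x in D, fderiv ℝ (fun x => f i x * ψ x) x e := by
    rw [← integral_finsetSum _ fun i _ =>
      integrableOn_of_continuous_of_isBounded (continuous_fderiv_apply (hfψ i) e) h.isBounded]
    refine setIntegral_congr_fun h.isOpen.measurableSet fun x hx => ?_
    have h1 : ψ =ᶠ[𝓝 x] fun x => ∑ i, f i x * ψ x := by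
      filter_upwards [h.isOpen.mem_nhds hx] with y hy
      rw [← Finset.sum_mul, hsum y (subset_closure hy), one_mul]
    rw [h1.fderiv_eq, fderiv_fun_sum fun i _ => (hfψ i).differentiable one_ne_zero x]
    simp
  rw [hD, Finset.sum_congr rfl fun i _ => hloc i, ← intervalIntegral.integral_finsetSum]
  · refine intervalIntegral.integral_congr fun θ _ => ?_
    rw [Finset.sum_neg_distrib, ← Finset.mul_sum, ← Finset.sum_mul,
      hsum _ (by rw [h.closure_eq]; exact Or.inr ⟨θ, rfl⟩), one_mul]
  · intro i _
    refine Continuous.intervalIntegrable ?_ _ _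
    have h1 : Continuous fun θ => det2 (deriv c θ) e :=
      det2_continuous.comp (h.continuous_deriv.prodMk continuous_const)
    exact (h1.mul (((hfC i).continuous.comp h.contDiff.continuous).mul
      (hψ.continuous.comp h.contDiff.continuous))).neg
end

/-! ### Convergence in `Lᵖ` -/

/-- The functions `F i` belong to `Lᵖ(μ)` eventually and converge in `Lᵖ(μ)` to `f` along `l`. -/
structure LpTendsto {α ι E : Type*} [MeasurableSpace α] [NormedAddCommGroup E] (p : ENNReal)
    (μ : Measure α) (F : ι → α → E) (l : Filter ι) (f : α → E) : Prop where
  memLp : ∀ᶠ i in l, MemLp (F i) p μ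
  memLp_lim : MemLp f p μ
  tendsto : Tendsto (fun i => eLpNorm (fun x => F i x - f x) p μ) l (𝓝 0)

namespace LpTendsto
variable {α ι E F G : Type*} [MeasurableSpace α] [NormedAddCommGroup E] [NormedAddCommGroup F]
  [NormedAddCommGroup G] {p q r : ENNReal} {μ : Measure α} {l : Filter ι}

lemma const {f : α → E} (hf : MemLp f p μ) : LpTendsto p μ (fun _ : ι => f) l f :=
  ⟨Eventually.of_forall fun _ => hf, hf, by simpa using tendsto_const_nhds⟩

lemma congr {f g : α → E} {u v : ι → α → E} (h : LpTendsto p μ u l f)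
    (huv : ∀ᶠ i in l, u i =ᵐ[μ] v i) (hfg : f =ᵐ[μ] g) : LpTendsto p μ v l g := by
  refine ⟨?_, h.memLp_lim.ae_eq hfg, h.tendsto.congr' ?_⟩
  · filter_upwards [h.memLp, huv] with i h1 h2 using h1.ae_eq h2
  · filter_upwards [huv] with i h1
    refine eLpNorm_congr_ae ?_
    filter_upwards [h1, hfg] with x h2 h3
    rw [h2, h3]

lemma comp {κ : Type*} {f : α → E} {u : ι → α → E} (h : LpTendsto p μ u l f) {l' : Filter κ}
    {n : κ → ι} (hn : Tendsto n l' l) : LpTendsto p μ (fun k => u (n k)) l' f :=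
  ⟨hn.eventually h.memLp, h.memLp_lim, h.tendsto.comp hn⟩

lemma add {f g : α → E} {u v : ι → α → E} (hu : LpTendsto p μ u l f) (hv : LpTendsto p μ v l g)
    (hp : 1 ≤ p) : LpTendsto p μ (fun i x => u i x + v i x) l (fun x => f x + g x) := by
  refine ⟨?_, hu.memLp_lim.add hv.memLp_lim, ?_⟩
  · filter_upwards [hu.memLp, hv.memLp] with i h1 h2 using h1.add h2
  · refine tendsto_of_tendsto_of_tendsto_of_le_of_le' tendsto_const_nhds
      (by simpa using hu.tendsto.add hv.tendsto) (Eventually.of_forall fun _ => zero_le) ?_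
    filter_upwards [hu.memLp, hv.memLp] with i h1 h2
    refine le_trans (le_of_eq ?_) (eLpNorm_add_le (h1.sub hu.memLp_lim).1 (h2.sub hv.memLp_lim).1 hp)
    congr 1; ext x; simp [sub_eq_add_neg]; abel

lemma neg {f : α → E} {u : ι → α → E} (hu : LpTendsto p μ u l f) :
    LpTendsto p μ (fun i x => - u i x) l (fun x => - f x) := by
  refine ⟨hu.memLp.mono fun i h => h.neg, hu.memLp_lim.neg, hu.tendsto.congr fun i => ?_⟩
  rw [← eLpNorm_neg]
  congr 1; ext x; simp [sub_eq_add_neg, add_comm]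

lemma sub {f g : α → E} {u v : ι → α → E} (hu : LpTendsto p μ u l f) (hv : LpTendsto p μ v l g)
    (hp : 1 ≤ p) : LpTendsto p μ (fun i x => u i x - v i x) l (fun x => f x - g x) := by
  simpa only [sub_eq_add_neg] using hu.add hv.neg hp

lemma mono_exponent [IsFiniteMeasure μ] {f : α → E} {u : ι → α → E} (hu : LpTendsto q μ u l f)
    (hpq : p ≤ q) (hp : p ≠ 0) : LpTendsto p μ u l f := by
  refine ⟨hu.memLp.mono fun i h => h.mono_exponent hpq, hu.memLp_lim.mono_exponent hpq, ?_⟩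
  have hfin : μ univ ^ (1 / p.toReal - 1 / q.toReal) ≠ ⊤ := by
    refine ENNReal.rpow_ne_top_of_nonneg ?_ (measure_ne_top _ _)
    by_cases hq : q = ⊤
    · simp [hq]
    · have h1 : 0 < p.toReal := ENNReal.toReal_pos hp (ne_top_of_le_ne_top hq hpq)
      have := one_div_le_one_div_of_le h1 (ENNReal.toReal_mono hq hpq)
      linarith
  have h0 := ENNReal.Tendsto.mul_const (b := μ univ ^ (1 / p.toReal - 1 / q.toReal)) hu.tendsto (Or.inr hfin)
  rw [zero_mul] at h0
  refine tendsto_of_tendsto_of_tendsto_of_le_of_le' tendsto_const_nhds h0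
    (Eventually.of_forall fun _ => zero_le) ?_
  filter_upwards [hu.memLp] with i h1
  exact eLpNorm_le_eLpNorm_mul_rpow_measure_univ hpq (h1.sub hu.memLp_lim).1

lemma mono_measure {ν : Measure α} (hν : ν ≤ μ) {f : α → E} {u : ι → α → E}
    (hu : LpTendsto p μ u l f) : LpTendsto p ν u l f :=
  ⟨hu.memLp.mono fun _ h => h.mono_measure hν, hu.memLp_lim.mono_measure hν,
    tendsto_of_tendsto_of_tendsto_of_le_of_le' tendsto_const_nhds hu.tendsto
    (Eventually.of_forall fun _ => zero_le) (Eventually.of_forall fun _ => eLpNorm_mono_measure _ hν)⟩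

lemma exists_subseq_ae (hp : p ≠ 0) {f : α → E} {u : ℕ → α → E}
    (hmeas : ∀ n, AEStronglyMeasurable (u n) μ) (hu : LpTendsto p μ u atTop f) :
    ∃ n : ℕ → ℕ, StrictMono n ∧ ∀ᵐ x ∂μ, Tendsto (fun k => u (n k) x) atTop (𝓝 (f x)) :=
  (tendstoInMeasure_of_tendsto_eLpNorm hp hmeas hu.memLp_lim.1 hu.tendsto).exists_seq_tendsto_ae

/-- Uniform convergence is convergence in `L^∞`. -/
lemma of_uniform {f : α → E} {u : ι → α → E} (hu : ∀ᶠ i in l, MemLp (u i) ⊤ μ) (hf : MemLp f ⊤ μ)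
    (h : ∀ ε > 0, ∀ᶠ i in l, ∀ᵐ x ∂μ, ‖u i x - f x‖ ≤ ε) : LpTendsto ⊤ μ u l f := by
  refine ⟨hu, hf, ENNReal.tendsto_nhds_zero.2 fun ε hε => ?_⟩
  by_cases hεt : ε = ⊤
  · simp [hεt]
  filter_upwards [h ε.toReal (ENNReal.toReal_pos hε.ne' hεt)] with i hi
  rw [eLpNorm_exponent_top]
  exact (eLpNormEssSup_le_of_ae_bound hi).trans (ENNReal.ofReal_toReal hεt).le

/-- Dominated convergence in `L²`. -/
lemma of_dominated {f : α → E} {u : ℕ → α → E} {b : α → ℝ} (hu : ∀ n, AEStronglyMeasurable (u n) μ)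
    (hb : MemLp b 2 μ) (hbd : ∀ n, ∀ᵐ x ∂μ, ‖u n x‖ ≤ b x)
    (hlim : ∀ᵐ x ∂μ, Tendsto (fun n => u n x) atTop (𝓝 (f x))) : LpTendsto 2 μ u atTop f := by
  have hfm : AEStronglyMeasurable f μ := aestronglyMeasurable_of_tendsto_ae atTop hu hlim
  have hfb : ∀ᵐ x ∂μ, ‖f x‖ ≤ b x := by
    filter_upwards [ae_all_iff.2 hbd, hlim] with x h1 h2
    exact le_of_tendsto h2.norm (Eventually.of_forall h1)
  have hfL : MemLp f 2 μ := hb.of_le hfm (hfb.mono fun x hx => hx.trans (le_abs_self _))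
  refine ⟨Eventually.of_forall fun n => hb.of_le (hu n) ((hbd n).mono fun x hx => hx.trans (le_abs_self _)),
    hfL, ?_⟩
  have h2 : Tendsto (fun n => ∫⁻ x, ‖u n x - f x‖ₑ ^ (2 : ℝ) ∂μ) atTop (𝓝 0) := by
    have hdom : ∫⁻ x, (2 * ‖b x‖ₑ) ^ (2 : ℝ) ∂μ ≠ ⊤ := by
      simp_rw [ENNReal.mul_rpow_of_nonneg _ _ (by norm_num : (0 : ℝ) ≤ 2)]
      rw [lintegral_const_mul' _ _ (by simp)]
      have := (eLpNorm_lt_top_iff_lintegral_rpow_enorm_lt_top (by simp) (by simp)).1 hb.2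
      exact ENNReal.mul_ne_top (by simp) (by simpa using this.ne)
    have := tendsto_lintegral_of_dominated_convergence' (μ := μ)
      (F := fun n x => ‖u n x - f x‖ₑ ^ (2 : ℝ)) (f := fun _ => 0)
      (fun x => (2 * ‖b x‖ₑ) ^ (2 : ℝ)) (fun n => ((hu n).sub hfm).enorm.pow_const _) (fun n => ?_) hdom ?_
    · simpa using this
    · filter_upwards [hbd n, hfb] with x h3 h4
      refine ENNReal.rpow_le_rpow ?_ (by norm_num)
      rw [two_mul]
      refine (enorm_sub_le).trans (add_le_add ?_ ?_) <;>
      · rw [enorm_le_iff_norm_le]; exact le_trans (by assumption) (le_abs_self _)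
    · filter_upwards [hlim] with x hx
      have h5 : Tendsto (fun n => ‖u n x - f x‖ₑ) atTop (𝓝 0) := by
        have := (tendsto_sub_nhds_zero_iff.2 hx).enorm
        simpa using this
      have h6 := (ENNReal.continuous_rpow_const (y := (2 : ℝ))).tendsto 0 |>.comp h5
      rw [ENNReal.zero_rpow_of_pos (by norm_num)] at h6
      exact h6
  have h3 := (ENNReal.continuous_rpow_const (y := (1 / 2 : ℝ))).tendsto 0 |>.comp h2
  rw [ENNReal.zero_rpow_of_pos (by norm_num)] at h3
  refine h3.congr fun n => ?_
  rw [eLpNorm_eq_lintegral_rpow_enorm_toReal (by simp) (by simp)]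
  simp

variable [NormedSpace ℝ E] [NormedSpace ℝ F] [NormedSpace ℝ G]

/-- Products of `Lᵖ`- and `L^q`-convergent families converge in `Lʳ`, for Hölder exponents. -/
lemma bilin (B : E →L[ℝ] F →L[ℝ] G) [hpqr : p.HolderTriple q r] (hr : 1 ≤ r) {f : α → E} {g : α → F}
    {u : ι → α → E} {v : ι → α → F} (hu : LpTendsto p μ u l f) (hv : LpTendsto q μ v l g) :
    LpTendsto r μ (fun i x => B (u i x) (v i x)) l (fun x => B (f x) (g x)) := by
  have hle : ∀ {a : α → E} {b : α → F}, MemLp a p μ → MemLp b q μ →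
      eLpNorm (fun x => B (a x) (b x)) r μ ≤ ‖B‖₊ * eLpNorm a p μ * eLpNorm b q μ := fun ha hb =>
    eLpNorm_le_eLpNorm_mul_eLpNorm_of_nnnorm ha.1 hb.1 (fun x y => B x y) ‖B‖₊
      (Eventually.of_forall fun x => B.le_opNorm₂ _ _)
  have hmem : ∀ {a : α → E} {b : α → F}, MemLp a p μ → MemLp b q μ →
      MemLp (fun x => B (a x) (b x)) r μ := fun ha hb => B.memLp_of_bilin r ha hb
  refine ⟨?_, hmem hu.memLp_lim hv.memLp_lim, ?_⟩
  · filter_upwards [hu.memLp, hv.memLp] with i h1 h2 using hmem h1 h2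
  · have t1 : Tendsto (fun i => (‖B‖₊ : ENNReal) * eLpNorm (fun x => u i x - f x) p μ * eLpNorm (fun x => v i x - g x) q μ
        + ‖B‖₊ * eLpNorm (fun x => u i x - f x) p μ * eLpNorm g q μ
        + ‖B‖₊ * eLpNorm f p μ * eLpNorm (fun x => v i x - g x) q μ) l (𝓝 0) := by
      have a1 := ENNReal.Tendsto.const_mul (a := (‖B‖₊ : ENNReal)) hu.tendsto (Or.inr ENNReal.coe_ne_top)
      rw [mul_zero] at a1
      have a2 := ENNReal.Tendsto.mul a1 (Or.inr ENNReal.zero_ne_top) hv.tendsto (Or.inr ENNReal.zero_ne_top)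
      have a3 := ENNReal.Tendsto.mul_const (b := eLpNorm g q μ) a1 (Or.inr hv.memLp_lim.2.ne)
      have a4 := ENNReal.Tendsto.const_mul (a := ‖B‖₊ * eLpNorm f p μ) hv.tendsto
        (Or.inr (ENNReal.mul_ne_top ENNReal.coe_ne_top hu.memLp_lim.2.ne))
      simpa using (a2.add a3).add a4
    refine tendsto_of_tendsto_of_tendsto_of_le_of_le' tendsto_const_nhds t1
      (Eventually.of_forall fun _ => zero_le) ?_
    filter_upwards [hu.memLp, hv.memLp] with i h1 h2
    have d1 := h1.sub hu.memLp_lim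
    have d2 := h2.sub hv.memLp_lim
    have heq : (fun x => B (u i x) (v i x) - B (f x) (g x)) =
        ((fun x => B (u i x - f x) (v i x - g x)) + fun x => B (u i x - f x) (g x)) +
          fun x => B (f x) (v i x - g x) := by
      ext x; simp only [map_sub, _root_.sub_apply, Pi.add_apply]; abel
    rw [heq]
    have m1 := hmem d1 d2
    have m2 := hmem d1 hv.memLp_lim
    have m3 := hmem hu.memLp_lim d2
    refine (eLpNorm_add_le (m1.add m2).1 m3.1 hr).trans (add_le_add ((eLpNorm_add_le m1.1 m2.1 hr).trans
      (add_le_add ?_ ?_)) ?_)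
    · exact hle d1 d2
    · exact hle d1 hv.memLp_lim
    · exact hle hu.memLp_lim d2

lemma clm (L : E →L[ℝ] F) {f : α → E} {u : ι → α → E} (hu : LpTendsto p μ u l f) :
    LpTendsto p μ (fun i x => L (u i x)) l (fun x => L (f x)) := by
  refine ⟨hu.memLp.mono fun i h => L.comp_memLp' h, L.comp_memLp' hu.memLp_lim, ?_⟩
  have h0 := ENNReal.Tendsto.const_mul (a := ENNReal.ofReal ‖L‖) hu.tendsto (Or.inr ENNReal.ofReal_ne_top)
  rw [mul_zero] at h0
  refine tendsto_of_tendsto_of_tendsto_of_le_of_le' tendsto_const_nhds h0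
    (Eventually.of_forall fun _ => zero_le) (Eventually.of_forall fun i => ?_)
  refine eLpNorm_le_mul_eLpNorm_of_ae_le_mul (Eventually.of_forall fun x => ?_) p
  rw [← map_sub]; exact L.le_opNorm _

lemma integral {f : α → E} {u : ι → α → E} (hu : LpTendsto 1 μ u l f) :
    Tendsto (fun i => ∫ x, u i x ∂μ) l (𝓝 (∫ x, f x ∂μ)) :=
  tendsto_integral_of_L1' f hu.memLp_lim.1 (hu.memLp.mono fun _ h => memLp_one_iff_integrable.1 h)
    hu.tendsto

lemma mul {f g : α → ℝ} {u v : ι → α → ℝ} [hpqr : p.HolderTriple q r] (hr : 1 ≤ r)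
    (hu : LpTendsto p μ u l f) (hv : LpTendsto q μ v l g) :
    LpTendsto r μ (fun i x => u i x * v i x) l (fun x => f x * g x) :=
  hu.bilin (ContinuousLinearMap.mul ℝ ℝ) hr hv

lemma smul {f : α → ℝ} {g : α → E} {u : ι → α → ℝ} {v : ι → α → E} [hpqr : p.HolderTriple q r]
    (hr : 1 ≤ r) (hu : LpTendsto p μ u l f) (hv : LpTendsto q μ v l g) :
    LpTendsto r μ (fun i x => u i x • v i x) l (fun x => f x • g x) :=
  hu.bilin (ContinuousLinearMap.lsmul ℝ ℝ) hr hv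

lemma const_mul (a : ℝ) {f : α → ℝ} {u : ι → α → ℝ} (hu : LpTendsto p μ u l f) :
    LpTendsto p μ (fun i x => a * u i x) l (fun x => a * f x) :=
  hu.clm (ContinuousLinearMap.mul ℝ ℝ a)

end LpTendsto

namespace LpTendsto
variable {α ι E F : Type*} [MeasurableSpace α] [NormedAddCommGroup E] [NormedSpace ℝ E]
  [NormedAddCommGroup F] {p : ENNReal} {μ : Measure α} {l : Filter ι}

lemma lipschitz_comp [IsFiniteMeasure μ] {f : α → F} {u : ι → α → F} (hu : LpTendsto p μ u l f)
    {G : F → ℝ} {K : NNReal} (hG : LipschitzWith K G) :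
    LpTendsto p μ (fun i x => G (u i x)) l (fun x => G (f x)) := by
  have hmem : ∀ {v : α → F}, MemLp v p μ → MemLp (fun x => G (v x)) p μ := fun {v} hv => by
    have h1 : LipschitzWith K fun y => G y - G 0 := by
      simpa using hG.sub (LipschitzWith.const (G 0))
    have h2 := (h1.comp_memLp (by simp) hv).add (memLp_const (G 0))
    refine h2.ae_eq (Eventually.of_forall fun x => by simp)
  refine ⟨hu.memLp.mono fun _ h => hmem h, hmem hu.memLp_lim, ?_⟩
  have h0 := ENNReal.Tendsto.const_mul (a := ENNReal.ofReal K) hu.tendsto (Or.inr ENNReal.ofReal_ne_top)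
  rw [mul_zero] at h0
  refine tendsto_of_tendsto_of_tendsto_of_le_of_le' tendsto_const_nhds h0
    (Eventually.of_forall fun _ => zero_le) (Eventually.of_forall fun i => ?_)
  exact eLpNorm_le_mul_eLpNorm_of_ae_le_mul (Eventually.of_forall fun x => by
    simpa [dist_eq_norm] using hG.dist_le_mul (u i x) (f x)) p

/-- Bounded factors that converge almost everywhere preserve convergence in `L²`. -/
lemma bdd_smul {m : ℕ → α → ℝ} {m' : α → ℝ} {v : ℕ → α → E} {v' : α → E} {C : ℝ}
    (hm : ∀ n, AEStronglyMeasurable (m n) μ) (hC : ∀ n x, |m n x| ≤ C)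
    (hlim : ∀ᵐ x ∂μ, Tendsto (fun n => m n x) atTop (𝓝 (m' x))) (hv : LpTendsto 2 μ v atTop v') :
    LpTendsto 2 μ (fun n x => m n x • v n x) atTop (fun x => m' x • v' x) := by
  have h1 : LpTendsto 2 μ (fun n x => m n x • v' x) atTop (fun x => m' x • v' x) := by
    refine of_dominated (b := fun x => C * ‖v' x‖) (fun n => (hm n).smul hv.memLp_lim.1)
      (hv.memLp_lim.norm.const_mul C) (fun n => Eventually.of_forall fun x => ?_) ?_
    · rw [norm_smul]; gcongr; exact hC n x
    · filter_upwards [hlim] with x hx using hx.smul_const _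
  have h2 : LpTendsto 2 μ (fun n x => m n x • (v n x - v' x)) atTop (fun _ => (0 : E)) := by
    have hle : ∀ n, eLpNorm (fun x => m n x • (v n x - v' x)) 2 μ ≤
        ENNReal.ofReal C * eLpNorm (fun x => v n x - v' x) 2 μ := fun n =>
      eLpNorm_le_mul_eLpNorm_of_ae_le_mul (Eventually.of_forall fun x => by
        rw [norm_smul]; gcongr; exact hC n x) 2
    refine ⟨hv.memLp.mono fun n hn => ⟨(hm n).smul (hn.sub hv.memLp_lim).1, (hle n).trans_lt
      (ENNReal.mul_lt_top ENNReal.ofReal_lt_top (hn.sub hv.memLp_lim).2)⟩, MemLp.zero, ?_⟩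
    have h0 := ENNReal.Tendsto.const_mul (a := ENNReal.ofReal C) hv.tendsto (Or.inr ENNReal.ofReal_ne_top)
    rw [mul_zero] at h0
    refine tendsto_of_tendsto_of_tendsto_of_le_of_le' tendsto_const_nhds h0
      (Eventually.of_forall fun _ => zero_le) (Eventually.of_forall fun n => by simpa using hle n)
  refine (h1.add h2 (by norm_num)).congr (Eventually.of_forall fun n => Eventually.of_forall fun x => ?_)
    (Eventually.of_forall fun x => by simp)
  simp [smul_sub]

end LpTendsto

/-! ### Gradients of `C¹` functions -/

lemma gradient_apply_eq (f : Plane → ℝ) (x : Plane) (i : Fin 2) :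
    gradient f x i = fderiv ℝ f x (planeBasis i) := by
  rw [← inner_gradient_left, plane_inner]
  fin_cases i <;> simp

lemma continuous_gradient {f : Plane → ℝ} (hf : ContDiff ℝ 1 f) : Continuous (gradient f) :=
  (InnerProductSpace.toDual ℝ Plane).symm.continuous.comp (hf.continuous_fderiv one_ne_zero)

lemma gradient_eq_of_hasFDerivAt {f : Plane → ℝ} {x v : Plane} {L : Plane →L[ℝ] ℝ}
    (h : HasFDerivAt f L x) (hv : ∀ e, L e = inner ℝ v e) : gradient f x = v := by
  refine ext_inner_right ℝ fun e => ?_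
  rw [inner_gradient_left, h.fderiv, hv]

lemma gradient_mul_eq {f g : Plane → ℝ} (hf : ContDiff ℝ 1 f) (hg : ContDiff ℝ 1 g) (x : Plane) :
    gradient (fun x => f x * g x) x = f x • gradient g x + g x • gradient f x := by
  refine gradient_eq_of_hasFDerivAt ((hf.differentiable one_ne_zero x).hasFDerivAt.mul
    (hg.differentiable one_ne_zero x).hasFDerivAt) fun e => ?_
  simp [inner_add_left, inner_smul_left, inner_gradient_left]

lemma gradient_add_eq {f g : Plane → ℝ} (hf : ContDiff ℝ 1 f) (hg : ContDiff ℝ 1 g) (x : Plane) :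
    gradient (fun x => f x + g x) x = gradient f x + gradient g x := by
  refine gradient_eq_of_hasFDerivAt ((hf.differentiable one_ne_zero x).hasFDerivAt.add
    (hg.differentiable one_ne_zero x).hasFDerivAt) fun e => ?_
  simp [inner_add_left, inner_gradient_left]

lemma gradient_sub_eq {f g : Plane → ℝ} (hf : ContDiff ℝ 1 f) (hg : ContDiff ℝ 1 g) (x : Plane) :
    gradient (fun x => f x - g x) x = gradient f x - gradient g x := by
  refine gradient_eq_of_hasFDerivAt ((hf.differentiable one_ne_zero x).hasFDerivAt.sub
    (hg.differentiable one_ne_zero x).hasFDerivAt) fun e => ?_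
  simp [inner_sub_left, inner_gradient_left]

lemma gradient_const_mul_eq {f : Plane → ℝ} (hf : ContDiff ℝ 1 f) (a : ℝ) (x : Plane) :
    gradient (fun x => a * f x) x = a • gradient f x := by
  refine gradient_eq_of_hasFDerivAt ((hf.differentiable one_ne_zero x).hasFDerivAt.const_mul a)
    fun e => ?_
  simp [inner_smul_left, inner_gradient_left]

/-- The chain rule for a function of two functions. -/
lemma gradient_comp_eq {G f g : Plane → ℝ} (hG : ContDiff ℝ 1 G) (hf : ContDiff ℝ 1 f)
    (hg : ContDiff ℝ 1 g) (x : Plane) :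
    gradient (fun x => G (f x • planeBasis 0 + g x • planeBasis 1)) x =
      gradient G (f x • planeBasis 0 + g x • planeBasis 1) 0 • gradient f x +
      gradient G (f x • planeBasis 0 + g x • planeBasis 1) 1 • gradient g x := by
  have h1 := ((hf.differentiable one_ne_zero x).hasFDerivAt.smul_const (planeBasis 0)).add
    ((hg.differentiable one_ne_zero x).hasFDerivAt.smul_const (planeBasis 1))
  refine gradient_eq_of_hasFDerivAt ((hG.differentiable one_ne_zero _).hasFDerivAt.comp x h1)
    fun e => ?_
  simp only [gradient_apply_eq, inner_add_left, inner_smul_left, inner_gradient_left]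
  simp [mul_comm]

/-! ### Integrability of continuous functions -/

lemma isFiniteMeasure_restrict {D : Set Plane} (hD : Bornology.IsBounded D) :
    IsFiniteMeasure (volume.restrict D) :=
  ⟨by rw [Measure.restrict_apply_univ]; exact hD.measure_lt_top⟩

instance : IsFiniteMeasure paramMeasure := ⟨by simp [paramMeasure]⟩

lemma memLp_top_of_continuous {E : Type*} [NormedAddCommGroup E] [SecondCountableTopology E]
    {D : Set Plane} (hD : Bornology.IsBounded D) {f : Plane → E} (hf : Continuous f) :
    MemLp f ⊤ (volume.restrict D) := by
  obtain ⟨C, hC⟩ := hD.isCompact_closure.exists_bound_of_continuousOn hf.continuousOn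
  refine memLp_top_of_bound hf.aestronglyMeasurable C ?_
  refine (ae_restrict_mem₀ (s := closure D) isClosed_closure.nullMeasurableSet).filter_mono
    (ae_mono (Measure.restrict_mono subset_closure le_rfl)) |>.mono fun x hx => hC x hx

lemma memLp_of_continuous {E : Type*} [NormedAddCommGroup E] [SecondCountableTopology E]
    {D : Set Plane} (hD : Bornology.IsBounded D) {f : Plane → E} (hf : Continuous f)
    (p : ENNReal) : MemLp f p (volume.restrict D) :=
  have := isFiniteMeasure_restrict hD
  (memLp_top_of_continuous hD hf).mono_exponent le_top

lemma memLp_param_of_continuous {E : Type*} [NormedAddCommGroup E] [SecondCountableTopology E]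
    {f : ℝ → E} (hf : Continuous f) (p : ENNReal) : MemLp f p paramMeasure := by
  obtain ⟨C, hC⟩ := (isCompact_Icc (a := (0 : ℝ)) (b := 1)).exists_bound_of_continuousOn hf.continuousOn
  have h1 : MemLp f ⊤ paramMeasure := memLp_top_of_bound hf.aestronglyMeasurable C
    ((ae_restrict_mem measurableSet_Ioc).mono fun x hx => hC x (Ioc_subset_Icc_self hx))
  exact h1.mono_exponent le_top

/-! ### Weak gradients -/

section Weak
variable {D : Set Plane} {f f' : Plane → ℝ} {g g' : Plane → Plane}

lemma IsTestFun.gradient_eq_zero {φ : Plane → ℝ} (hφ : IsTestFun D φ) {x : Plane} (hx : x ∉ D) :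
    gradient φ x = 0 := by
  simp [gradient, fderiv_eq_zero_of_notMem_tsupport fun h => hx (hφ.2.2 h)]

lemma IsTestFun.eq_zero {φ : Plane → ℝ} (hφ : IsTestFun D φ) {x : Plane} (hx : x ∉ D) : φ x = 0 :=
  image_eq_zero_of_notMem_tsupport fun h => hx (hφ.2.2 h)

/-- The fundamental lemma of the calculus of variations, tested with `C²` functions only. -/
lemma ae_eq_of_forall_testFun {E : Type*} [NormedAddCommGroup E] [NormedSpace ℝ E] [CompleteSpace E]
    (hD : IsOpen D) {f g : Plane → E} (hf : LocallyIntegrableOn f D) (hg : LocallyIntegrableOn g D)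
    (h : ∀ φ, IsTestFun D φ → ContDiff ℝ 2 φ → ∫ x in D, φ x • f x = ∫ x in D, φ x • g x) :
    f =ᵐ[volume.restrict D] g := by
  have hz := hD.ae_eq_zero_of_integral_contDiff_smul_eq_zero (hf.sub hg) (fun φ h1 h2 h3 => by
    have hφ : IsTestFun D φ := ⟨h1.of_le (by exact_mod_cast le_top), h2, h3⟩
    have hint : ∀ {k : Plane → E}, LocallyIntegrableOn k D → IntegrableOn (fun x => φ x • k x) D :=
      fun {k} hk => by
        have h4 : IntegrableOn k (tsupport φ) := hk.integrableOn_compact_subset h3 h2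
        have h5 : IntegrableOn (fun x => φ x • k x) (tsupport φ) :=
          h4.continuousOn_smul hφ.1.continuous.continuousOn h2
        refine ((integrableOn_iff_integrable_of_support_subset ?_).1 h5).integrableOn
        intro x hx
        exact subset_tsupport _ fun h0 => hx (by simp [h0])
    rw [← setIntegral_eq_integral_of_forall_compl_eq_zero (s := D)
      (fun x hx => by simp [hφ.eq_zero hx])]
    simp only [Pi.sub_apply, smul_sub]
    rw [integral_sub (hint hf) (hint hg), h φ hφ (by exact_mod_cast contDiff_infty.1 h1 2), sub_self])
  filter_upwards [(ae_restrict_iff' hD.measurableSet).2 hz] with x hx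
  exact sub_eq_zero.1 hx

lemma HasWeakGrad.ae_unique (hD : IsOpen D) (h : HasWeakGrad D f g) (h' : HasWeakGrad D f g') :
    g =ᵐ[volume.restrict D] g' :=
  ae_eq_of_forall_testFun hD h.2.1 h'.2.1 fun φ hφ _ =>
    neg_injective ((h.2.2 φ hφ).symm.trans (h'.2.2 φ hφ))

lemma weakGrad_spec (h : ∃ g, HasWeakGrad D f g) : HasWeakGrad D f (weakGrad D f) := by
  unfold weakGrad; rw [dif_pos h]; exact h.choose_spec

lemma HasWeakGrad.weakGrad_ae (hD : IsOpen D) (h : HasWeakGrad D f g) :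
    weakGrad D f =ᵐ[volume.restrict D] g :=
  (weakGrad_spec ⟨g, h⟩).ae_unique hD h

lemma locallyIntegrableOn_congr {E : Type*} [NormedAddCommGroup E] (hD : IsOpen D) {f g : Plane → E}
    (hf : LocallyIntegrableOn f D) (h : f =ᵐ[volume.restrict D] g) : LocallyIntegrableOn g D := by
  rw [locallyIntegrableOn_iff hD.isLocallyClosed] at hf ⊢
  exact fun k hk hkc => (hf k hk hkc).congr (h.filter_mono (ae_mono (Measure.restrict_mono hk le_rfl)))

lemma HasWeakGrad.congr (hD : IsOpen D) (h : HasWeakGrad D f g) (hf : f =ᵐ[volume.restrict D] f')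
    (hg : g =ᵐ[volume.restrict D] g') : HasWeakGrad D f' g' := by
  refine ⟨locallyIntegrableOn_congr hD h.1 hf, locallyIntegrableOn_congr hD h.2.1 hg, fun φ hφ => ?_⟩
  have h1 : ∫ x in D, f' x • gradient φ x = ∫ x in D, f x • gradient φ x :=
    integral_congr_ae (hf.mono fun x hx => by simp only [hx])
  have h2 : ∫ x in D, φ x • g' x = ∫ x in D, φ x • g x :=
    integral_congr_ae (hg.mono fun x hx => by simp only [hx])
  rw [h1, h2, h.2.2 φ hφ]

lemma locallyIntegrableOn_of_memLp {E : Type*} [NormedAddCommGroup E]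
    (hb : Bornology.IsBounded D) {p : ENNReal} (hp : 1 ≤ p) {f : Plane → E}
    (hf : MemLp f p (volume.restrict D)) : LocallyIntegrableOn f D := by
  have := isFiniteMeasure_restrict hb
  have h : IntegrableOn f D := hf.integrable hp
  exact h.locallyIntegrableOn

lemma memH1_iff (hD : IsOpen D) : MemH1 D f ↔ MemLp f 2 (volume.restrict D) ∧
    ∃ g, HasWeakGrad D f g ∧ MemLp g 2 (volume.restrict D) :=
  ⟨fun h => ⟨h.1, _, weakGrad_spec h.2.1, h.2.2⟩,
    fun ⟨h1, g, h2, h3⟩ => ⟨h1, ⟨g, h2⟩, h3.ae_eq (h2.weakGrad_ae hD).symm⟩⟩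

/-- `ψ k → f` and `∇ψ k → g` in `Lᵖ(D)`. -/
def GradLim (p : ENNReal) (D : Set Plane) (ψ : ℕ → Plane → ℝ) (f : Plane → ℝ) (g : Plane → Plane) :
    Prop :=
  LpTendsto p (volume.restrict D) ψ atTop f ∧
    LpTendsto p (volume.restrict D) (fun k => gradient (ψ k)) atTop g

lemma setIntegral_smul_gradient (hψ : ContDiff ℝ 1 f) {φ : Plane → ℝ} (hφ : IsTestFun D φ) :
    ∫ x in D, f x • gradient φ x = -∫ x in D, φ x • gradient f x := by
  have hcs : HasCompactSupport (fun x => f x * φ x) := hφ.2.1.mul_left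
  have hI : ∀ {k : Plane → Plane}, Continuous k → HasCompactSupport k → Integrable k :=
    fun h1 h2 => h1.integrable_of_hasCompactSupport h2
  have hgs : HasCompactSupport (gradient φ) :=
    (hφ.2.1.fderiv ℝ).comp_left (g := (InnerProductSpace.toDual ℝ Plane).symm) (map_zero _)
  have i1 : Integrable (fun x => f x • gradient φ x) :=
    hI (hψ.continuous.smul (continuous_gradient hφ.1))
      (hgs.mono fun x hx h0 => hx (by simp only [h0, smul_zero]))
  have i2 : Integrable (fun x => φ x • gradient f x) :=
    hI (hφ.1.continuous.smul (continuous_gradient hψ))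
      (hφ.2.1.mono fun x hx h0 => hx (by simp only [h0, zero_smul]))
  rw [setIntegral_eq_integral_of_forall_compl_eq_zero (fun x hx => by simp [hφ.gradient_eq_zero hx]),
    setIntegral_eq_integral_of_forall_compl_eq_zero (fun x hx => by simp [hφ.eq_zero hx]),
    eq_neg_iff_add_eq_zero, ← integral_add i1 i2]
  have hsum : (fun x => f x • gradient φ x + φ x • gradient f x) =
      gradient (fun x => f x * φ x) := funext fun x => (gradient_mul_eq hψ hφ.1 x).symm
  have hi : Integrable (gradient fun x => f x * φ x) := by
    rw [← hsum]; exact i1.add i2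
  rw [hsum]
  refine ext_inner_left ℝ fun e => ?_
  rw [← integral_inner hi e, inner_zero_right, ← integral_fderiv_apply_eq_zero (hψ.mul hφ.1) hcs e]
  refine integral_congr_ae (Eventually.of_forall fun x => ?_)
  exact (real_inner_comm _ _).trans inner_gradient_left

lemma GradLim.hasWeakGrad {p : ENNReal} (hb : Bornology.IsBounded D) (hp : 1 ≤ p) {ψ : ℕ → Plane → ℝ}
    (hψ : ∀ k, ContDiff ℝ 1 (ψ k)) (h : GradLim p D ψ f g) : HasWeakGrad D f g := by
  have := isFiniteMeasure_restrict hb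
  refine ⟨locallyIntegrableOn_of_memLp hb hp h.1.memLp_lim,
    locallyIntegrableOn_of_memLp hb hp h.2.memLp_lim, fun φ hφ => ?_⟩
  have h1 := h.1.mono_exponent hp one_ne_zero
  have h2 := h.2.mono_exponent hp one_ne_zero
  have t1 := (h1.smul (p := 1) (q := ⊤) le_rfl
    (LpTendsto.const (memLp_top_of_continuous hb (continuous_gradient hφ.1)))).integral
  have t2 := ((LpTendsto.const (memLp_top_of_continuous hb hφ.1.continuous)).smul (p := ⊤) (q := 1)
    le_rfl h2).integral.neg
  refine tendsto_nhds_unique t1 (t2.congr fun k => ?_)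
  rw [setIntegral_smul_gradient (hψ k) hφ]

lemma HasWeakGrad.of_contDiff (hb : Bornology.IsBounded D) (hf : ContDiff ℝ 1 f) :
    HasWeakGrad D f (gradient f) :=
  GradLim.hasWeakGrad hb le_top (fun _ => hf)
    ⟨LpTendsto.const (memLp_of_continuous hb hf.continuous ⊤),
      LpTendsto.const (memLp_of_continuous hb (continuous_gradient hf) ⊤)⟩

lemma HasWeakGrad.integrableOn_smul {φ : Plane → ℝ} (h : HasWeakGrad D f g) (hφ : IsTestFun D φ) :
    IntegrableOn (fun x => f x • gradient φ x) D ∧ IntegrableOn (fun x => φ x • g x) D := by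
  have hc := hφ.2.1
  have i1 : IntegrableOn f (tsupport φ) := h.1.integrableOn_compact_subset hφ.2.2 hc
  have i2 : IntegrableOn g (tsupport φ) := h.2.1.integrableOn_compact_subset hφ.2.2 hc
  constructor
  · refine ((integrableOn_iff_integrable_of_support_subset ?_).1
      (i1.smul_continuousOn (continuous_gradient hφ.1).continuousOn hc)).integrableOn
    intro x hx
    by_contra h0
    exact hx (by simp [gradient, fderiv_eq_zero_of_notMem_tsupport h0])
  · refine ((integrableOn_iff_integrable_of_support_subset ?_).1
      (i2.continuousOn_smul hφ.1.continuous.continuousOn hc)).integrableOn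
    intro x hx
    exact subset_tsupport _ fun h0 => hx (by simp [h0])

lemma HasWeakGrad.sub (h : HasWeakGrad D f g) (h' : HasWeakGrad D f' g') :
    HasWeakGrad D (fun x => f x - f' x) (fun x => g x - g' x) := by
  refine ⟨h.1.sub h'.1, h.2.1.sub h'.2.1, fun φ hφ => ?_⟩
  simp only [sub_smul, smul_sub]
  rw [integral_sub (h.integrableOn_smul hφ).1 (h'.integrableOn_smul hφ).1,
    integral_sub (h.integrableOn_smul hφ).2 (h'.integrableOn_smul hφ).2, h.2.2 φ hφ, h'.2.2 φ hφ]
  abel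

lemma h1Norm_eq (hD : IsOpen D) (h : HasWeakGrad D f g) :
    h1Norm D f = eLpNorm f 2 (volume.restrict D) + eLpNorm g 2 (volume.restrict D) := by
  rw [h1Norm, eLpNorm_congr_ae (h.weakGrad_ae hD)]

end Weak

/-! ### Sobolev functions with a trace -/

/-- `f` has the weak gradient `g` on `D` and the trace `r` on the curve `c`, in the sense that all
three are the `Lᵖ` limits of the corresponding data of one sequence of `C¹` functions on the plane.
For `p = 2` this is the trace of an `H¹` function; `p = 1` accommodates products. -/
def HasSobolevTrace (p : ENNReal) (D : Set Plane) (c : ℝ → Plane) (f : Plane → ℝ)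
    (g : Plane → Plane) (r : ℝ → ℝ) : Prop :=
  ∃ ψ : ℕ → Plane → ℝ, (∀ k, ContDiff ℝ 1 (ψ k)) ∧ GradLim p D ψ f g ∧
    LpTendsto p paramMeasure (fun k θ => ψ k (c θ)) atTop r

/-- `f` belongs to `H¹₀(D)` with weak gradient `g`. -/
def IsH10Lim (D : Set Plane) (f : Plane → ℝ) (g : Plane → Plane) : Prop :=
  ∃ φ : ℕ → Plane → ℝ, (∀ k, IsTestFun D (φ k)) ∧ GradLim 2 D φ f g

section
variable {D : Set Plane} {c : ℝ → Plane} {f f' : Plane → ℝ} {g g' : Plane → Plane} {r r' : ℝ → ℝ}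
  {p : ENNReal}

lemma tendsto_h1Norm_iff (hD : IsOpen D) {ι : Type*} {l : Filter ι} {F : ι → Plane → ℝ}
    {G : ι → Plane → Plane} (h : ∀ᶠ i in l, HasWeakGrad D (F i) (G i)) :
    Tendsto (fun i => h1Norm D (F i)) l (𝓝 0) ↔
      Tendsto (fun i => eLpNorm (F i) 2 (volume.restrict D)) l (𝓝 0) ∧
      Tendsto (fun i => eLpNorm (G i) 2 (volume.restrict D)) l (𝓝 0) := by
  rw [tendsto_congr' (h.mono fun i hi => h1Norm_eq hD hi)]
  constructor
  · intro ht
    exact ⟨tendsto_of_tendsto_of_tendsto_of_le_of_le tendsto_const_nhds ht (fun _ => zero_le)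
      fun _ => le_self_add, tendsto_of_tendsto_of_tendsto_of_le_of_le tendsto_const_nhds ht
      (fun _ => zero_le) fun _ => le_add_self⟩
  · rintro ⟨h1, h2⟩
    simpa using h1.add h2

lemma gradLim_iff (hD : IsOpen D) (hb : Bornology.IsBounded D) (hw : HasWeakGrad D f g)
    (hf : MemLp f 2 (volume.restrict D)) (hg : MemLp g 2 (volume.restrict D))
    {ψ : ℕ → Plane → ℝ} (hψ : ∀ k, ContDiff ℝ 1 (ψ k)) :
    GradLim 2 D ψ f g ↔ Tendsto (fun k => h1Norm D (fun x => ψ k x - f x)) atTop (𝓝 0) := by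
  rw [tendsto_h1Norm_iff hD (G := fun k x => gradient (ψ k) x - g x)
    (Eventually.of_forall fun k => (HasWeakGrad.of_contDiff hb (hψ k)).sub hw)]
  constructor
  · exact fun h => ⟨h.1.tendsto, h.2.tendsto⟩
  · exact fun h => ⟨⟨Eventually.of_forall fun k => memLp_of_continuous hb (hψ k).continuous 2, hf, h.1⟩,
      ⟨Eventually.of_forall fun k => memLp_of_continuous hb (continuous_gradient (hψ k)) 2, hg, h.2⟩⟩

lemma MemH10.isH10Lim (hD : IsOpen D) (hb : Bornology.IsBounded D) (h : MemH10 D f) :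
    IsH10Lim D f (weakGrad D f) := by
  obtain ⟨h1, φ, h2, h3⟩ := h
  exact ⟨φ, h2, (gradLim_iff hD hb (weakGrad_spec h1.2.1) h1.1 h1.2.2 fun k => (h2 k).1).2 h3⟩

lemma IsH10Lim.hasWeakGrad (hb : Bornology.IsBounded D) (h : IsH10Lim D f g) : HasWeakGrad D f g := by
  obtain ⟨φ, h1, h2⟩ := h
  exact h2.hasWeakGrad hb (by norm_num) fun k => (h1 k).1

/-- Functions of `H¹₀` have zero trace, since test functions vanish on the boundary curve. -/
lemma IsH10Lim.hasSobolevTrace (h : IsC1JordanDomain D c) (hf : IsH10Lim D f g) :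
    HasSobolevTrace 2 D c f g (fun _ => 0) := by
  obtain ⟨φ, h1, h2⟩ := hf
  refine ⟨φ, fun k => (h1 k).1, h2, ?_⟩
  have : (fun k θ => φ k (c θ)) = fun (_ : ℕ) (_ : ℝ) => (0 : ℝ) := by
    ext k θ; exact (h1 k).eq_zero (h.curve_notMem θ)
  rw [this]
  exact LpTendsto.const MemLp.zero

lemma HasTrace.hasSobolevTrace (h : IsC1JordanDomain D c) (ht : HasTrace D c f r) :
    HasSobolevTrace 2 D c f (weakGrad D f) r := by
  obtain ⟨h1, h2, ψ, h3, h4, h5⟩ := ht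
  exact ⟨ψ, h3, (gradLim_iff h.isOpen h.isBounded (weakGrad_spec h1.2.1) h1.1 h1.2.2 h3).2 h4,
    ⟨Eventually.of_forall fun k => memLp_param_of_continuous
      ((h3 k).continuous.comp h.contDiff.continuous) 2, h2, h5⟩⟩

lemma HasWeakGrad.memH1 (hD : IsOpen D) (hw : HasWeakGrad D f g) (hf : MemLp f 2 (volume.restrict D))
    (hg : MemLp g 2 (volume.restrict D)) : MemH1 D f :=
  (memH1_iff hD).2 ⟨hf, g, hw, hg⟩

namespace HasSobolevTrace

lemma memLp (h : HasSobolevTrace p D c f g r) : MemLp f p (volume.restrict D) := by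
  obtain ⟨ψ, -, h2, -⟩ := h; exact h2.1.memLp_lim

lemma memLp_grad (h : HasSobolevTrace p D c f g r) : MemLp g p (volume.restrict D) := by
  obtain ⟨ψ, -, h2, -⟩ := h; exact h2.2.memLp_lim

lemma memLp_trace (h : HasSobolevTrace p D c f g r) : MemLp r p paramMeasure := by
  obtain ⟨ψ, -, -, h3⟩ := h; exact h3.memLp_lim

lemma hasWeakGrad (hb : Bornology.IsBounded D) (hp : 1 ≤ p) (h : HasSobolevTrace p D c f g r) :
    HasWeakGrad D f g := by
  obtain ⟨ψ, h1, h2, -⟩ := h; exact h2.hasWeakGrad hb hp h1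

lemma hasTrace (hJ : IsC1JordanDomain D c) (h : HasSobolevTrace 2 D c f g r) : HasTrace D c f r := by
  have hw := h.hasWeakGrad hJ.isBounded (by norm_num)
  have hf := h.memLp
  have hg := h.memLp_grad
  obtain ⟨ψ, h1, h2, h3⟩ := h
  exact ⟨hw.memH1 hJ.isOpen hf hg, h3.memLp_lim, ψ, h1,
    (gradLim_iff hJ.isOpen hJ.isBounded hw hf hg h1).1 h2, h3.tendsto⟩

lemma congr (h : HasSobolevTrace p D c f g r) (hf : f =ᵐ[volume.restrict D] f')
    (hg : g =ᵐ[volume.restrict D] g') (hr : r =ᵐ[paramMeasure] r') :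
    HasSobolevTrace p D c f' g' r' := by
  obtain ⟨ψ, h1, ⟨h2, h3⟩, h4⟩ := h
  have hrfl : ∀ {α E : Type} [MeasurableSpace α] (μ : Measure α) (u : ℕ → α → E),
    ∀ᶠ i in (atTop : Filter ℕ), u i =ᵐ[μ] u i := fun μ u => Eventually.of_forall fun _ => ae_eq_rfl
  exact ⟨ψ, h1, ⟨h2.congr (hrfl _ _) hf, h3.congr (hrfl _ _) hg⟩, h4.congr (hrfl _ _) hr⟩

lemma of_contDiff (hb : Bornology.IsBounded D) (hc : Continuous c) {ψ : Plane → ℝ}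
    (hψ : ContDiff ℝ 1 ψ) (p : ENNReal) :
    HasSobolevTrace p D c ψ (gradient ψ) (fun θ => ψ (c θ)) :=
  ⟨fun _ => ψ, fun _ => hψ, ⟨LpTendsto.const (memLp_of_continuous hb hψ.continuous p),
    LpTendsto.const (memLp_of_continuous hb (continuous_gradient hψ) p)⟩,
    LpTendsto.const (memLp_param_of_continuous (hψ.continuous.comp hc) p)⟩

lemma add (h : HasSobolevTrace p D c f g r) (h' : HasSobolevTrace p D c f' g' r') (hp : 1 ≤ p) :
    HasSobolevTrace p D c (fun x => f x + f' x) (fun x => g x + g' x) (fun θ => r θ + r' θ) := by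
  obtain ⟨ψ, h1, ⟨h2, h3⟩, h4⟩ := h
  obtain ⟨φ, h1', ⟨h2', h3'⟩, h4'⟩ := h'
  refine ⟨fun k x => ψ k x + φ k x, fun k => (h1 k).add (h1' k), ⟨h2.add h2' hp, ?_⟩, h4.add h4' hp⟩
  refine (h3.add h3' hp).congr (Eventually.of_forall fun k => Eventually.of_forall fun x => ?_) ae_eq_rfl
  exact (gradient_add_eq (h1 k) (h1' k) x).symm

lemma sub (h : HasSobolevTrace p D c f g r) (h' : HasSobolevTrace p D c f' g' r') (hp : 1 ≤ p) :
    HasSobolevTrace p D c (fun x => f x - f' x) (fun x => g x - g' x) (fun θ => r θ - r' θ) := by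
  obtain ⟨ψ, h1, ⟨h2, h3⟩, h4⟩ := h
  obtain ⟨φ, h1', ⟨h2', h3'⟩, h4'⟩ := h'
  refine ⟨fun k x => ψ k x - φ k x, fun k => (h1 k).sub (h1' k), ⟨h2.sub h2' hp, ?_⟩, h4.sub h4' hp⟩
  refine (h3.sub h3' hp).congr (Eventually.of_forall fun k => Eventually.of_forall fun x => ?_) ae_eq_rfl
  exact (gradient_sub_eq (h1 k) (h1' k) x).symm

lemma const_mul (a : ℝ) (h : HasSobolevTrace p D c f g r) :
    HasSobolevTrace p D c (fun x => a * f x) (fun x => a • g x) (fun θ => a * r θ) := by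
  obtain ⟨ψ, h1, ⟨h2, h3⟩, h4⟩ := h
  refine ⟨fun k x => a * ψ k x, fun k => contDiff_const.mul (h1 k), ⟨h2.const_mul a, ?_⟩, h4.const_mul a⟩
  refine (h3.clm (a • ContinuousLinearMap.id ℝ Plane)).congr
    (Eventually.of_forall fun k => Eventually.of_forall fun x => ?_) ae_eq_rfl
  exact (gradient_const_mul_eq (h1 k) a x).symm

/-- The product of two `H¹` functions is of class `W^{1,1}`. -/
lemma mul (h : HasSobolevTrace 2 D c f g r) (h' : HasSobolevTrace 2 D c f' g' r') :
    HasSobolevTrace 1 D c (fun x => f x * f' x) (fun x => f x • g' x + f' x • g x)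
      (fun θ => r θ * r' θ) := by
  obtain ⟨ψ, h1, ⟨h2, h3⟩, h4⟩ := h
  obtain ⟨φ, h1', ⟨h2', h3'⟩, h4'⟩ := h'
  refine ⟨fun k x => ψ k x * φ k x, fun k => (h1 k).mul (h1' k), ⟨h2.mul le_rfl h2', ?_⟩,
    h4.mul le_rfl h4'⟩
  refine ((h2.smul le_rfl h3').add (h2'.smul le_rfl h3) le_rfl).congr
    (Eventually.of_forall fun k => Eventually.of_forall fun x => ?_) ae_eq_rfl
  exact (gradient_mul_eq (h1 k) (h1' k) x).symm

lemma mul_contDiff (hb : Bornology.IsBounded D) (hc : Continuous c) (hp : 1 ≤ p)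
    (h : HasSobolevTrace p D c f g r) {φ : Plane → ℝ} (hφ : ContDiff ℝ 1 φ) :
    HasSobolevTrace p D c (fun x => φ x * f x) (fun x => φ x • g x + f x • gradient φ x)
      (fun θ => φ (c θ) * r θ) := by
  obtain ⟨ψ, h1, ⟨h2, h3⟩, h4⟩ := h
  have k1 : LpTendsto ⊤ (volume.restrict D) (fun _ : ℕ => φ) atTop φ :=
    LpTendsto.const (memLp_top_of_continuous hb hφ.continuous)
  have k2 : LpTendsto ⊤ (volume.restrict D) (fun _ : ℕ => gradient φ) atTop (gradient φ) :=
    LpTendsto.const (memLp_top_of_continuous hb (continuous_gradient hφ))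
  have k3 : LpTendsto ⊤ paramMeasure (fun (_ : ℕ) θ => φ (c θ)) atTop fun θ => φ (c θ) :=
    LpTendsto.const (memLp_param_of_continuous (hφ.continuous.comp hc) ⊤)
  refine ⟨fun k x => φ x * ψ k x, fun k => hφ.mul (h1 k), ⟨k1.mul hp h2, ?_⟩, k3.mul hp h4⟩
  refine ((k1.smul hp h3).add (h2.smul (p := p) (q := ⊤) hp k2) hp).congr
    (Eventually.of_forall fun k => Eventually.of_forall fun x => ?_) ae_eq_rfl
  exact (gradient_mul_eq hφ (h1 k) x).symm

lemma mono_exponent (hb : Bornology.IsBounded D) (h : HasSobolevTrace 2 D c f g r) :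
    HasSobolevTrace 1 D c f g r := by
  have := isFiniteMeasure_restrict hb
  obtain ⟨ψ, h1, ⟨h2, h3⟩, h4⟩ := h
  exact ⟨ψ, h1, ⟨h2.mono_exponent (by norm_num) one_ne_zero,
    h3.mono_exponent (by norm_num) one_ne_zero⟩, h4.mono_exponent (by norm_num) one_ne_zero⟩

/-- The Gauss–Green formula for functions of class `W^{1,1}` with a trace. -/
theorem integral_inner_eq (hJ : IsC1JordanDomain D c) (h : HasSobolevTrace 1 D c f g r) (e : Plane) :
    ∫ x in D, inner ℝ (g x) e = arcIntegral c fun θ => r θ * inner ℝ e (outerNormal c θ) := by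
  obtain ⟨ψ, h1, ⟨-, h3⟩, h4⟩ := h
  have t1 := (h3.clm ((innerSL ℝ).flip e)).integral
  have hcont : Continuous fun θ => - det2 (deriv c θ) e :=
    (det2_continuous.comp (hJ.continuous_deriv.prodMk continuous_const)).neg
  have t2 := (h4.mul (q := ⊤) le_rfl
    (LpTendsto.const (l := (atTop : Filter ℕ)) (memLp_param_of_continuous hcont ⊤))).integral
  have e1 : ∀ k, arcIntegral c (fun θ => ψ k (c θ) * inner ℝ e (outerNormal c θ)) =
      ∫ θ, ψ k (c θ) * - det2 (deriv c θ) e ∂paramMeasure := fun k => by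
    unfold arcIntegral; simp_rw [mul_assoc, inner_outerNormal]
  have e2 : arcIntegral c (fun θ => r θ * inner ℝ e (outerNormal c θ)) =
      ∫ θ, r θ * - det2 (deriv c θ) e ∂paramMeasure := by
    unfold arcIntegral; simp_rw [mul_assoc, inner_outerNormal]
  rw [e2]
  refine tendsto_nhds_unique t1 (t2.congr fun k => ?_)
  rw [← e1, ← hJ.gaussGreen (h1 k) e]
  refine integral_congr_ae (Eventually.of_forall fun x => ?_)
  exact inner_gradient_left.symm

/-- The chain rule: a `C¹` function with bounded gradient of two `H¹` functions with traces. -/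
lemma comp (hb : Bornology.IsBounded D) {G : Plane → ℝ} (hG : ContDiff ℝ 1 G)
    {C : NNReal} (hC : ∀ y, ‖gradient G y‖ ≤ C) {a : Plane → Plane} {b : Fin 2 → Plane → Plane}
    {q : ℝ → Plane}
    (h : ∀ i, HasSobolevTrace 2 D c (fun x => a x i) (b i) (fun θ => q θ i)) :
    HasSobolevTrace 2 D c (fun x => G (a x))
      (fun x => gradient G (a x) 0 • b 0 x + gradient G (a x) 1 • b 1 x) (fun θ => G (q θ)) := by
  have := isFiniteMeasure_restrict hb
  choose ψ h1 h2 h3 using h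
  have hmeas : ∀ i k, AEStronglyMeasurable (ψ i k) (volume.restrict D) := fun i k =>
    (h1 i k).continuous.aestronglyMeasurable
  -- a common subsequence that converges almost everywhere
  obtain ⟨m, hm, hae0⟩ := (h2 0).1.exists_subseq_ae (by norm_num) (hmeas 0)
  obtain ⟨m', hm', hae1⟩ := ((h2 1).1.comp hm.tendsto_atTop).exists_subseq_ae (by norm_num)
    fun k => hmeas 1 (m k)
  set n : ℕ → ℕ := fun k => m (m' k) with hn
  have hnt : Tendsto n atTop atTop := hm.tendsto_atTop.comp hm'.tendsto_atTop
  set Ψ : ℕ → Plane → Plane := fun k x => ψ 0 (n k) x • planeBasis 0 + ψ 1 (n k) x • planeBasis 1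
    with hΨ
  have hΨae : ∀ᵐ x ∂volume.restrict D, Tendsto (fun k => Ψ k x) atTop (𝓝 (a x)) := by
    filter_upwards [hae0, hae1] with x hx0 hx1
    rw [plane_eq_sum (a x)]
    exact ((hx0.comp hm'.tendsto_atTop).smul_const _).add (hx1.smul_const _)
  have hlip : LipschitzWith C G := by
    refine lipschitzWith_of_nnnorm_fderiv_le (hG.differentiable one_ne_zero) fun y => ?_
    rw [← toDual_gradient, LinearIsometryEquiv.nnnorm_map]
    exact_mod_cast hC y
  have hcomb : ∀ {α : Type} [MeasurableSpace α] {μ : Measure α} {u : Fin 2 → ℕ → α → ℝ} {v : α → Plane},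
      (∀ i, LpTendsto 2 μ (u i) atTop fun x => v x i) →
      LpTendsto 2 μ (fun k x => u 0 k x • planeBasis 0 + u 1 k x • planeBasis 1) atTop v := by
    intro α _ μ u v hu
    refine (((hu 0).clm (ContinuousLinearMap.toSpanSingleton ℝ (planeBasis 0))).add
      ((hu 1).clm (ContinuousLinearMap.toSpanSingleton ℝ (planeBasis 1))) (by norm_num)).congr
      (Eventually.of_forall fun k => Eventually.of_forall fun x => ?_) (Eventually.of_forall fun x => ?_)
    · simp [ContinuousLinearMap.toSpanSingleton_apply]
    · simpa [ContinuousLinearMap.toSpanSingleton_apply] using (plane_eq_sum (v x)).symm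
  refine ⟨fun k x => G (Ψ k x), fun k => ?_, ⟨?_, ?_⟩, ?_⟩
  · exact hG.comp (((h1 0 _).smul contDiff_const).add ((h1 1 _).smul contDiff_const))
  · exact (hcomb fun i => (h2 i).1.comp hnt).lipschitz_comp hlip
  · have hbd : ∀ i, LpTendsto 2 (volume.restrict D)
        (fun k x => gradient G (Ψ k x) i • gradient (ψ i (n k)) x) atTop
        (fun x => gradient G (a x) i • b i x) := fun i => by
      have hgc : Continuous fun y => gradient G y i :=
        (EuclideanSpace.proj i : Plane →L[ℝ] ℝ).continuous.comp (continuous_gradient hG)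
      refine LpTendsto.bdd_smul (C := C) (fun k => ?_) (fun k x => ?_) ?_ ((h2 i).2.comp hnt)
      · refine (hgc.comp ?_).aestronglyMeasurable
        exact ((h1 0 _).continuous.smul continuous_const).add ((h1 1 _).continuous.smul continuous_const)
      · exact (plane_abs_apply_le _ i).trans (hC _)
      · filter_upwards [hΨae] with x hx using (hgc.tendsto _).comp hx
    refine ((hbd 0).add (hbd 1) (by norm_num)).congr
      (Eventually.of_forall fun k => Eventually.of_forall fun x => ?_) ae_eq_rfl
    exact (gradient_comp_eq hG (h1 0 (n k)) (h1 1 (n k)) x).symm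
  · exact (hcomb (v := q) fun i => (h3 i).comp hnt).lipschitz_comp hlip

end HasSobolevTrace
end

/-! ### Arc length integrals -/

section Arc
variable {D : Set Plane} {c : ℝ → Plane}

lemma IsC1JordanDomain.continuous_outerNormal (h : IsC1JordanDomain D c) :
    Continuous (outerNormal c) := by
  have h1 := h.continuous_deriv
  have h2 : Continuous fun θ => ‖deriv c θ‖⁻¹ :=
    h1.norm.inv₀ fun θ => norm_ne_zero_iff.2 (h.regular θ)
  have h3 : Continuous fun v : Plane => (!₂[v 1, -(v 0)] : Plane) := by fun_prop
  exact h2.smul (h3.comp h1)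

lemma norm_outerNormal (h : IsC1JordanDomain D c) (θ : ℝ) : ‖outerNormal c θ‖ = 1 := by
  have h0 := norm_ne_zero_iff.2 (h.regular θ)
  have h1 : ‖(!₂[deriv c θ 1, -(deriv c θ 0)] : Plane)‖ = ‖deriv c θ‖ := by
    rw [← sq_eq_sq₀ (norm_nonneg _) (norm_nonneg _), plane_norm_sq, plane_norm_sq]
    simp; ring
  rw [outerNormal, norm_smul, h1, norm_inv, norm_norm, inv_mul_cancel₀ h0]

lemma IsC1JordanDomain.integrable_arc (h : IsC1JordanDomain D c) {k : ℝ → ℝ} (hk : MemLp k 1 paramMeasure) :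
    Integrable (fun θ => k θ * ‖deriv c θ‖) paramMeasure :=
  memLp_one_iff_integrable.1 (MemLp.mul (p := 1) (q := ⊤)
    (memLp_param_of_continuous h.continuous_deriv.norm ⊤) hk)

lemma IsC1JordanDomain.arcIntegral_add (h : IsC1JordanDomain D c) {k k' : ℝ → ℝ}
    (hk : MemLp k 1 paramMeasure) (hk' : MemLp k' 1 paramMeasure) :
    arcIntegral c (fun θ => k θ + k' θ) = arcIntegral c k + arcIntegral c k' := by
  unfold arcIntegral
  rw [← integral_add (h.integrable_arc hk) (h.integrable_arc hk')]
  simp_rw [add_mul]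

lemma arcIntegral_const_mul (c : ℝ → Plane) (a : ℝ) (k : ℝ → ℝ) :
    arcIntegral c (fun θ => a * k θ) = a * arcIntegral c k := by
  unfold arcIntegral
  rw [← integral_const_mul]; simp_rw [mul_assoc]

lemma arcIntegral_congr (c : ℝ → Plane) {k k' : ℝ → ℝ} (h : k =ᵐ[paramMeasure] k') :
    arcIntegral c k = arcIntegral c k' :=
  integral_congr_ae (h.mono fun θ hθ => by simp only [hθ])

lemma IsC1JordanDomain.injOn_Ioc (h : IsC1JordanDomain D c) : InjOn c (Ioc 0 1) := by
  have h1 : c 1 = c 0 := by simpa using h.periodic 0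
  intro x hx y hy hxy
  rcases hx.2.eq_or_lt with hx1 | hx1 <;> rcases hy.2.eq_or_lt with hy1 | hy1
  · rw [hx1, hy1]
  · have := h.injOn ⟨le_rfl, one_pos⟩ ⟨hy.1.le, hy1⟩ (by rw [← h1, ← hx1, hxy])
    linarith [hy.1]
  · have := h.injOn ⟨le_rfl, one_pos⟩ ⟨hx.1.le, hx1⟩ (by rw [← h1, ← hy1, hxy])
    linarith [hx.1]
  · exact h.injOn ⟨hx.1.le, hx1⟩ ⟨hy.1.le, hy1⟩ hxy

/-- A function on the curve with nonpositive integrals against nonnegative smooth functions of the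
plane is nonpositive: its integrals over subarcs are nonpositive, because the indicator of a compact
set is a bounded limit of powers of smooth functions. -/
lemma IsC1JordanDomain.ae_nonpos (hJ : IsC1JordanDomain D c) {k : ℝ → ℝ} (hk : MemLp k 1 paramMeasure)
    (h : ∀ φ : Plane → ℝ, ContDiff ℝ 2 φ → (∀ x, 0 ≤ φ x) → arcIntegral c (fun θ => φ (c θ) * k θ) ≤ 0) :
    ∀ᵐ θ ∂paramMeasure, k θ ≤ 0 := by
  set F : ℝ → ℝ := fun θ => k θ * ‖deriv c θ‖ with hF
  have hFi : Integrable F paramMeasure := hJ.integrable_arc hk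
  have harc : ∀ a b, 0 < a → a ≤ b → b ≤ 1 → ∫ θ in a..b, F θ ≤ 0 := by
    intro a b ha hab hb
    have hK : IsCompact (c '' Icc a b) := isCompact_Icc.image hJ.contDiff.continuous
    obtain ⟨f, hfs, hfd, hfr⟩ := hK.isClosed.isOpen_compl.exists_contDiff_support_eq (n := 2)
    have hf01 : ∀ x, 0 ≤ f x ∧ f x ≤ 1 := fun x => hfr (mem_range_self x)
    have hmem : ∀ θ ∈ Ioc (0 : ℝ) 1, (f (c θ) = 0 ↔ θ ∈ Icc a b) := by
      intro θ hθ
      rw [← Function.notMem_support, hfs, notMem_compl_iff]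
      constructor
      · rintro ⟨θ', hθ', he⟩
        rwa [← hJ.injOn_Ioc ⟨ha.trans_le hθ'.1, hθ'.2.trans hb⟩ hθ he]
      · exact fun hm => ⟨θ, hm, rfl⟩
    have hlim : Tendsto (fun n : ℕ => ∫ θ, (1 - f (c θ)) ^ n * F θ ∂paramMeasure) atTop
        (𝓝 (∫ θ, (Icc a b).indicator F θ ∂paramMeasure)) := by
      refine tendsto_integral_of_dominated_convergence (fun θ => |F θ|) (fun n => ?_) hFi.norm
        (fun n => Eventually.of_forall fun θ => ?_) ?_
      · exact ((continuous_const.sub (hfd.continuous.comp hJ.contDiff.continuous)).pow n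
          ).aestronglyMeasurable.mul hFi.1
      · rw [norm_mul, norm_pow, Real.norm_eq_abs, Real.norm_eq_abs]
        refine mul_le_of_le_one_left (abs_nonneg _) (pow_le_one₀ (abs_nonneg _) ?_)
        rw [abs_le]; constructor <;> linarith [hf01 (c θ)]
      · filter_upwards [ae_restrict_mem measurableSet_Ioc] with θ hθ
        by_cases hm : θ ∈ Icc a b
        · simp [hm, (hmem θ hθ).2 hm]
        · have hne : f (c θ) ≠ 0 := fun h0 => hm ((hmem θ hθ).1 h0)
          have hpos : 0 < f (c θ) := lt_of_le_of_ne (hf01 _).1 hne.symm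
          rw [indicator_of_notMem hm]
          simpa using (tendsto_pow_atTop_nhds_zero_of_lt_one (r := 1 - f (c θ))
            (by linarith [hf01 (c θ)]) (by linarith)).mul_const (F θ)
    have hle : ∫ θ, (Icc a b).indicator F θ ∂paramMeasure ≤ 0 := by
      refine le_of_tendsto hlim (Eventually.of_forall fun n => ?_)
      have h1 := h (fun x => (1 - f x) ^ n) ((contDiff_const.sub hfd).pow n)
        (fun x => pow_nonneg (by linarith [hf01 x]) n)
      simpa only [arcIntegral, mul_assoc, hF] using h1
    have hsub : Icc a b ⊆ Ioc (0 : ℝ) 1 := fun θ hθ => ⟨ha.trans_le hθ.1, hθ.2.trans hb⟩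
    rw [integral_indicator measurableSet_Icc, paramMeasure, Measure.restrict_restrict measurableSet_Icc,
      inter_eq_self_of_subset_left hsub] at hle
    rwa [intervalIntegral.integral_of_le hab, ← integral_Icc_eq_integral_Ioc]
  have hii : IntervalIntegrable F volume 0 1 := (intervalIntegrable_iff_integrableOn_Ioc_of_le zero_le_one).2 hFi
  have hsub : ∀ {x y : ℝ}, x ∈ Icc (0 : ℝ) 1 → y ∈ Icc (0 : ℝ) 1 → IntervalIntegrable F volume x y := fun hx hy =>
    hii.mono_set (by rw [uIcc_of_le zero_le_one]; exact uIcc_subset_Icc hx hy)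
  have hanti : AntitoneOn (fun x => ∫ θ in (0 : ℝ)..x, F θ) (Ioo 0 1) := by
    intro x hx y hy hxy
    have h0 : (0 : ℝ) ∈ Icc (0 : ℝ) 1 := ⟨le_rfl, zero_le_one⟩
    have := intervalIntegral.integral_add_adjacent_intervals (hsub h0 (Ioo_subset_Icc_self hx))
      (hsub (Ioo_subset_Icc_self hx) (Ioo_subset_Icc_self hy))
    simp only
    linarith [harc x y hx.1 hxy hy.2.le]
  have hae := hii.ae_hasDerivAt_integral
  have h1 : ∀ᵐ θ : ℝ, θ ≠ 1 := by simp [ae_iff]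
  rw [paramMeasure, ae_restrict_iff' measurableSet_Ioc]
  filter_upwards [hae, h1] with θ hθ hθ1 hmem
  have hoo : θ ∈ Ioo (0 : ℝ) 1 := ⟨hmem.1, lt_of_le_of_ne hmem.2 hθ1⟩
  rw [uIcc_of_le zero_le_one] at hθ
  have hd := hθ (Ioo_subset_Icc_self hoo) 0 ⟨le_rfl, zero_le_one⟩
  have hle : F θ ≤ 0 := hd.hasDerivWithinAt.nonpos_of_antitoneOn
    (uniqueDiffWithinAt_iff_accPt.1 (isOpen_Ioo.uniqueDiffWithinAt hoo)) hanti
  exact nonpos_of_mul_nonpos_left hle (norm_pos_iff.2 (hJ.regular θ))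

lemma memLp_mul_continuous {p : ENNReal} {k : ℝ → ℝ} (hk : MemLp k p paramMeasure) {m : ℝ → ℝ}
    (hm : Continuous m) : MemLp (fun θ => k θ * m θ) p paramMeasure :=
  MemLp.mul (p := p) (q := ⊤) (memLp_param_of_continuous hm ⊤) hk

/-- The divergence theorem for vector fields of class `W^{1,1}` with a trace. -/
theorem IsC1JordanDomain.integral_div_eq (hJ : IsC1JordanDomain D c) {X₀ X₁ : Plane → ℝ}
    {G₀ G₁ : Plane → Plane} {r₀ r₁ : ℝ → ℝ} (h₀ : HasSobolevTrace 1 D c X₀ G₀ r₀)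
    (h₁ : HasSobolevTrace 1 D c X₁ G₁ r₁) :
    ∫ x in D, (G₀ x 0 + G₁ x 1) =
      arcIntegral c fun θ => r₀ θ * outerNormal c θ 0 + r₁ θ * outerNormal c θ 1 := by
  have hn : ∀ i, Continuous fun θ => outerNormal c θ i := fun i =>
    (EuclideanSpace.proj i : Plane →L[ℝ] ℝ).continuous.comp hJ.continuous_outerNormal
  have hG : ∀ {G : Plane → Plane} (i : Fin 2), MemLp G 1 (volume.restrict D) →
      Integrable (fun x => G x i) (volume.restrict D) := fun i h =>
    memLp_one_iff_integrable.1 ((EuclideanSpace.proj i : Plane →L[ℝ] ℝ).comp_memLp' h)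
  rw [integral_add (hG 0 h₀.memLp_grad) (hG 1 h₁.memLp_grad),
    hJ.arcIntegral_add (memLp_mul_continuous h₀.memLp_trace (hn 0))
    (memLp_mul_continuous h₁.memLp_trace (hn 1))]
  have e₀ := h₀.integral_inner_eq hJ (planeBasis 0)
  have e₁ := h₁.integral_inner_eq hJ (planeBasis 1)
  simp only [plane_inner] at e₀ e₁
  congr 1
  · simpa using e₀
  · simpa using e₁

end Arc

/-! ### Boundary behaviour of nonnegative functions in `H² ∩ H¹₀` -/

section Boundary
variable {D : Set Plane} {c : ℝ → Plane} {f : Plane → ℝ} {g : Plane → Plane} {r : ℝ → ℝ}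

lemma HasWeakGrad.integral_apply {φ : Plane → ℝ} (h : HasWeakGrad D f g) (hφ : IsTestFun D φ)
    (i : Fin 2) : ∫ x in D, f x * gradient φ x i = -∫ x in D, φ x * g x i := by
  have h1 := congrArg (EuclideanSpace.proj i : Plane →L[ℝ] ℝ) (h.2.2 φ hφ)
  rw [map_neg, ← ContinuousLinearMap.integral_comp_comm _ (h.integrableOn_smul hφ).1,
    ← ContinuousLinearMap.integral_comp_comm _ (h.integrableOn_smul hφ).2] at h1
  simpa using h1

/-- The truncations `arctan (n f)` of an `H¹` function. -/
lemma HasSobolevTrace.arctan (hb : Bornology.IsBounded D) (h : HasSobolevTrace 2 D c f g r) (n : ℝ) :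
    HasSobolevTrace 2 D c (fun x => Real.arctan (n * f x))
      (fun x => (n / (1 + (n * f x) ^ 2)) • g x) (fun θ => Real.arctan (n * r θ)) := by
  set G : Plane → ℝ := fun y => Real.arctan (n * y 0) with hG
  have hp : ContDiff ℝ 1 fun y : Plane => y 0 := (EuclideanSpace.proj 0 : Plane →L[ℝ] ℝ).contDiff
  have hGc : ContDiff ℝ 1 G := Real.contDiff_arctan.comp (contDiff_const.mul hp)
  have hgrad : ∀ y, gradient G y = (n / (1 + (n * y 0) ^ 2)) • planeBasis 0 := fun y => by
    have h0 : HasFDerivAt (fun y : Plane => y 0) (EuclideanSpace.proj 0 : Plane →L[ℝ] ℝ) y :=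
      (EuclideanSpace.proj 0 : Plane →L[ℝ] ℝ).hasFDerivAt
    have h1 : HasFDerivAt G _ y :=
      (Real.hasDerivAt_arctan (n * y 0)).comp_hasFDerivAt (f := fun y : Plane => n * y 0) y (h0.const_mul n)
    refine gradient_eq_of_hasFDerivAt h1 fun e => ?_
    rw [inner_smul_left, plane_inner]
    simp
    ring
  have hbd : ∀ y, ‖gradient G y‖ ≤ (⟨|n|, abs_nonneg n⟩ : NNReal) := fun y => by
    rw [hgrad, norm_smul]
    simp only [PiLp.norm_single, norm_one, mul_one, Real.norm_eq_abs, abs_div]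
    exact div_le_self (abs_nonneg n) (le_trans (by nlinarith [sq_nonneg (n * y 0)]) (le_abs_self _))
  have hzero : HasSobolevTrace 2 D c (fun _ => 0) (fun _ => 0) (fun _ => 0) := by
    refine (h.const_mul 0).congr ?_ ?_ ?_ <;> exact Eventually.of_forall fun x => by simp
  have := HasSobolevTrace.comp hb hGc hbd (a := fun x => f x • planeBasis 0)
    (b := fun i => if i = 0 then g else fun _ => 0) (q := fun θ => r θ • planeBasis 0) (c := c)
    (fun i => by fin_cases i <;> [simpa using h; simpa using hzero])
  refine this.congr (Eventually.of_forall fun x => by simp [hG]) (Eventually.of_forall fun x => ?_)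
    (Eventually.of_forall fun x => by simp [hG])
  simp [hgrad]

lemma abs_arctan_le (t : ℝ) : |Real.arctan t| ≤ Real.pi / 2 :=
  abs_le.2 ⟨(Real.neg_pi_div_two_lt_arctan t).le, (Real.arctan_lt_pi_div_two t).le⟩

lemma tendsto_inv_one_add_sq (t : ℝ) : Tendsto (fun n : ℕ => (1 + ((n + 1 : ℝ) * t) ^ 2)⁻¹) atTop
    (𝓝 (if t = 0 then 1 else 0)) := by
  by_cases ht : t = 0
  · simp [ht]
  · rw [if_neg ht]
    refine tendsto_inv_atTop_zero.comp (tendsto_atTop_add_const_left _ _ ?_)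
    have h1 : Tendsto (fun n : ℕ => (n : ℝ) + 1) atTop atTop :=
      tendsto_atTop_add_const_right _ _ tendsto_natCast_atTop_atTop
    have h2 := ((tendsto_pow_atTop (α := ℝ) two_ne_zero).comp h1).atTop_mul_const
      (by positivity : 0 < t ^ 2)
    simpa only [mul_pow, Function.comp_def] using h2

/-- The weak gradient of an `H¹` function vanishes almost everywhere on its zero set: the functions
`arctan (n f) / n` converge uniformly to `0`, while their gradients converge to `1_{f = 0} ∇f`. -/
theorem HasSobolevTrace.grad_eq_zero (hD : IsOpen D) (hb : Bornology.IsBounded D)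
    (h : HasSobolevTrace 2 D c f g r) : ∀ᵐ x ∂(volume.restrict D), f x = 0 → g x = 0 := by
  have hfin := isFiniteMeasure_restrict hb
  have hn : ∀ n : ℕ, (0 : ℝ) < n + 1 := fun n => by positivity
  have hmeas : ∀ n : ℕ, AEStronglyMeasurable (fun x => (1 + ((n + 1 : ℝ) * f x) ^ 2)⁻¹)
      (volume.restrict D) := fun n => by
    have hc : Continuous fun t : ℝ => (1 + ((n + 1 : ℝ) * t) ^ 2)⁻¹ :=
      Continuous.inv₀ (by fun_prop) fun t => by positivity
    exact hc.comp_aestronglyMeasurable h.memLp.1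
  have hgrad : LpTendsto 2 (volume.restrict D)
      (fun n : ℕ => fun x => (1 + ((n + 1 : ℝ) * f x) ^ 2)⁻¹ • g x) atTop
      (fun x => (if f x = 0 then (1 : ℝ) else 0) • g x) := by
    refine LpTendsto.bdd_smul (C := 1) hmeas (fun n x => ?_) ?_ (LpTendsto.const h.memLp_grad)
    · rw [abs_of_pos (by positivity)]
      exact inv_le_one_of_one_le₀ (by nlinarith [sq_nonneg ((n + 1 : ℝ) * f x)])
    · exact Eventually.of_forall fun x => tendsto_inv_one_add_sq (f x)
  have hw : ∀ n : ℕ, HasWeakGrad D (fun x => (n + 1 : ℝ)⁻¹ * Real.arctan ((n + 1) * f x))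
      (fun x => (1 + ((n + 1 : ℝ) * f x) ^ 2)⁻¹ • g x) := fun n => by
    have h1 := ((h.arctan hb (n + 1)).const_mul (n + 1 : ℝ)⁻¹).hasWeakGrad hb (by norm_num)
    refine h1.congr hD ae_eq_rfl (Eventually.of_forall fun x => ?_)
    have := (hn n).ne'
    simp only [smul_smul]
    congr 1
    field_simp
  have hval : LpTendsto 2 (volume.restrict D)
      (fun n : ℕ => fun x => (n + 1 : ℝ)⁻¹ * Real.arctan ((n + 1) * f x)) atTop (fun _ => 0) := by
    refine LpTendsto.of_dominated (b := fun _ => Real.pi / 2) (fun n => ?_) (memLp_const _)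
      (fun n => Eventually.of_forall fun x => ?_) (Eventually.of_forall fun x => ?_)
    · exact ((Real.continuous_arctan.comp (by fun_prop : Continuous fun t : ℝ => (n + 1 : ℝ) * t)
        ).comp_aestronglyMeasurable h.memLp.1).const_mul _
    · rw [norm_mul, Real.norm_eq_abs, Real.norm_eq_abs]
      have h1 : |(n + 1 : ℝ)⁻¹| ≤ 1 := by
        rw [abs_of_pos (inv_pos.2 (hn n))]
        exact inv_le_one_of_one_le₀ (by linarith [(Nat.cast_nonneg n : (0 : ℝ) ≤ n)])
      have h2 := abs_arctan_le ((n + 1) * f x)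
      nlinarith [abs_nonneg ((n + 1 : ℝ)⁻¹), abs_nonneg (Real.arctan ((n + 1) * f x))]
    · have h1 : Tendsto (fun n : ℕ => (n + 1 : ℝ)⁻¹) atTop (𝓝 0) := by
        simpa using tendsto_one_div_add_atTop_nhds_zero_nat (𝕜 := ℝ)
      refine squeeze_zero_norm (fun n => ?_) (by simpa using h1.mul_const (Real.pi / 2))
      rw [norm_mul, Real.norm_eq_abs, Real.norm_eq_abs, abs_of_pos (inv_pos.2 (hn n))]
      exact mul_le_mul_of_nonneg_left (abs_arctan_le _) (inv_pos.2 (hn n)).le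
  have hzero := ae_eq_of_forall_testFun hD (f := fun x => (if f x = 0 then (1 : ℝ) else 0) • g x)
    (g := fun _ => 0) (locallyIntegrableOn_of_memLp hb (by norm_num) hgrad.memLp_lim)
    (locallyIntegrableOn_of_memLp hb (p := 2) (by norm_num) MemLp.zero) (fun φ hφ _ => by
      have t1 := ((LpTendsto.const (l := (atTop : Filter ℕ)) (memLp_of_continuous hb hφ.1.continuous 2)).smul
        (r := 1) le_rfl hgrad).integral
      have t2 := (hval.smul (r := 1) le_rfl (LpTendsto.const
        (memLp_of_continuous hb (continuous_gradient hφ.1) 2))).integral.neg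
      have t3 := tendsto_nhds_unique t1 (t2.congr fun n => by rw [(hw n).2.2 φ hφ, neg_neg])
      rw [t3]; simp)
  filter_upwards [hzero] with x hx hfx
  simpa [hfx] using hx

end Boundary

section Hessian
variable {D : Set Plane} {c : ℝ → Plane} {u : Plane → ℝ} {a : Plane → Plane}
  {b : Fin 2 → Plane → Plane} {q : ℝ → Plane}

lemma contDiff_partial {φ : Plane → ℝ} (hφ : ContDiff ℝ 2 φ) (i : Fin 2) :
    ContDiff ℝ 1 fun x => fderiv ℝ φ x (planeBasis i) :=
  (hφ.fderiv_right (m := 1) (by norm_num)).clm_apply contDiff_const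

lemma gradient_partial_comm {φ : Plane → ℝ} (hφ : ContDiff ℝ 2 φ) (i j : Fin 2) (x : Plane) :
    gradient (fun x => fderiv ℝ φ x (planeBasis i)) x j =
      gradient (fun x => fderiv ℝ φ x (planeBasis j)) x i := by
  have hd : DifferentiableAt ℝ (fderiv ℝ φ) x :=
    (hφ.fderiv_right (m := 1) (by norm_num)).differentiable one_ne_zero x
  have h1 : ∀ i j, gradient (fun x => fderiv ℝ φ x (planeBasis i)) x j =
      fderiv ℝ (fderiv ℝ φ) x (planeBasis j) (planeBasis i) := fun i j => by
    rw [gradient_apply_eq, fderiv_clm_apply hd (differentiableAt_const _)]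
    simp
  rw [h1, h1]
  exact (hφ.contDiffAt.isSymmSndFDerivAt (by simp)).eq _ _

lemma IsTestFun.partial {φ : Plane → ℝ} (hφ : IsTestFun D φ) (h2 : ContDiff ℝ 2 φ) (i : Fin 2) :
    IsTestFun D fun x => fderiv ℝ φ x (planeBasis i) := by
  have hsub : tsupport (fun x => fderiv ℝ φ x (planeBasis i)) ⊆ tsupport φ :=
    closure_minimal (fun x hx => by
      by_contra h0
      exact hx (by simp [fderiv_eq_zero_of_notMem_tsupport h0])) (isClosed_tsupport φ)
  exact ⟨contDiff_partial h2 i, hφ.2.1.of_isClosed_subset (isClosed_tsupport _) hsub, hsub.trans hφ.2.2⟩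

/-- The weak Hessian is symmetric. -/
lemma weakHessian_symm (hD : IsOpen D) (hu : HasWeakGrad D u a)
    (ha : ∀ i, HasWeakGrad D (fun x => a x i) (b i)) :
    (fun x => b 0 x 1) =ᵐ[volume.restrict D] fun x => b 1 x 0 := by
  have hloc : ∀ i j, LocallyIntegrableOn (fun x => b i x j) D := fun i j x hx => by
    obtain ⟨s, hs, hi⟩ := (ha i).2.1 x hx
    exact ⟨s, hs, (EuclideanSpace.proj j : Plane →L[ℝ] ℝ).integrable_comp hi⟩
  refine ae_eq_of_forall_testFun hD (hloc 0 1) (hloc 1 0) fun φ hφ h2 => ?_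
  have key : ∀ i j, ∫ x in D, φ x • b i x j =
      ∫ x in D, u x * gradient (fun x => fderiv ℝ φ x (planeBasis j)) x i := fun i j => by
    have h1 := (ha i).integral_apply hφ j
    have h3 := hu.integral_apply (hφ.partial h2 j) i
    simp only [smul_eq_mul]
    rw [h3, ← neg_eq_iff_eq_neg.2 h1]
    congr 1
    refine integral_congr_ae (Eventually.of_forall fun x => ?_)
    simp only [gradient_apply_eq]; ring
  rw [key, key]
  refine integral_congr_ae (Eventually.of_forall fun x => ?_)
  simp only [gradient_partial_comm h2 1 0 x]

/-- The gradient of a function vanishing on the boundary curve has no tangential component there,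
because the rotated gradient is divergence free. -/
lemma tangential_eq_zero (hJ : IsC1JordanDomain D c) (hu : HasSobolevTrace 2 D c u a fun _ => 0)
    (ha : ∀ i, HasSobolevTrace 2 D c (fun x => a x i) (b i) fun θ => q θ i) :
    ∀ᵐ θ ∂paramMeasure, q θ 0 * outerNormal c θ 1 - q θ 1 * outerNormal c θ 0 = 0 := by
  have hb := hJ.isBounded
  have hc := hJ.contDiff.continuous
  have h12 : (1 : ENNReal) ≤ 2 := by norm_num
  have hsymm := weakHessian_symm hJ.isOpen (hu.hasWeakGrad hb h12) fun i => (ha i).hasWeakGrad hb h12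
  set k : ℝ → ℝ := fun θ => q θ 0 * outerNormal c θ 1 - q θ 1 * outerNormal c θ 0 with hk
  have hn : ∀ i, Continuous fun θ => outerNormal c θ i := fun i =>
    (EuclideanSpace.proj i : Plane →L[ℝ] ℝ).continuous.comp hJ.continuous_outerNormal
  have hk1 : MemLp k 1 paramMeasure :=
    ((memLp_mul_continuous (ha 0).memLp_trace (hn 1)).sub
      (memLp_mul_continuous (ha 1).memLp_trace (hn 0))).mono_exponent h12
  have hzero : ∀ φ : Plane → ℝ, ContDiff ℝ 2 φ → arcIntegral c (fun θ => φ (c θ) * k θ) = 0 := by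
    intro φ h2
    have hφ1 : ContDiff ℝ 1 φ := h2.of_le (by norm_num)
    -- the divergence theorem for `φ` times the rotated gradient of `u`, and for `u` times the rotated
    -- gradient of `φ`: the integrands over `D` are opposite, and the second boundary term is zero
    have A := hJ.integral_div_eq
      (((ha 1).mul_contDiff hb hc h12 hφ1).const_mul (-1) |>.mono_exponent hb)
      (((ha 0).mul_contDiff hb hc h12 hφ1).mono_exponent hb)
    have B := hJ.integral_div_eq
      ((hu.mul_contDiff hb hc h12 (contDiff_partial h2 1)).const_mul (-1) |>.mono_exponent hb)
      ((hu.mul_contDiff hb hc h12 (contDiff_partial h2 0)).mono_exponent hb)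
    have hB : arcIntegral c (fun θ => -1 * (fderiv ℝ φ (c θ) (planeBasis 1) * 0) * outerNormal c θ 0 +
        fderiv ℝ φ (c θ) (planeBasis 0) * 0 * outerNormal c θ 1) = 0 := by
      simp [arcIntegral]
    rw [hB] at B
    have hAe : arcIntegral c (fun θ => φ (c θ) * k θ) = arcIntegral c (fun θ =>
        -1 * (φ (c θ) * q θ 1) * outerNormal c θ 0 + φ (c θ) * q θ 0 * outerNormal c θ 1) := by
      congr 1; ext θ; simp only [hk]; ring
    rw [hAe, ← A, ← neg_eq_zero, ← integral_neg, ← B]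
    refine integral_congr_ae ?_
    filter_upwards [hsymm] with x hx
    have h3 := gradient_partial_comm h2 1 0 x
    simp only [PiLp.smul_apply, PiLp.add_apply, smul_eq_mul, h3, hx, gradient_apply_eq φ]
    ring
  have hle := hJ.ae_nonpos hk1 fun φ h1 _ => (hzero φ h1).le
  have hge := hJ.ae_nonpos hk1.neg fun φ h1 _ => by
    have := arcIntegral_const_mul c (-1) (fun θ => φ (c θ) * k θ)
    rw [hzero φ h1] at this
    refine le_of_eq ?_
    rw [mul_zero] at this
    rw [← this]
    congr 1; ext θ; simp
  filter_upwards [hle, hge] with θ h1 h2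
  exact le_antisymm h1 (neg_nonpos.1 h2)

/-- A nonnegative function that vanishes on the boundary curve does not increase towards it.
Testing `div (φ ∇u)` with the nonnegative truncations `arctan (n u)`, which vanish on the boundary,
gives `∫ arctan (n u) div (φ ∇u) ≤ 0`. As `n → ∞` only `{u > 0}` is left, and `div (φ ∇u)` vanishes
almost everywhere on `{u = 0}`. -/
lemma normal_nonpos (hJ : IsC1JordanDomain D c) (hu : HasSobolevTrace 2 D c u a fun _ => 0)
    (ha : ∀ i, HasSobolevTrace 2 D c (fun x => a x i) (b i) fun θ => q θ i)
    (hpos : ∀ᵐ x ∂(volume.restrict D), 0 ≤ u x) :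
    ∀ᵐ θ ∂paramMeasure, q θ 0 * outerNormal c θ 0 + q θ 1 * outerNormal c θ 1 ≤ 0 := by
  have hb := hJ.isBounded
  have hfin := isFiniteMeasure_restrict hb
  have hc := hJ.contDiff.continuous
  have h12 : (1 : ENNReal) ≤ 2 := by norm_num
  have hn : ∀ i, Continuous fun θ => outerNormal c θ i := fun i =>
    (EuclideanSpace.proj i : Plane →L[ℝ] ℝ).continuous.comp hJ.continuous_outerNormal
  refine hJ.ae_nonpos (((memLp_mul_continuous (ha 0).memLp_trace (hn 0)).add
      (memLp_mul_continuous (ha 1).memLp_trace (hn 1))).mono_exponent h12) fun φ h2 hφ0 => ?_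
  have hφ1 : ContDiff ℝ 1 φ := h2.of_le (by norm_num)
  have hX : ∀ i, HasSobolevTrace 2 D c (fun x => φ x * a x i)
    (fun x => φ x • b i x + a x i • gradient φ x) (fun θ => φ (c θ) * q θ i) := fun i =>
    (ha i).mul_contDiff hb hc h12 hφ1
  set d : Plane → ℝ := fun x => (φ x • b 0 x + a x 0 • gradient φ x) 0 +
    (φ x • b 1 x + a x 1 • gradient φ x) 1 with hd
  have hdL : MemLp d 2 (volume.restrict D) :=
    ((EuclideanSpace.proj 0 : Plane →L[ℝ] ℝ).comp_memLp' (hX 0).memLp_grad).add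
      ((EuclideanSpace.proj 1 : Plane →L[ℝ] ℝ).comp_memLp' (hX 1).memLp_grad)
  have hA := hJ.integral_div_eq ((hX 0).mono_exponent hb) ((hX 1).mono_exponent hb)
  have hgoal : arcIntegral c (fun θ => φ (c θ) *
      (q θ 0 * outerNormal c θ 0 + q θ 1 * outerNormal c θ 1)) = ∫ x in D, d x := by
    rw [hA]; congr 1; ext θ; ring
  -- the truncated inequality
  have htr : ∀ n : ℕ, ∫ x in D, Real.arctan (n * u x) * d x ≤ 0 := fun n => by
    have hS := hu.arctan hb n
    have hB := hJ.integral_div_eq (hS.mul (hX 0)) (hS.mul (hX 1))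
    have h0 : arcIntegral c (fun θ => Real.arctan (n * 0) * (φ (c θ) * q θ 0) * outerNormal c θ 0 +
        Real.arctan (n * 0) * (φ (c θ) * q θ 1) * outerNormal c θ 1) = 0 := by
      simp [arcIntegral]
    rw [h0] at hB
    have hSd : Integrable (fun x => Real.arctan (n * u x) * d x) (volume.restrict D) :=
      memLp_one_iff_integrable.1 (MemLp.mul (p := 2) (q := 2) hdL hS.memLp)
    have hrest : Integrable (fun x => φ x * a x 0 * ((n / (1 + (n * u x) ^ 2)) * a x 0) +
        φ x * a x 1 * ((n / (1 + (n * u x) ^ 2)) * a x 1)) (volume.restrict D) := by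
      have hi : ∀ i, Integrable (fun x => φ x * a x i * ((n / (1 + (n * u x) ^ 2)) * a x i))
          (volume.restrict D) := fun i =>
        memLp_one_iff_integrable.1 (MemLp.mul (p := 2) (q := 2)
          ((EuclideanSpace.proj i : Plane →L[ℝ] ℝ).comp_memLp' hS.memLp_grad) (hX i).memLp)
      exact (hi 0).add (hi 1)
    have hsum : (∫ x in D, Real.arctan (n * u x) * d x) + ∫ x in D,
        (φ x * a x 0 * ((n / (1 + (n * u x) ^ 2)) * a x 0) +
        φ x * a x 1 * ((n / (1 + (n * u x) ^ 2)) * a x 1)) = 0 := by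
      rw [← integral_add hSd hrest, ← hB]
      refine integral_congr_ae (Eventually.of_forall fun x => ?_)
      simp only [hd, PiLp.smul_apply, PiLp.add_apply, smul_eq_mul]
      ring
    have hnn : 0 ≤ ∫ x in D, (φ x * a x 0 * ((n / (1 + (n * u x) ^ 2)) * a x 0) +
        φ x * a x 1 * ((n / (1 + (n * u x) ^ 2)) * a x 1)) := by
      refine integral_nonneg fun x => ?_
      have hf : 0 ≤ (n : ℝ) / (1 + (n * u x) ^ 2) := by positivity
      have := mul_nonneg (mul_nonneg (hφ0 x) hf) (add_nonneg (sq_nonneg (a x 0)) (sq_nonneg (a x 1)))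
      calc (0 : ℝ) ≤ _ := this
        _ = _ := by ring
    linarith
  -- `div (φ ∇u)` vanishes on the zero set of `u`
  have hdz : ∀ᵐ x ∂(volume.restrict D), u x = 0 → d x = 0 := by
    filter_upwards [hu.grad_eq_zero hJ.isOpen hb, (ha 0).grad_eq_zero hJ.isOpen hb,
      (ha 1).grad_eq_zero hJ.isOpen hb] with x h1 h3 h4 hx
    have h5 := h1 hx
    have h6 : b 0 x = 0 := h3 (by simp [h5])
    have h7 : b 1 x = 0 := h4 (by simp [h5])
    simp [hd, h5, h6, h7]
  have hlim : Tendsto (fun n : ℕ => ∫ x in D, Real.arctan (n * u x) * d x) atTop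
      (𝓝 (∫ x in D, Real.pi / 2 * d x)) := by
    refine tendsto_integral_of_dominated_convergence (fun x => Real.pi / 2 * |d x|) (fun n => ?_)
      ((hdL.integrable h12).abs.const_mul _) (fun n => Eventually.of_forall fun x => ?_) ?_
    · exact (hu.arctan hb n).memLp.1.mul hdL.1
    · rw [norm_mul, Real.norm_eq_abs, Real.norm_eq_abs]
      exact mul_le_mul_of_nonneg_right (abs_arctan_le _) (abs_nonneg _)
    · filter_upwards [hdz, hpos] with x h1 h3
      rcases h3.eq_or_lt with h4 | h4
      · simp [h1 h4.symm]
      · refine Tendsto.mul_const _ ?_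
        exact (tendsto_nhds_of_tendsto_nhdsWithin Real.tendsto_arctan_atTop).comp
          (tendsto_natCast_atTop_atTop.atTop_mul_const h4)
  have h8 := le_of_tendsto hlim (Eventually.of_forall htr)
  rw [integral_const_mul] at h8
  rw [hgoal]
  exact nonpos_of_mul_nonpos_right h8 (by positivity)

/-- On the boundary curve the gradient of a nonnegative function of `H² ∩ H¹₀` points along the
inner normal. -/
theorem trace_grad_eq (hJ : IsC1JordanDomain D c) (hu : HasSobolevTrace 2 D c u a fun _ => 0)
    (ha : ∀ i, HasSobolevTrace 2 D c (fun x => a x i) (b i) fun θ => q θ i)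
    (hpos : ∀ᵐ x ∂(volume.restrict D), 0 ≤ u x) :
    ∀ᵐ θ ∂paramMeasure, q θ = -(‖q θ‖ • outerNormal c θ) := by
  filter_upwards [tangential_eq_zero hJ hu ha, normal_nonpos hJ hu ha hpos] with θ h1 h2
  have hn := plane_norm_sq (outerNormal c θ)
  rw [norm_outerNormal hJ] at hn
  have hnq : ‖q θ‖ = -(q θ 0 * outerNormal c θ 0 + q θ 1 * outerNormal c θ 1) := by
    rw [← sq_eq_sq₀ (norm_nonneg _) (by linarith), plane_norm_sq]
    linear_combination (-(q θ 0 ^ 2 + q θ 1 ^ 2)) * (-1 : ℝ) * hn +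
      (q θ 0 * outerNormal c θ 1 - q θ 1 * outerNormal c θ 0) * h1
  ext i
  fin_cases i
  · simp only [hnq, PiLp.neg_apply, PiLp.smul_apply, smul_eq_mul, Fin.zero_eta]
    linear_combination q θ 0 * hn + outerNormal c θ 1 * h1
  · simp only [hnq, PiLp.neg_apply, PiLp.smul_apply, smul_eq_mul, Fin.mk_one]
    linear_combination q θ 1 * hn - outerNormal c θ 0 * h1

end Hessian

/-! ### Pullback by diffeomorphisms -/

namespace LpTendsto
variable {α β ι E : Type*} [MeasurableSpace α] [MeasurableSpace β] [NormedAddCommGroup E]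
  {p : ENNReal} {μ : Measure α} {l : Filter ι} {f : α → E} {u : ι → α → E}

lemma smul_measure (hu : LpTendsto p μ u l f) {C : ENNReal} (hC : C ≠ ⊤) (hp : p ≠ 0) :
    LpTendsto p (C • μ) u l f := by
  have hle : ∀ w : α → E, eLpNorm w p (C • μ) ≤ C ^ p.toReal⁻¹ * eLpNorm w p μ ∨ p = ⊤ := fun w => by
    by_cases h : p = ⊤
    · exact Or.inr h
    · left
      rw [eLpNorm_smul_measure_of_ne_top h, smul_eq_mul, one_div, ENNReal.toReal_inv]
  refine ⟨hu.memLp.mono fun i h => h.smul_measure hC, hu.memLp_lim.smul_measure hC, ?_⟩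
  by_cases h : p = ⊤
  · subst h
    refine tendsto_of_tendsto_of_tendsto_of_le_of_le tendsto_const_nhds hu.tendsto
      (fun _ => zero_le) fun i => ?_
    rw [eLpNorm_exponent_top, eLpNorm_exponent_top]
    exact eLpNormEssSup_mono_measure _ Measure.smul_absolutelyContinuous
  · have h0 := ENNReal.Tendsto.const_mul (a := C ^ p.toReal⁻¹) hu.tendsto
      (Or.inr (ENNReal.rpow_ne_top_of_nonneg (by positivity) hC))
    rw [mul_zero] at h0
    exact tendsto_of_tendsto_of_tendsto_of_le_of_le tendsto_const_nhds h0 (fun _ => zero_le)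
      fun i => (hle _).resolve_right h

lemma comp_measurable {ν : Measure β} {Ψ : β → α} (hΨ : AEMeasurable Ψ ν)
    (hu : LpTendsto p (ν.map Ψ) u l f) :
    LpTendsto p ν (fun i y => u i (Ψ y)) l (fun y => f (Ψ y)) := by
  refine ⟨hu.memLp.mono fun i h => h.comp_of_map hΨ, hu.memLp_lim.comp_of_map hΨ, ?_⟩
  refine hu.tendsto.congr' ?_
  filter_upwards [hu.memLp] with i hi
  exact eLpNorm_map_measure (hi.1.sub hu.memLp_lim.1) hΨ

end LpTendsto

section Pullback
variable {E : Set Plane} {Ψ : Plane ≃ₜ Plane}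

lemma isBounded_preimage (hb : Bornology.IsBounded E) : Bornology.IsBounded (Ψ ⁻¹' E) := by
  rw [← Homeomorph.image_symm]
  exact (hb.isCompact_closure.image Ψ.symm.continuous).isBounded.subset (image_mono subset_closure)

/-- A diffeomorphism maps Lebesgue measure on bounded sets to a measure with bounded density. -/
lemma exists_map_restrict_le (hE : MeasurableSet E) (hb : Bornology.IsBounded E)
    (hΨ' : ContDiff ℝ 1 Ψ.symm) :
    ∃ C : ENNReal, C ≠ ⊤ ∧ (volume.restrict (Ψ ⁻¹' E)).map Ψ ≤ C • volume.restrict E := by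
  have hcont : Continuous fun x => (fderiv ℝ Ψ.symm x).det :=
    ContinuousLinearMap.continuous_det.comp (hΨ'.continuous_fderiv one_ne_zero)
  obtain ⟨M, hM⟩ := hb.isCompact_closure.exists_bound_of_continuousOn hcont.continuousOn
  refine ⟨ENNReal.ofReal M, ENNReal.ofReal_ne_top, Measure.le_iff.2 fun A hA => ?_⟩
  rw [Measure.map_apply Ψ.continuous.measurable hA, Measure.restrict_apply (Ψ.continuous.measurable hA),
    ← preimage_inter, Measure.smul_apply, Measure.restrict_apply hA, ← Homeomorph.image_symm,
    ← lintegral_abs_det_fderiv_eq_addHaar_image volume (hA.inter hE)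
      (fun x _ => ((hΨ'.differentiable one_ne_zero x).hasFDerivAt).hasFDerivWithinAt)
      Ψ.symm.injective.injOn]
  calc ∫⁻ x in A ∩ E, ENNReal.ofReal |(fderiv ℝ Ψ.symm x).det|
      ≤ ∫⁻ _ in A ∩ E, ENNReal.ofReal M := by
        refine setLIntegral_mono measurable_const fun x hx => ENNReal.ofReal_le_ofReal ?_
        exact hM x (subset_closure hx.2)
    _ = _ := by simp

lemma LpTendsto.pullback {F ι : Type*} [NormedAddCommGroup F] {p : ENNReal} (hp : p ≠ 0)
    {l : Filter ι} {u : ι → Plane → F} {f : Plane → F} (hE : MeasurableSet E)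
    (hb : Bornology.IsBounded E) (hΨ' : ContDiff ℝ 1 Ψ.symm)
    (hu : LpTendsto p (volume.restrict E) u l f) :
    LpTendsto p (volume.restrict (Ψ ⁻¹' E)) (fun i y => u i (Ψ y)) l (fun y => f (Ψ y)) := by
  obtain ⟨C, hC, hle⟩ := exists_map_restrict_le hE hb hΨ'
  exact ((hu.smul_measure hC hp).mono_measure hle).comp_measurable Ψ.continuous.aemeasurable

/-- The transpose of the differential of `Ψ`. -/
def transposeDeriv (Ψ : Plane → Plane) (y : Plane) : Plane →L[ℝ] Plane :=
  ContinuousLinearMap.adjoint (fderiv ℝ Ψ y)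

lemma continuous_transposeDeriv (hΨ : ContDiff ℝ 1 Ψ) : Continuous (transposeDeriv Ψ) :=
  (ContinuousLinearMap.adjoint (𝕜 := ℝ) (E := Plane) (F := Plane)).continuous.comp
    (hΨ.continuous_fderiv one_ne_zero)

lemma gradient_comp_homeo (hΨ : ContDiff ℝ 1 Ψ) {φ : Plane → ℝ} (hφ : ContDiff ℝ 1 φ) (y : Plane) :
    gradient (fun y => φ (Ψ y)) y = transposeDeriv Ψ y (gradient φ (Ψ y)) := by
  refine gradient_eq_of_hasFDerivAt ((hφ.differentiable one_ne_zero _).hasFDerivAt.comp y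
    (hΨ.differentiable one_ne_zero y).hasFDerivAt) fun e => ?_
  rw [transposeDeriv, ContinuousLinearMap.adjoint_inner_left, inner_gradient_left]
  rfl

lemma IsTestFun.comp_homeo (hΨ : ContDiff ℝ 1 Ψ) {φ : Plane → ℝ} (hφ : IsTestFun E φ) :
    IsTestFun (Ψ ⁻¹' E) fun y => φ (Ψ y) := by
  refine ⟨hφ.1.comp hΨ, hφ.2.1.comp_homeomorph Ψ, ?_⟩
  have h1 : tsupport (fun y => φ (Ψ y)) ⊆ Ψ ⁻¹' tsupport φ :=
    closure_minimal (fun y hy => subset_tsupport φ hy) ((isClosed_tsupport φ).preimage Ψ.continuous)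
  exact h1.trans (preimage_mono hφ.2.2)

lemma IsH10Lim.pullback (hE : MeasurableSet E) (hb : Bornology.IsBounded E) (hΨ : ContDiff ℝ 1 Ψ)
    (hΨ' : ContDiff ℝ 1 Ψ.symm) {f : Plane → ℝ} {g : Plane → Plane} (h : IsH10Lim E f g) :
    IsH10Lim (Ψ ⁻¹' E) (fun y => f (Ψ y)) (fun y => transposeDeriv Ψ y (g (Ψ y))) := by
  obtain ⟨φ, h1, h2, h3⟩ := h
  refine ⟨fun k y => φ k (Ψ y), fun k => (h1 k).comp_homeo hΨ, h2.pullback two_ne_zero hE hb hΨ', ?_⟩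
  have hT : LpTendsto ⊤ (volume.restrict (Ψ ⁻¹' E)) (fun _ : ℕ => transposeDeriv Ψ) atTop
      (transposeDeriv Ψ) :=
    LpTendsto.const (memLp_top_of_continuous (isBounded_preimage hb) (continuous_transposeDeriv hΨ))
  refine (hT.bilin (ContinuousLinearMap.id ℝ (Plane →L[ℝ] Plane)) (r := 2) (by norm_num)
    (h3.pullback two_ne_zero hE hb hΨ')).congr (Eventually.of_forall fun k =>
    Eventually.of_forall fun y => ?_) ae_eq_rfl
  exact (gradient_comp_homeo hΨ (h1 k).1 y).symm

end Pullback

/-! ### The space `H¹₀` -/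

section H10
variable {D : Set Plane} {f f' : Plane → ℝ} {g g' : Plane → Plane}

lemma IsTestFun.sub {φ ψ : Plane → ℝ} (hφ : IsTestFun D φ) (hψ : IsTestFun D ψ) :
    IsTestFun D fun x => φ x - ψ x :=
  ⟨hφ.1.sub hψ.1, hφ.2.1.sub hψ.2.1, (tsupport_sub φ ψ).trans (union_subset hφ.2.2 hψ.2.2)⟩

lemma IsTestFun.const_mul {φ : Plane → ℝ} (hφ : IsTestFun D φ) (a : ℝ) :
    IsTestFun D fun x => a * φ x :=
  ⟨contDiff_const.mul hφ.1, hφ.2.1.mul_left, tsupport_mul_subset_right.trans hφ.2.2⟩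

lemma IsH10Lim.sub (h : IsH10Lim D f g) (h' : IsH10Lim D f' g') :
    IsH10Lim D (fun x => f x - f' x) (fun x => g x - g' x) := by
  obtain ⟨φ, h1, h2, h3⟩ := h
  obtain ⟨ψ, h1', h2', h3'⟩ := h'
  refine ⟨fun k x => φ k x - ψ k x, fun k => (h1 k).sub (h1' k), h2.sub h2' (by norm_num), ?_⟩
  refine (h3.sub h3' (by norm_num)).congr (Eventually.of_forall fun k => Eventually.of_forall fun x => ?_)
    ae_eq_rfl
  exact (gradient_sub_eq (h1 k).1 (h1' k).1 x).symm

lemma IsH10Lim.const_mul (h : IsH10Lim D f g) (a : ℝ) :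
    IsH10Lim D (fun x => a * f x) (fun x => a • g x) := by
  obtain ⟨φ, h1, h2, h3⟩ := h
  refine ⟨fun k x => a * φ k x, fun k => (h1 k).const_mul a, h2.const_mul a, ?_⟩
  refine (h3.clm (a • ContinuousLinearMap.id ℝ Plane)).congr
    (Eventually.of_forall fun k => Eventually.of_forall fun x => ?_) ae_eq_rfl
  exact (gradient_const_mul_eq (h1 k).1 a x).symm

lemma IsH10Lim.memLp (h : IsH10Lim D f g) : MemLp f 2 (volume.restrict D) := by
  obtain ⟨φ, -, h2, -⟩ := h; exact h2.memLp_lim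

lemma IsH10Lim.memLp_grad (h : IsH10Lim D f g) : MemLp g 2 (volume.restrict D) := by
  obtain ⟨φ, -, -, h3⟩ := h; exact h3.memLp_lim

/-- `H¹₀` is closed in `H¹`. -/
lemma IsH10Lim.of_tendsto (hb : Bornology.IsBounded D) {ι : Type*} {l : Filter ι} [l.NeBot]
    {F : ι → Plane → ℝ} {G : ι → Plane → Plane} (h : ∀ᶠ i in l, IsH10Lim D (F i) (G i))
    (hF : LpTendsto 2 (volume.restrict D) F l f) (hG : LpTendsto 2 (volume.restrict D) G l g) :
    IsH10Lim D f g := by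
  have key : ∀ ε : ENNReal, 0 < ε → ∃ φ, IsTestFun D φ ∧
      eLpNorm (fun x => φ x - f x) 2 (volume.restrict D) ≤ ε + ε ∧
      eLpNorm (fun x => gradient φ x - g x) 2 (volume.restrict D) ≤ ε + ε := by
    intro ε hε
    obtain ⟨i, hi, h1, h2⟩ := (h.and ((ENNReal.tendsto_nhds_zero.1 hF.tendsto ε hε).and
      (ENNReal.tendsto_nhds_zero.1 hG.tendsto ε hε))).exists
    have hiF := hi.memLp
    have hiG := hi.memLp_grad
    obtain ⟨φ, h3, h4, h5⟩ := hi
    obtain ⟨k, h6, h7⟩ := ((ENNReal.tendsto_nhds_zero.1 h4.tendsto ε hε).and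
      (ENNReal.tendsto_nhds_zero.1 h5.tendsto ε hε)).exists
    refine ⟨φ k, h3 k, ?_, ?_⟩
    · have := eLpNorm_add_le (p := 2) ((memLp_of_continuous hb (h3 k).1.continuous 2).sub hiF).1
        (hiF.sub hF.memLp_lim).1 (by norm_num)
      refine le_trans (le_of_eq ?_) (this.trans (add_le_add h6 h1))
      congr 1; ext x; simp
    · have := eLpNorm_add_le (p := 2) ((memLp_of_continuous hb (continuous_gradient (h3 k).1) 2).sub hiG).1
        (hiG.sub hG.memLp_lim).1 (by norm_num)
      refine le_trans (le_of_eq ?_) (this.trans (add_le_add h7 h2))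
      congr 1; ext x : 1; simp
  have hε : ∀ k : ℕ, (0 : ENNReal) < ((k : ENNReal) + 1)⁻¹ := fun k => by
    simp [ENNReal.inv_pos]
  choose φ h1 h2 h3 using fun k : ℕ => key _ (hε k)
  have hlim : Tendsto (fun k : ℕ => ((k : ENNReal) + 1)⁻¹ + ((k : ENNReal) + 1)⁻¹) atTop (𝓝 0) := by
    have : Tendsto (fun k : ℕ => ((k : ENNReal) + 1)⁻¹) atTop (𝓝 0) := by
      have := (tendsto_add_atTop_iff_nat 1).2 ENNReal.tendsto_inv_nat_nhds_zero
      simpa using this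
    simpa using this.add this
  refine ⟨φ, h1, ⟨Eventually.of_forall fun k => memLp_of_continuous hb (h1 k).1.continuous 2,
    hF.memLp_lim, ?_⟩, ⟨Eventually.of_forall fun k => memLp_of_continuous hb
    (continuous_gradient (h1 k).1) 2, hG.memLp_lim, ?_⟩⟩
  · exact tendsto_of_tendsto_of_tendsto_of_le_of_le tendsto_const_nhds hlim (fun _ => zero_le) h2
  · exact tendsto_of_tendsto_of_tendsto_of_le_of_le tendsto_const_nhds hlim (fun _ => zero_le) h3

end H10

/-! ### Differentiable curves in `Lᵖ` -/

/-- The curve `s ↦ f s` has the derivative `f'` in `Lᵖ(μ)` at the time `t`, along `J`. -/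
def HasLpDeriv {α E : Type*} [MeasurableSpace α] [NormedAddCommGroup E] [NormedSpace ℝ E]
    (p : ENNReal) (μ : Measure α) (J : Set ℝ) (t : ℝ) (f : ℝ → α → E) (f' : α → E) : Prop :=
  MemLp (f t) p μ ∧ LpTendsto p μ (fun s y => (s - t)⁻¹ • (f s y - f t y)) (𝓝[J \ {t}] t) f'

namespace LpTendsto
variable {α ι E : Type*} [MeasurableSpace α] [NormedAddCommGroup E]
  {p : ENNReal} {μ : Measure α} {l : Filter ι}

lemma const_smul_zero [NormedSpace ℝ E] {f : α → E} {u : ι → α → E} (hu : LpTendsto p μ u l f) (hp : 1 ≤ p)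
    {a : ι → ℝ} (ha : Tendsto a l (𝓝 0)) : LpTendsto p μ (fun i x => a i • u i x) l (fun _ => 0) := by
  have h1 : LpTendsto ⊤ μ (fun i (_ : α) => a i) l (fun _ => (0 : ℝ)) := by
    refine of_uniform (Eventually.of_forall fun i => memLp_top_const _) (memLp_top_const _) fun ε hε => ?_
    filter_upwards [(Metric.tendsto_nhds.1 ha) ε hε] with i hi
    exact Eventually.of_forall fun x => by simpa [Real.dist_eq] using hi.le
  simpa using h1.smul hp hu

lemma of_le_zero {F : Type*} [NormedAddCommGroup F] {u : ι → α → E} {v : ι → α → F}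
    (hv : LpTendsto p μ v l fun _ => 0) (hu : ∀ᶠ i in l, AEStronglyMeasurable (u i) μ)
    (hle : ∀ᶠ i in l, ∀ᵐ x ∂μ, ‖u i x‖ ≤ ‖v i x‖) : LpTendsto p μ u l fun _ => 0 := by
  refine ⟨?_, MemLp.zero, ?_⟩
  · filter_upwards [hv.memLp, hu, hle] with i h1 h2 h3 using h1.of_le h2 h3
  · refine tendsto_of_tendsto_of_tendsto_of_le_of_le' tendsto_const_nhds hv.tendsto
      (Eventually.of_forall fun _ => zero_le) ?_
    filter_upwards [hle] with i h3
    exact eLpNorm_mono_ae (by simpa using h3)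

end LpTendsto

namespace HasLpDeriv
variable {α E F G : Type*} [MeasurableSpace α] [NormedAddCommGroup E] [NormedSpace ℝ E]
  [NormedAddCommGroup F] [NormedSpace ℝ F] [NormedAddCommGroup G] [NormedSpace ℝ G]
  {p q r : ENNReal} {μ : Measure α} {J : Set ℝ} {t : ℝ} {f : ℝ → α → E} {f' : α → E}
  {g : ℝ → α → F} {g' : α → F}

lemma tendsto_sub_self (J : Set ℝ) (t : ℝ) : Tendsto (fun s => s - t) (𝓝[J \ {t}] t) (𝓝 0) := by
  have : Tendsto (fun s : ℝ => s - t) (𝓝 t) (𝓝 (t - t)) := (continuous_id.sub continuous_const).tendsto t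
  rw [sub_self] at this
  exact this.mono_left nhdsWithin_le_nhds

lemma eventually_ne (J : Set ℝ) (t : ℝ) : ∀ᶠ s in 𝓝[J \ {t}] t, s ∈ J ∧ s - t ≠ 0 := by
  filter_upwards [self_mem_nhdsWithin] with s hs
  exact ⟨hs.1, sub_ne_zero.2 hs.2⟩

lemma tendsto (h : HasLpDeriv p μ J t f f') (hp : 1 ≤ p) : LpTendsto p μ f (𝓝[J \ {t}] t) (f t) := by
  refine ((h.2.const_smul_zero hp (tendsto_sub_self J t)).add (LpTendsto.const h.1) hp).congr ?_
    (Eventually.of_forall fun x => by simp)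
  filter_upwards [eventually_ne J t] with s hs
  refine Eventually.of_forall fun x => ?_
  simp [smul_smul, mul_inv_cancel₀ hs.2]

lemma congr {f₁ : ℝ → α → E} {f₁' : α → E} (h : HasLpDeriv p μ J t f f')
    (h1 : ∀ᶠ s in 𝓝[J \ {t}] t, f s =ᵐ[μ] f₁ s) (h2 : f t =ᵐ[μ] f₁ t) (h3 : f' =ᵐ[μ] f₁') :
    HasLpDeriv p μ J t f₁ f₁' := by
  refine ⟨h.1.ae_eq h2, h.2.congr ?_ h3⟩
  filter_upwards [h1] with s hs
  filter_upwards [hs, h2] with x hx1 hx2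
  rw [hx1, hx2]

lemma clm (L : E →L[ℝ] F) (h : HasLpDeriv p μ J t f f') :
    HasLpDeriv p μ J t (fun s x => L (f s x)) (fun x => L (f' x)) := by
  refine ⟨L.comp_memLp' h.1, (h.2.clm L).congr (Eventually.of_forall fun s =>
    Eventually.of_forall fun x => by simp) ae_eq_rfl⟩

lemma const {f : α → E} (hf : MemLp f p μ) : HasLpDeriv p μ J t (fun _ => f) fun _ => 0 := by
  refine ⟨hf, ?_⟩
  simp only [sub_self, smul_zero]
  exact LpTendsto.const MemLp.zero

lemma sub {f₁ : ℝ → α → E} {f₁' : α → E} (hp : 1 ≤ p) (h : HasLpDeriv p μ J t f f')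
    (h' : HasLpDeriv p μ J t f₁ f₁') :
    HasLpDeriv p μ J t (fun s x => f s x - f₁ s x) (fun x => f' x - f₁' x) := by
  refine ⟨h.1.sub h'.1, (h.2.sub h'.2 hp).congr (Eventually.of_forall fun s =>
    Eventually.of_forall fun x => ?_) ae_eq_rfl⟩
  simp only [← smul_sub]; congr 1; abel

lemma mono_exponent [IsFiniteMeasure μ] (h : HasLpDeriv q μ J t f f') (hpq : p ≤ q) (hp : p ≠ 0) :
    HasLpDeriv p μ J t f f' :=
  ⟨h.1.mono_exponent hpq, h.2.mono_exponent hpq hp⟩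

/-- The product rule. -/
lemma bilin (B : E →L[ℝ] F →L[ℝ] G) [hpqr : p.HolderTriple q r] (hq : 1 ≤ q) (hr : 1 ≤ r)
    (hf : HasLpDeriv p μ J t f f') (hg : HasLpDeriv q μ J t g g') :
    HasLpDeriv r μ J t (fun s x => B (f s x) (g s x)) (fun x => B (f' x) (g t x) + B (f t x) (g' x)) := by
  refine ⟨B.memLp_of_bilin r hf.1 hg.1, ((hf.2.bilin B hr (hg.tendsto hq)).add
    ((LpTendsto.const hf.1).bilin B hr hg.2) hr).congr (Eventually.of_forall fun s =>
    Eventually.of_forall fun x => ?_) ae_eq_rfl⟩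
  simp only [map_smul, map_sub, _root_.smul_apply, _root_.sub_apply, ← smul_add]
  congr 1; abel

lemma mul {f g : ℝ → α → ℝ} {f' g' : α → ℝ} [hpqr : p.HolderTriple q r] (hq : 1 ≤ q)
    (hr : 1 ≤ r) (hf : HasLpDeriv p μ J t f f') (hg : HasLpDeriv q μ J t g g') :
    HasLpDeriv r μ J t (fun s x => f s x * g s x) (fun x => f' x * g t x + f t x * g' x) :=
  hf.bilin (ContinuousLinearMap.mul ℝ ℝ) hq hr hg

lemma integral {f : ℝ → α → ℝ} {f' : α → ℝ} (h : HasLpDeriv 1 μ J t f f') :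
    HasDerivWithinAt (fun s => ∫ x, f s x ∂μ) (∫ x, f' x ∂μ) J t := by
  rw [hasDerivWithinAt_iff_tendsto_slope]
  refine h.2.integral.congr' ?_
  filter_upwards [(h.tendsto le_rfl).memLp] with s hs
  rw [slope_def_module, ← integral_sub (memLp_one_iff_integrable.1 hs) (memLp_one_iff_integrable.1 h.1),
    ← integral_smul]

/-- The first-order Taylor remainder of `(m, x, y) ↦ √(m² + x² + y²)` at `(1, x₀, y₀)`. It is quadratic,
with a constant independent of the base point because the norm of the base point is at least `1`. -/
lemma sqrt_remainder (m x y x₀ y₀ : ℝ) :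
    |√(m ^ 2 + x ^ 2 + y ^ 2) - √(1 + x₀ ^ 2 + y₀ ^ 2) -
      ((m - 1) + x₀ * (x - x₀) + y₀ * (y - y₀)) / √(1 + x₀ ^ 2 + y₀ ^ 2)| ≤
      (m - 1) ^ 2 + (x - x₀) ^ 2 + (y - y₀) ^ 2 := by
  set S := √(m ^ 2 + x ^ 2 + y ^ 2) with hS
  set W := √(1 + x₀ ^ 2 + y₀ ^ 2) with hW
  have hS2 : S ^ 2 = m ^ 2 + x ^ 2 + y ^ 2 := Real.sq_sqrt (by positivity)
  have hW2 : W ^ 2 = 1 + x₀ ^ 2 + y₀ ^ 2 := Real.sq_sqrt (by positivity)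
  have hS0 : 0 ≤ S := Real.sqrt_nonneg _
  have hW1 : 1 ≤ W := by
    rw [hW, Real.one_le_sqrt]; nlinarith [sq_nonneg x₀, sq_nonneg y₀]
  have hW0 : 0 < W := by linarith
  have hcs : m + x₀ * x + y₀ * y ≤ S * W := by
    refine abs_le_of_sq_le_sq' ?_ (by positivity) |>.2
    rw [mul_pow, hS2, hW2]
    nlinarith [sq_nonneg (m * x₀ - x), sq_nonneg (m * y₀ - y), sq_nonneg (x * y₀ - y * x₀)]
  have hrw : S - W - ((m - 1) + x₀ * (x - x₀) + y₀ * (y - y₀)) / W =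
      (S * W - (m + x₀ * x + y₀ * y)) / W := by
    field_simp
    linear_combination -hW2
  rw [hrw, abs_of_nonneg (div_nonneg (by linarith) hW0.le), div_le_iff₀ hW0]
  nlinarith [sq_nonneg (S - W), sq_nonneg (m - 1), sq_nonneg (x - x₀), sq_nonneg (y - y₀)]

/-- Differentiability of `√(m² + x² + y²)` in `L¹` along curves that are differentiable in `L²`, at
a time where `m = 1`: the Taylor remainder of the square root is quadratic. -/
lemma sqrt [IsFiniteMeasure μ] {m x y : ℝ → α → ℝ} {m' x' y' : α → ℝ} (hm : HasLpDeriv 2 μ J t m m')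
    (hx : HasLpDeriv 2 μ J t x x') (hy : HasLpDeriv 2 μ J t y y') (h1 : ∀ z, m t z = 1) :
    HasLpDeriv 1 μ J t (fun s z => √(m s z ^ 2 + x s z ^ 2 + y s z ^ 2))
      (fun z => (m' z + x t z * x' z + y t z * y' z) / √(1 + x t z ^ 2 + y t z ^ 2)) := by
  have h12 : (1 : ENNReal) ≤ 2 := by norm_num
  have hsq : Continuous fun v : ℝ × ℝ × ℝ => √(v.1 ^ 2 + v.2.1 ^ 2 + v.2.2 ^ 2) := by fun_prop
  have hmeas : ∀ {a b c : α → ℝ}, AEStronglyMeasurable a μ → AEStronglyMeasurable b μ →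
      AEStronglyMeasurable c μ →
      AEStronglyMeasurable (fun z => √(a z ^ 2 + b z ^ 2 + c z ^ 2)) μ := fun ha hb hc =>
    hsq.comp_aestronglyMeasurable (ha.prodMk (hb.prodMk hc))
  have hle : ∀ a b c : ℝ, √(a ^ 2 + b ^ 2 + c ^ 2) ≤ |a| + |b| + |c| := fun a b c => by
    refine Real.sqrt_le_iff.2 ⟨by positivity, ?_⟩
    nlinarith [sq_abs a, sq_abs b, sq_abs c, mul_nonneg (abs_nonneg a) (abs_nonneg b),
      mul_nonneg (abs_nonneg a) (abs_nonneg c), mul_nonneg (abs_nonneg b) (abs_nonneg c)]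
  have hbase : MemLp (fun z => √(m t z ^ 2 + x t z ^ 2 + y t z ^ 2)) 1 μ := by
    refine (((hm.1.abs.add hx.1.abs).add hy.1.abs).mono_exponent h12).of_le
      (hmeas hm.1.1 hx.1.1 hy.1.1) (Eventually.of_forall fun z => ?_)
    rw [Real.norm_of_nonneg (Real.sqrt_nonneg _)]
    exact (hle _ _ _).trans (le_abs_self _)
  set W : α → ℝ := fun z => √(1 + x t z ^ 2 + y t z ^ 2) with hW
  have hWm : AEStronglyMeasurable W μ :=
    (hmeas (aestronglyMeasurable_const (b := (1 : ℝ))) hx.1.1 hy.1.1).congr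
      (Eventually.of_forall fun z => by simp [hW])
  have hW1 : ∀ z, 1 ≤ W z := fun z => by
    rw [hW, Real.one_le_sqrt]; nlinarith [sq_nonneg (x t z), sq_nonneg (y t z)]
  have hWi : AEStronglyMeasurable (fun z => (W z)⁻¹) μ := hWm.aemeasurable.inv.aestronglyMeasurable
  -- the coefficients of the linear part are bounded
  have hcoef : ∀ {k : α → ℝ}, AEStronglyMeasurable k μ → (∀ z, |k z| ≤ W z) →
      LpTendsto ⊤ μ (fun (_ : ℝ) z => k z * (W z)⁻¹) (𝓝[J \ {t}] t) (fun z => k z * (W z)⁻¹) :=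
    fun hk hkW => LpTendsto.const (memLp_top_of_bound (hk.mul hWi) 1 (Eventually.of_forall fun z => by
      rw [Real.norm_eq_abs, abs_mul, abs_of_pos (inv_pos.2 (by linarith [hW1 z] : 0 < W z))]
      exact (mul_inv_le_iff₀ (by linarith [hW1 z])).2 (by linarith [hkW z])))
  have hxW : ∀ z, |x t z| ≤ W z := fun z => Real.abs_le_sqrt (by nlinarith [sq_nonneg (y t z)])
  have hyW : ∀ z, |y t z| ≤ W z := fun z => Real.abs_le_sqrt (by nlinarith [sq_nonneg (x t z)])
  have hlin := (((hcoef (aestronglyMeasurable_const (b := (1 : ℝ))) fun z => by simpa using hW1 z).mul h12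
    hm.2).add ((hcoef hx.1.1 hxW).mul h12 hx.2) h12).add ((hcoef hy.1.1 hyW).mul h12 hy.2) h12
  -- the remainder
  have hB := ((hm.2.mul (r := 1) le_rfl hm.2).add (hx.2.mul (r := 1) le_rfl hx.2) le_rfl).add
    (hy.2.mul (r := 1) le_rfl hy.2) le_rfl
  have hB0 := hB.const_smul_zero le_rfl (tendsto_sub_self J t)
  refine ⟨hbase, ?_⟩
  have hlin1 := hlin.mono_exponent h12 one_ne_zero
  have hrem := hB0.of_le_zero (u := fun s z => (s - t)⁻¹ • (√(m s z ^ 2 + x s z ^ 2 + y s z ^ 2) -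
      √(m t z ^ 2 + x t z ^ 2 + y t z ^ 2)) - (1 * (W z)⁻¹ * ((s - t)⁻¹ • (m s z - m t z)) +
        x t z * (W z)⁻¹ * ((s - t)⁻¹ • (x s z - x t z)) +
        y t z * (W z)⁻¹ * ((s - t)⁻¹ • (y s z - y t z)))) ?_ ?_
  · refine (hrem.add hlin1 le_rfl).congr (Eventually.of_forall fun s => Eventually.of_forall fun z => ?_)
      (Eventually.of_forall fun z => ?_)
    · simp
    · simp only [zero_add]
      rw [div_eq_mul_inv]; ring
  · filter_upwards [(hm.tendsto h12).memLp, (hx.tendsto h12).memLp, (hy.tendsto h12).memLp,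
      hlin1.memLp] with s e1 e2 e3 e4
    exact AEStronglyMeasurable.sub (AEStronglyMeasurable.const_smul
      ((hmeas e1.1 e2.1 e3.1).sub (hmeas hm.1.1 hx.1.1 hy.1.1)) ((s - t)⁻¹)) e4.1
  · filter_upwards [eventually_ne J t] with s hs
    refine Eventually.of_forall fun z => ?_
    have hr := sqrt_remainder (m s z) (x s z) (y s z) (x t z) (y t z)
    have hst : 0 < |s - t| := abs_pos.2 hs.2
    have e1 : (s - t)⁻¹ • (√(m s z ^ 2 + x s z ^ 2 + y s z ^ 2) -
      √(m t z ^ 2 + x t z ^ 2 + y t z ^ 2)) - (1 * (W z)⁻¹ * ((s - t)⁻¹ • (m s z - m t z)) +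
        x t z * (W z)⁻¹ * ((s - t)⁻¹ • (x s z - x t z)) +
        y t z * (W z)⁻¹ * ((s - t)⁻¹ • (y s z - y t z))) =
        (s - t)⁻¹ * (√(m s z ^ 2 + x s z ^ 2 + y s z ^ 2) - √(1 + x t z ^ 2 + y t z ^ 2) -
      ((m s z - 1) + x t z * (x s z - x t z) + y t z * (y s z - y t z)) / √(1 + x t z ^ 2 + y t z ^ 2)) := by
      simp only [hW, h1, smul_eq_mul, one_pow, div_eq_mul_inv]; ring
    have e2 : ‖(s - t) • ((s - t)⁻¹ • (m s z - m t z) * (s - t)⁻¹ • (m s z - m t z) +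
        (s - t)⁻¹ • (x s z - x t z) * (s - t)⁻¹ • (x s z - x t z) +
        (s - t)⁻¹ • (y s z - y t z) * (s - t)⁻¹ • (y s z - y t z))‖ =
        |s - t|⁻¹ * ((m s z - 1) ^ 2 + (x s z - x t z) ^ 2 + (y s z - y t z) ^ 2) := by
      have : (s - t) • ((s - t)⁻¹ • (m s z - m t z) * (s - t)⁻¹ • (m s z - m t z) +
        (s - t)⁻¹ • (x s z - x t z) * (s - t)⁻¹ • (x s z - x t z) +
        (s - t)⁻¹ • (y s z - y t z) * (s - t)⁻¹ • (y s z - y t z)) =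
        (s - t)⁻¹ * ((m s z - 1) ^ 2 + (x s z - x t z) ^ 2 + (y s z - y t z) ^ 2) := by
        have := hs.2
        simp only [smul_eq_mul, h1]
        field_simp
      rw [this, norm_mul, Real.norm_eq_abs, Real.norm_eq_abs, abs_inv]
      congr 1
      exact abs_of_nonneg (by positivity)
    rw [e1, e2, norm_mul, Real.norm_eq_abs, Real.norm_eq_abs, abs_inv]
    exact mul_le_mul_of_nonneg_left hr (inv_nonneg.2 hst.le)

end HasLpDeriv

/-! ### Isotopies of the plane -/

/-- Uniform differentiability in time on bounded sets. -/
lemma hasLpDeriv_top_of_hasDerivWithinAt {E : Type*} [NormedAddCommGroup E] [NormedSpace ℝ E]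
    [SecondCountableTopology E] {a b t : ℝ} (ht : t ∈ Icc a b) {D : Set Plane}
    (hb : Bornology.IsBounded D) {h h' : ℝ → Plane → E}
    (hd : ∀ s ∈ Icc a b, ∀ y, HasDerivWithinAt (fun s => h s y) (h' s y) (Icc a b) s)
    (hc : ContinuousOn (fun p : ℝ × Plane => h' p.1 p.2) (Icc a b ×ˢ univ))
    (hcont : ∀ s ∈ Icc a b, Continuous (h s)) :
    HasLpDeriv ⊤ (volume.restrict D) (Icc a b) t h (h' t) := by
  have hct : ∀ s ∈ Icc a b, Continuous (h' s) := fun s hs =>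
    continuousOn_univ.1 (hc.comp (f := fun y => (s, y)) (by fun_prop) fun y _ => ⟨hs, mem_univ _⟩)
  refine ⟨memLp_top_of_continuous hb (hcont t ht), LpTendsto.of_uniform ?_
    (memLp_top_of_continuous hb (hct t ht)) fun ε hε => ?_⟩
  · filter_upwards [HasLpDeriv.eventually_ne (Icc a b) t] with s hs
    exact memLp_top_of_continuous hb (((hcont s hs.1).sub (hcont t ht)).const_smul _)
  · have huc := ((isCompact_Icc (a := a) (b := b)).prod
      hb.isCompact_closure).uniformContinuousOn_of_continuous (hc.mono (prod_mono_right (subset_univ _)))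
    obtain ⟨δ, hδ, hδ'⟩ := Metric.uniformContinuousOn_iff.1 huc ε hε
    filter_upwards [HasLpDeriv.eventually_ne (Icc a b) t,
      mem_nhdsWithin_of_mem_nhds (Metric.ball_mem_nhds t hδ)] with s hs hsδ
    refine (ae_restrict_mem₀ (s := closure D) isClosed_closure.nullMeasurableSet).filter_mono
      (ae_mono (Measure.restrict_mono subset_closure le_rfl)) |>.mono fun y hy => ?_
    have hk : ∀ r ∈ Icc a b ∩ Metric.ball t δ, HasDerivWithinAt (fun r => h r y - r • h' t y)
        (h' r y - h' t y) (Icc a b ∩ Metric.ball t δ) r := fun r hr => by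
      have h1 := ((hd r hr.1 y).mono (inter_subset_left (t := Metric.ball t δ))).sub
        ((hasDerivWithinAt_id r (Icc a b ∩ Metric.ball t δ)).smul_const (h' t y))
      exact h1.congr_deriv (by simp)
    have hbd : ∀ r ∈ Icc a b ∩ Metric.ball t δ, ‖h' r y - h' t y‖ ≤ ε := fun r hr => by
      have := hδ' (r, y) ⟨hr.1, hy⟩ (t, y) ⟨ht, hy⟩ (by
        rw [Prod.dist_eq]; simpa using hr.2)
      rw [← dist_eq_norm]; exact this.le
    have hmv := ((convex_Icc a b).inter (convex_ball t δ)).norm_image_sub_le_of_norm_hasDerivWithin_le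
      hk hbd ⟨ht, Metric.mem_ball_self hδ⟩ ⟨hs.1, hsδ⟩
    have hst : 0 < ‖s - t‖ := norm_pos_iff.2 hs.2
    have e1 : (s - t)⁻¹ • (h s y - h t y) - h' t y =
        (s - t)⁻¹ • (h s y - s • h' t y - (h t y - t • h' t y)) := by
      rw [show h s y - s • h' t y - (h t y - t • h' t y) = (h s y - h t y) - (s - t) • h' t y by
        rw [sub_smul]; abel, smul_sub _ (h s y - h t y), smul_smul, inv_mul_cancel₀ hs.2, one_smul]
    rw [e1, norm_smul, norm_inv, inv_mul_le_iff₀ hst, mul_comm]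
    exact hmv

lemma LpTendsto.eventually_ae_norm_sub_lt {α ι E : Type*} [MeasurableSpace α] [NormedAddCommGroup E]
    {μ : Measure α} {l : Filter ι} {u : ι → α → E} {f : α → E} (hu : LpTendsto ⊤ μ u l f) {ε : ℝ}
    (hε : 0 < ε) : ∀ᶠ i in l, ∀ᵐ x ∂μ, ‖u i x - f x‖ < ε := by
  filter_upwards [hu.tendsto.eventually_lt_const (ENNReal.ofReal_pos.2 hε)] with i hi
  rw [eLpNorm_exponent_top] at hi
  filter_upwards [ae_lt_of_essSup_lt hi] with x hx
  rw [← ofReal_norm, ENNReal.ofReal_lt_ofReal_iff hε] at hx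
  exact hx

/-- The isotopy `Φ` with the plane at the time `t` as the reference configuration. -/
def isotopyFrom (Φ : ℝ → Plane ≃ₜ Plane) (t s : ℝ) : Plane ≃ₜ Plane := (Φ t).symm.trans (Φ s)

lemma isotopyFrom_self (Φ : ℝ → Plane ≃ₜ Plane) (t : ℝ) (y : Plane) : isotopyFrom Φ t t y = y := by
  simp [isotopyFrom]

namespace IsC1Isotopy
variable {J : Set ℝ} {Φ : ℝ → Plane ≃ₜ Plane} {t : ℝ}

/-- Changing the reference configuration preserves `C¹` isotopies. -/
lemma from_time (h : IsC1Isotopy J Φ) (ht : t ∈ J) : IsC1Isotopy J (isotopyFrom Φ t) := by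
  have hs := h.contDiff_symm t ht
  have hcomp : ∀ {k : Plane → Plane}, ContDiff ℝ 1 k → ∀ y,
      fderiv ℝ (fun y => k ((Φ t).symm y)) y = (fderiv ℝ k ((Φ t).symm y)).comp
        (fderiv ℝ (Φ t).symm y) := fun hk y =>
    fderiv_comp y (hk.differentiable one_ne_zero _) (hs.differentiable one_ne_zero y)
  have hmaps : MapsTo (fun p : ℝ × Plane => (p.1, (Φ t).symm p.2)) (J ×ˢ univ) (J ×ˢ univ) :=
    fun p hp => ⟨hp.1, mem_univ _⟩
  have hcm : Continuous (fun p : ℝ × Plane => (p.1, (Φ t).symm p.2)) :=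
    continuous_fst.prodMk ((Φ t).symm.continuous.comp continuous_snd)
  constructor
  · exact fun s hs' => (h.contDiff s hs').comp hs
  · exact fun s hs' => (h.contDiff t ht).comp (h.contDiff_symm s hs')
  · exact fun s hs' y => h.differentiable s hs' _
  · exact fun s hs' => (h.contDiff_velocity s hs').comp hs
  · intro s hs' y
    have h1 := (h.hasDeriv_fderiv s hs' ((Φ t).symm y)).clm_comp
      (hasDerivWithinAt_const s J (fderiv ℝ (Φ t).symm y))
    refine (h1.congr_deriv ?_).congr (fun r hr => hcomp (h.contDiff r hr) y) (hcomp (h.contDiff s hs') y)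
    simp only [ContinuousLinearMap.comp_zero, add_zero]
    exact (hcomp (h.contDiff_velocity s hs') y).symm
  · exact h.continuous_velocity.comp hcm.continuousOn hmaps
  · refine ContinuousOn.congr (f := fun p : ℝ × Plane =>
      (fderiv ℝ (lagrangianVelocity J Φ p.1) ((Φ t).symm p.2)).comp (fderiv ℝ (Φ t).symm p.2)) ?_
      fun p hp => hcomp (h.contDiff_velocity p.1 hp.1) p.2
    exact (h.continuous_fderiv_velocity.comp hcm.continuousOn hmaps).clm_comp
      ((hs.continuous_fderiv one_ne_zero).comp continuous_snd).continuousOn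

lemma hasDerivWithinAt (h : IsC1Isotopy J Φ) {s : ℝ} (hs : s ∈ J) (y : Plane) :
    HasDerivWithinAt (fun s => Φ s y) (lagrangianVelocity J Φ s y) J s :=
  (h.differentiable s hs y).hasDerivWithinAt

/-- A `C¹` isotopy is jointly continuous: it is locally Lipschitz in time, uniformly in space. -/
lemma continuousOn {a b : ℝ} (h : IsC1Isotopy (Icc a b) Φ) :
    ContinuousOn (fun p : ℝ × Plane => Φ p.1 p.2) (Icc a b ×ˢ univ) := by
  rintro ⟨s₀, y₀⟩ ⟨hs₀, -⟩
  obtain ⟨C, hC⟩ := ((isCompact_Icc (a := a) (b := b)).prod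
    (isCompact_closedBall y₀ 1)).exists_bound_of_continuousOn
      (h.continuous_velocity.mono (prod_mono_right (subset_univ _)))
  have hle : ∀ s ∈ Icc a b, ∀ y ∈ Metric.closedBall y₀ 1, ‖Φ s y - Φ s₀ y‖ ≤ C * ‖s - s₀‖ :=
    fun s hs y hy => (convex_Icc a b).norm_image_sub_le_of_norm_hasDerivWithin_le
      (fun r hr => h.hasDerivWithinAt hr y) (fun r hr => hC (r, y) ⟨hr, hy⟩) hs₀ hs
  have h1 : Tendsto (fun p : ℝ × Plane => C * ‖p.1 - s₀‖ + ‖Φ s₀ p.2 - Φ s₀ y₀‖) (𝓝 (s₀, y₀)) (𝓝 0) := by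
    have hc : Continuous fun p : ℝ × Plane => C * ‖p.1 - s₀‖ + ‖Φ s₀ p.2 - Φ s₀ y₀‖ := by
      have := (Φ s₀).continuous; fun_prop
    have := hc.tendsto (s₀, y₀)
    simpa using this
  refine tendsto_iff_norm_sub_tendsto_zero.2 (squeeze_zero' (Eventually.of_forall fun _ => norm_nonneg _) ?_
    (h1.mono_left nhdsWithin_le_nhds))
  have hball : ∀ᶠ p : ℝ × Plane in 𝓝 (s₀, y₀), p.2 ∈ Metric.closedBall y₀ 1 :=
    continuous_snd.continuousAt.eventually (Metric.closedBall_mem_nhds y₀ one_pos)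
  filter_upwards [self_mem_nhdsWithin, mem_nhdsWithin_of_mem_nhds hball] with p hp hpb
  calc ‖Φ p.1 p.2 - Φ s₀ y₀‖ = ‖(Φ p.1 p.2 - Φ s₀ p.2) + (Φ s₀ p.2 - Φ s₀ y₀)‖ := by congr 1; abel
    _ ≤ _ := (norm_add_le _ _).trans (add_le_add (hle p.1 hp.1 p.2 hpb) le_rfl)

lemma hasLpDeriv_fderiv {a b : ℝ} (h : IsC1Isotopy (Icc a b) Φ) (ht : t ∈ Icc a b) {D : Set Plane}
    (hb : Bornology.IsBounded D) :
    HasLpDeriv ⊤ (volume.restrict D) (Icc a b) t (fun s => fderiv ℝ (Φ s))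
      (fderiv ℝ (lagrangianVelocity (Icc a b) Φ t)) :=
  hasLpDeriv_top_of_hasDerivWithinAt ht hb (fun s hs y => h.hasDeriv_fderiv s hs y)
    h.continuous_fderiv_velocity fun s hs => (h.contDiff s hs).continuous_fderiv one_ne_zero

lemma hasLpDeriv_comp {a b : ℝ} (h : IsC1Isotopy (Icc a b) Φ) (ht : t ∈ Icc a b) {D : Set Plane}
    (hb : Bornology.IsBounded D) {φ : Plane → ℝ} (hφ : ContDiff ℝ 1 φ) :
    HasLpDeriv ⊤ (volume.restrict D) (Icc a b) t (fun s y => φ (Φ s y))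
      (fun y => inner ℝ (gradient φ (Φ t y)) (lagrangianVelocity (Icc a b) Φ t y)) := by
  refine hasLpDeriv_top_of_hasDerivWithinAt ht hb
    (h' := fun s y => inner ℝ (gradient φ (Φ s y)) (lagrangianVelocity (Icc a b) Φ s y))
    (fun s hs y => ?_) ?_ fun s hs => hφ.continuous.comp (Φ s).continuous
  · rw [inner_gradient_left]
    exact (hφ.differentiable one_ne_zero _).hasFDerivAt.comp_hasDerivWithinAt s (h.hasDerivWithinAt hs y)
  · exact ((continuous_gradient hφ).comp_continuousOn h.continuousOn).inner h.continuous_velocity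

end IsC1Isotopy

/-! ### Droplet trajectories in a fixed reference domain -/

lemma neBot_nhdsWithin_Icc_diff {a b t : ℝ} (hab : a < b) (ht : t ∈ Icc a b) :
    (𝓝[Icc a b \ {t}] t).NeBot :=
  accPt_principal_iff_nhdsWithin.1 ((uniqueDiffOn_Icc hab) t ht).accPt

lemma transposeDeriv_comp {Ψ χ : Plane → Plane} (hΨ : ContDiff ℝ 1 Ψ) (hχ : ContDiff ℝ 1 χ) (y : Plane)
    (v : Plane) : transposeDeriv (fun y => Ψ (χ y)) y v = transposeDeriv χ y (transposeDeriv Ψ (χ y) v) := by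
  have : fderiv ℝ (fun y => Ψ (χ y)) y = (fderiv ℝ Ψ (χ y)).comp (fderiv ℝ χ y) :=
    fderiv_comp y (hΨ.differentiable one_ne_zero _) (hχ.differentiable one_ne_zero y)
  simp only [transposeDeriv, this, ContinuousLinearMap.adjoint_comp]
  rfl

namespace IsDropletTrajectory
variable {a b t : ℝ} {D₀ : Set Plane} {Φ : ℝ → Plane ≃ₜ Plane} {D : ℝ → Set Plane}
  {u : ℝ → Plane → ℝ} {J : Set ℝ}

lemma preimage_eq (h : IsDropletTrajectory J D₀ Φ D u) {s : ℝ} (hs : s ∈ J) : Φ s ⁻¹' D s = D₀ := by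
  rw [h.image_eq s hs, preimage_image_eq _ (Φ s).injective]

lemma isOpen (h : IsDropletTrajectory J D₀ Φ D u) (ht : t ∈ J) (hD : IsOpen (D t)) {s : ℝ} (hs : s ∈ J) :
    IsOpen (D s) := by
  rw [h.image_eq s hs, (Φ s).isOpen_image, ← h.preimage_eq ht]
  exact hD.preimage (Φ t).continuous

lemma isBounded (h : IsDropletTrajectory J D₀ Φ D u) (ht : t ∈ J) (hb : Bornology.IsBounded (D t))
    {s : ℝ} (hs : s ∈ J) : Bornology.IsBounded (D s) := by
  rw [h.image_eq s hs, ← h.preimage_eq ht, ← Homeomorph.preimage_symm]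
  exact isBounded_preimage (isBounded_preimage hb)

lemma image_isotopyFrom (h : IsDropletTrajectory J D₀ Φ D u) (ht : t ∈ J) {s : ℝ} (hs : s ∈ J) :
    isotopyFrom Φ t s '' D t = D s := by
  rw [h.image_eq s hs, h.image_eq t ht, ← image_comp]
  congr 1
  ext y : 1
  simp [isotopyFrom]

/-- With the droplet at the time `t` as the reference configuration, the profiles and their
gradients are differentiable in `L²`, and the derivative of the profiles vanishes on the boundary. -/
theorem exists_hasLpDeriv (h : IsDropletTrajectory (Icc a b) D₀ Φ D u) (hab : a < b) (ht : t ∈ Icc a b)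
    (hD : IsOpen (D t)) (hb : Bornology.IsBounded (D t)) :
    ∃ (U' : Plane → ℝ) (P' : Plane → Plane), IsH10Lim (D t) U' P' ∧
      HasLpDeriv 2 (volume.restrict (D t)) (Icc a b) t (fun s y => u s (isotopyFrom Φ t s y)) U' ∧
      HasLpDeriv 2 (volume.restrict (D t)) (Icc a b) t
        (fun s y => transposeDeriv (isotopyFrom Φ t s) y (weakGrad (D s) (u s) (isotopyFrom Φ t s y)))
        P' := by
  have := neBot_nhdsWithin_Icc_diff hab ht
  have hD₀ : IsOpen D₀ := by rw [← h.preimage_eq ht]; exact hD.preimage (Φ t).continuous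
  have hb₀ : Bornology.IsBounded D₀ := by rw [← h.preimage_eq ht]; exact isBounded_preimage hb
  have hΦ := h.isotopy.contDiff
  have hΦ' := h.isotopy.contDiff_symm
  set G : ℝ → Plane → Plane := fun s y => transposeDeriv (Φ s) y (weakGrad (D s) (u s) (Φ s y)) with hG
  have hU : ∀ s ∈ Icc a b, IsH10Lim D₀ (fun y => u s (Φ s y)) (G s) := fun s hs => by
    have h1 := (MemH10.isH10Lim (h.isOpen ht hD hs) (h.isBounded ht hb hs) (h.memH10 s hs)).pullback
      (h.isOpen ht hD hs).measurableSet (h.isBounded ht hb hs) (hΦ s hs) (hΦ' s hs)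
    rwa [h.preimage_eq hs] at h1
  obtain ⟨U', -, hU', hlim⟩ := h.differentiable t ht
  have hslope : ∀ᶠ s in 𝓝[Icc a b \ {t}] t, IsH10Lim D₀
      (fun y => (s - t)⁻¹ * (u s (Φ s y) - u t (Φ t y))) (fun y => (s - t)⁻¹ • (G s y - G t y)) := by
    filter_upwards [HasLpDeriv.eventually_ne (Icc a b) t] with s hs
    exact ((hU s hs.1).sub (hU t ht)).const_mul _
  rw [tendsto_h1Norm_iff hD₀ (G := fun s y => (s - t)⁻¹ • (G s y - G t y) - weakGrad D₀ U' y)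
    (hslope.mono fun s hs => (hs.hasWeakGrad hb₀).sub (weakGrad_spec hU'.2.1))] at hlim
  have hL : LpTendsto 2 (volume.restrict D₀) (fun s y => (s - t)⁻¹ • (u s (Φ s y) - u t (Φ t y)))
      (𝓝[Icc a b \ {t}] t) U' := ⟨hslope.mono fun s hs => hs.memLp, hU'.1, hlim.1⟩
  have hLG : LpTendsto 2 (volume.restrict D₀) (fun s y => (s - t)⁻¹ • (G s y - G t y))
      (𝓝[Icc a b \ {t}] t) (weakGrad D₀ U') := ⟨hslope.mono fun s hs => hs.memLp_grad, hU'.2.2, hlim.2⟩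
  have hU'0 : IsH10Lim D₀ U' (weakGrad D₀ U') := IsH10Lim.of_tendsto hb₀ hslope hL hLG
  have hDt : (Φ t).symm ⁻¹' D₀ = D t := by rw [h.image_eq t ht, Homeomorph.preimage_symm]
  have hχ : ContDiff ℝ 1 (Φ t).symm.symm := hΦ t ht
  have hm := hD₀.measurableSet
  have hcomp : ∀ s ∈ Icc a b, ∀ y, transposeDeriv (Φ t).symm y (G s ((Φ t).symm y)) =
      transposeDeriv (isotopyFrom Φ t s) y (weakGrad (D s) (u s) (isotopyFrom Φ t s y)) :=
    fun s hs y => (transposeDeriv_comp (hΦ s hs) (hΦ' t ht) y _).symm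
  have hUt := (hU t ht).pullback hm hb₀ (hΦ' t ht) hχ
  have hT : LpTendsto ⊤ (volume.restrict ((Φ t).symm ⁻¹' D₀)) (fun _ : ℝ => transposeDeriv (Φ t).symm)
      (𝓝[Icc a b \ {t}] t) (transposeDeriv (Φ t).symm) :=
    LpTendsto.const (memLp_top_of_continuous (isBounded_preimage hb₀) (continuous_transposeDeriv (hΦ' t ht)))
  refine ⟨fun y => U' ((Φ t).symm y), fun y => transposeDeriv (Φ t).symm y (weakGrad D₀ U' ((Φ t).symm y)),
    ?_, ⟨?_, ?_⟩, ⟨?_, ?_⟩⟩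
  · rw [← hDt]; exact hU'0.pullback hm hb₀ (hΦ' t ht) hχ
  · rw [← hDt]; exact hUt.memLp
  · rw [← hDt]; exact hL.pullback two_ne_zero hm hb₀ hχ
  · rw [← hDt]
    exact hUt.memLp_grad.ae_eq (Eventually.of_forall fun y => hcomp t ht y)
  · rw [← hDt]
    refine (hT.bilin (ContinuousLinearMap.id ℝ (Plane →L[ℝ] Plane)) (r := 2) (by norm_num)
      (hLG.pullback two_ne_zero hm hb₀ hχ)).congr ?_ ae_eq_rfl
    filter_upwards [HasLpDeriv.eventually_ne (Icc a b) t] with s hs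
    refine Eventually.of_forall fun y => ?_
    simp only [ContinuousLinearMap.id_apply, map_smul, map_sub, hcomp s hs.1, hcomp t ht]

end IsDropletTrajectory

/-! ### Reynolds transport -/

/-- The divergence of a `C¹` vector field. -/
def planeDiv (V : Plane → Plane) (y : Plane) : ℝ :=
  fderiv ℝ V y (planeBasis 0) 0 + fderiv ℝ V y (planeBasis 1) 1

/-- The coordinate `A ↦ (A e_j)_i` on linear maps. -/
def clmEntry (i j : Fin 2) : (Plane →L[ℝ] Plane) →L[ℝ] ℝ :=
  (EuclideanSpace.proj i : Plane →L[ℝ] ℝ).comp (ContinuousLinearMap.apply ℝ Plane (planeBasis j))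

lemma clmEntry_apply (i j : Fin 2) (A : Plane →L[ℝ] Plane) : clmEntry i j A = A (planeBasis j) i := rfl

lemma det_eq_clmEntry (A : Plane →L[ℝ] Plane) :
    A.det = clmEntry 0 0 A * clmEntry 1 1 A - clmEntry 1 0 A * clmEntry 0 1 A := by
  rw [plane_clm_det]; rfl

lemma clmEntry_id (i j : Fin 2) : clmEntry i j (ContinuousLinearMap.id ℝ Plane) = if i = j then 1 else 0 := by
  simp [clmEntry_apply]

lemma transposeDeriv_apply (Ψ : Plane → Plane) (y p : Plane) (j : Fin 2) : transposeDeriv Ψ y p j =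
    clmEntry 0 j (fderiv ℝ Ψ y) * p 0 + clmEntry 1 j (fderiv ℝ Ψ y) * p 1 := by
  have h1 : transposeDeriv Ψ y p j = inner ℝ (planeBasis j) (transposeDeriv Ψ y p) := by
    rw [plane_inner]; fin_cases j <;> simp
  rw [h1, transposeDeriv, ContinuousLinearMap.adjoint_inner_right, plane_inner]
  rfl

lemma areaElt_eq (p : Plane) : areaElt p = √(1 + p 0 ^ 2 + p 1 ^ 2) := by
  rw [areaElt, plane_norm_sq, add_assoc]

/-- The area element of a graph in terms of its pullback under a linear map. -/
lemma abs_det_mul_areaElt (A : Plane →L[ℝ] Plane) (p P : Plane)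
    (hP : ∀ j, P j = clmEntry 0 j A * p 0 + clmEntry 1 j A * p 1) :
    |A.det| * areaElt p = √(A.det ^ 2 + (clmEntry 1 1 A * P 0 - clmEntry 1 0 A * P 1) ^ 2 +
      (clmEntry 0 0 A * P 1 - clmEntry 0 1 A * P 0) ^ 2) := by
  have h0 : clmEntry 1 1 A * P 0 - clmEntry 1 0 A * P 1 = A.det * p 0 := by
    rw [det_eq_clmEntry, hP, hP]; ring
  have h1 : clmEntry 0 0 A * P 1 - clmEntry 0 1 A * P 0 = A.det * p 1 := by
    rw [det_eq_clmEntry, hP, hP]; ring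
  rw [h0, h1, areaElt_eq, ← Real.sqrt_sq_eq_abs, ← Real.sqrt_mul (sq_nonneg _)]
  congr 1; ring

namespace IsC1Isotopy
variable {a b t : ℝ} {Ψ : ℝ → Plane ≃ₜ Plane} {D : Set Plane}

lemma fderiv_of_id (hid : ∀ y, Ψ t y = y) (y : Plane) : fderiv ℝ (Ψ t) y = ContinuousLinearMap.id ℝ Plane := by
  have : (Ψ t : Plane → Plane) = id := funext hid
  rw [this, fderiv_id]

lemma hasLpDeriv_entry (h : IsC1Isotopy (Icc a b) Ψ) (ht : t ∈ Icc a b) (hb : Bornology.IsBounded D)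
    (i j : Fin 2) :
    HasLpDeriv ⊤ (volume.restrict D) (Icc a b) t (fun s y => clmEntry i j (fderiv ℝ (Ψ s) y))
      (fun y => clmEntry i j (fderiv ℝ (lagrangianVelocity (Icc a b) Ψ t) y)) :=
  (h.hasLpDeriv_fderiv ht hb).clm (clmEntry i j)

lemma hasLpDeriv_det (h : IsC1Isotopy (Icc a b) Ψ) (ht : t ∈ Icc a b) (hid : ∀ y, Ψ t y = y)
    (hb : Bornology.IsBounded D) :
    HasLpDeriv ⊤ (volume.restrict D) (Icc a b) t (fun s y => (fderiv ℝ (Ψ s) y).det)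
      (planeDiv (lagrangianVelocity (Icc a b) Ψ t)) := by
  have H := h.hasLpDeriv_entry ht hb
  refine ((((H 0 0).mul (r := ⊤) le_top le_top (H 1 1)).sub le_top
    ((H 1 0).mul (r := ⊤) le_top le_top (H 0 1)))).congr (Eventually.of_forall fun s =>
      Eventually.of_forall fun y => (det_eq_clmEntry _).symm)
      (Eventually.of_forall fun y => (det_eq_clmEntry _).symm) (Eventually.of_forall fun y => ?_)
  simp only [fderiv_of_id hid, clmEntry_id]
  simp [planeDiv, clmEntry_apply]

lemma det_of_id (hid : ∀ y, Ψ t y = y) (y : Plane) : (fderiv ℝ (Ψ t) y).det = 1 := by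
  rw [fderiv_of_id hid, det_eq_clmEntry]; simp [clmEntry_id]

/-- Near the reference time the isotopy preserves orientation, which removes the absolute value of the
Jacobian from the change of variables. -/
lemma eventually_det_pos (h : IsC1Isotopy (Icc a b) Ψ) (ht : t ∈ Icc a b) (hid : ∀ y, Ψ t y = y)
    (hb : Bornology.IsBounded D) :
    ∀ᶠ s in 𝓝[Icc a b \ {t}] t, ∀ᵐ y ∂(volume.restrict D), 0 < (fderiv ℝ (Ψ s) y).det := by
  filter_upwards [((h.hasLpDeriv_det ht hid hb).tendsto le_top).eventually_ae_norm_sub_lt one_pos]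
    with s hs
  filter_upwards [hs] with y hy
  rw [det_of_id hid, Real.norm_eq_abs, abs_lt] at hy
  linarith [hy.1]

/-- Differentiation of an integral over a moving domain, after the change of variables. -/
lemma hasDerivWithinAt_of_pullback (h : IsC1Isotopy (Icc a b) Ψ) (hm : MeasurableSet D)
    (ht : t ∈ Icc a b) {f : ℝ → Plane → ℝ} {f' : Plane → ℝ}
    (hf : HasLpDeriv 1 (volume.restrict D) (Icc a b) t
      (fun s y => |(fderiv ℝ (Ψ s) y).det| * f s (Ψ s y)) f') :
    HasDerivWithinAt (fun s => ∫ x in Ψ s '' D, f s x) (∫ y in D, f' y) (Icc a b) t := by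
  have hcv : ∀ s ∈ Icc a b, ∫ x in Ψ s '' D, f s x =
      ∫ y in D, |(fderiv ℝ (Ψ s) y).det| * f s (Ψ s y) := fun s hs =>
    integral_image_eq_integral_abs_det_fderiv_smul volume hm
      (fun x _ => ((h.contDiff s hs).differentiable one_ne_zero x).hasFDerivAt.hasFDerivWithinAt)
      (Ψ s).injective.injOn _
  exact hf.integral.congr hcv (hcv t ht)

/-- The Reynolds transport theorem. -/
theorem hasDerivWithinAt_setIntegral (h : IsC1Isotopy (Icc a b) Ψ) (hm : MeasurableSet D)
    (hb : Bornology.IsBounded D) (ht : t ∈ Icc a b) (hid : ∀ y, Ψ t y = y) {f : ℝ → Plane → ℝ}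
    {f' : Plane → ℝ} (hf : HasLpDeriv 1 (volume.restrict D) (Icc a b) t (fun s y => f s (Ψ s y)) f') :
    HasDerivWithinAt (fun s => ∫ x in Ψ s '' D, f s x)
      (∫ y in D, (planeDiv (lagrangianVelocity (Icc a b) Ψ t) y * f t y + f' y)) (Icc a b) t := by
  refine h.hasDerivWithinAt_of_pullback hm ht (((h.hasLpDeriv_det ht hid hb).mul (r := 1) le_rfl le_rfl
    hf).congr ?_ (Eventually.of_forall fun y => ?_) (Eventually.of_forall fun y => ?_))
  · filter_upwards [h.eventually_det_pos ht hid hb] with s hs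
    filter_upwards [hs] with y hy
    rw [abs_of_pos hy]
  · simp only [det_of_id hid, abs_one]
  · simp only [det_of_id hid, hid, one_mul]

/-- The rate of change of the area of a moving graph, in terms of the pulled back gradients `P`. -/
theorem hasDerivWithinAt_area (h : IsC1Isotopy (Icc a b) Ψ) (hm : MeasurableSet D)
    (hb : Bornology.IsBounded D) (ht : t ∈ Icc a b) (hid : ∀ y, Ψ t y = y) {p : ℝ → Plane → Plane}
    {P' : Plane → Plane} (hP : HasLpDeriv 2 (volume.restrict D) (Icc a b) t
      (fun s y => transposeDeriv (Ψ s) y (p s (Ψ s y))) P') {V : Plane → Plane}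
    (hV : V = lagrangianVelocity (Icc a b) Ψ t) :
    HasDerivWithinAt (fun s => ∫ x in Ψ s '' D, areaElt (p s x))
      (∫ y in D, (areaElt (p t y) * planeDiv V y +
        inner ℝ (p t y) (P' y - transposeDeriv V y (p t y)) / areaElt (p t y))) (Icc a b) t := by
  have hfin := isFiniteMeasure_restrict hb
  have h12 : (1 : ENNReal) ≤ 2 := by norm_num
  have H := h.hasLpDeriv_entry ht hb
  have hPi : ∀ i : Fin 2, HasLpDeriv 2 (volume.restrict D) (Icc a b) t
      (fun s y => transposeDeriv (Ψ s) y (p s (Ψ s y)) i) (fun y => P' y i) := fun i =>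
    hP.clm (EuclideanSpace.proj i : Plane →L[ℝ] ℝ)
  have hdet := (h.hasLpDeriv_det ht hid hb).mono_exponent (p := 2) le_top two_ne_zero
  have hQ0 := ((H 1 1).mul (r := 2) h12 h12 (hPi 0)).sub h12 ((H 1 0).mul (r := 2) h12 h12 (hPi 1))
  have hQ1 := ((H 0 0).mul (r := 2) h12 h12 (hPi 1)).sub h12 ((H 0 1).mul (r := 2) h12 h12 (hPi 0))
  have hid' : ∀ y v, transposeDeriv (Ψ t) y v = v := fun y v => by
    ext i
    rw [transposeDeriv_apply, fderiv_of_id hid]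
    fin_cases i <;> simp [clmEntry_id]
  refine h.hasDerivWithinAt_of_pullback hm ht ((hdet.sqrt hQ0 hQ1 (det_of_id hid)).congr
    (Eventually.of_forall fun s => Eventually.of_forall fun y => ?_)
    (Eventually.of_forall fun y => ?_) (Eventually.of_forall fun y => ?_))
  · exact (abs_det_mul_areaElt _ _ _ fun j => transposeDeriv_apply _ _ _ j).symm
  · exact (abs_det_mul_areaElt _ _ _ fun j => transposeDeriv_apply _ _ _ j).symm
  · simp only [fderiv_of_id hid, clmEntry_id, hid', hid, ← hV]
    have e1 : √(1 + p t y 0 ^ 2 + p t y 1 ^ 2) = areaElt (p t y) := (areaElt_eq _).symm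
    have e2 : areaElt (p t y) ^ 2 = 1 + p t y 0 ^ 2 + p t y 1 ^ 2 := by
      rw [areaElt_eq, Real.sq_sqrt (by positivity)]
    have e3 : areaElt (p t y) ≠ 0 := by
      rw [areaElt_eq]; positivity
    simp only [Fin.isValue, ↓reduceIte, one_ne_zero, zero_ne_one, one_mul, zero_mul, sub_zero, e1]
    rw [div_eq_iff e3, add_mul, div_mul_cancel₀ _ e3, plane_inner]
    simp only [PiLp.sub_apply, transposeDeriv_apply, planeDiv, ← clmEntry_apply]
    linear_combination (-(clmEntry 0 0 (fderiv ℝ V y) + clmEntry 1 1 (fderiv ℝ V y))) * e2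

end IsC1Isotopy

/-! ### The divergence theorem for products -/

section
variable {D : Set Plane} {c : ℝ → Plane} {V : Plane → Plane}

lemma contDiff_component (hV : ContDiff ℝ 1 V) (i : Fin 2) : ContDiff ℝ 1 fun x => V x i :=
  (EuclideanSpace.proj i : Plane →L[ℝ] ℝ).contDiff.comp hV

lemma gradient_component (hV : ContDiff ℝ 1 V) (x : Plane) (i j : Fin 2) :
    gradient (fun x => V x i) x j = clmEntry i j (fderiv ℝ V x) := by
  have h : HasFDerivAt (fun x => V x i) ((EuclideanSpace.proj i : Plane →L[ℝ] ℝ).comp (fderiv ℝ V x)) x :=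
    (EuclideanSpace.proj i : Plane →L[ℝ] ℝ).hasFDerivAt.comp x (hV.differentiable one_ne_zero x).hasFDerivAt
  rw [gradient_apply_eq, h.fderiv]
  rfl

lemma integrable_apply {μ : Measure Plane} {G : Plane → Plane} (h : MemLp G 1 μ) (i : Fin 2) :
    Integrable (fun x => G x i) μ :=
  memLp_one_iff_integrable.1 ((EuclideanSpace.proj i : Plane →L[ℝ] ℝ).comp_memLp' h)

/-- The divergence theorem for the product of a `C¹` vector field and a Sobolev function. -/
lemma HasSobolevTrace.integral_div_smul (hJ : IsC1JordanDomain D c) {z : Plane → ℝ} {g : Plane → Plane}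
    {r : ℝ → ℝ} (hz : HasSobolevTrace 1 D c z g r) (hV : ContDiff ℝ 1 V) :
    Integrable (fun x => planeDiv V x * z x + inner ℝ (V x) (g x)) (volume.restrict D) ∧
      ∫ x in D, (planeDiv V x * z x + inner ℝ (V x) (g x)) =
        arcIntegral c fun θ => r θ * inner ℝ (V (c θ)) (outerNormal c θ) := by
  have h := fun i => hz.mul_contDiff hJ.isBounded hJ.contDiff.continuous le_rfl (contDiff_component hV i)
  have e : (fun x => planeDiv V x * z x + inner ℝ (V x) (g x)) = fun x =>
      (V x 0 • g x + z x • gradient (fun x => V x 0) x) 0 +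
      (V x 1 • g x + z x • gradient (fun x => V x 1) x) 1 := by
    ext x
    simp only [PiLp.add_apply, PiLp.smul_apply, smul_eq_mul, gradient_component hV, plane_inner, planeDiv,
      ← clmEntry_apply]
    ring
  rw [e]
  refine ⟨(integrable_apply (h 0).memLp_grad 0).add (integrable_apply (h 1).memLp_grad 1), ?_⟩
  rw [hJ.integral_div_eq (h 0) (h 1)]
  congr 1; ext θ
  rw [plane_inner]; ring

/-- A weak divergence is the trace of the weak Jacobian matrix. -/
lemma HasWeakDiv.ae_eq (hD : IsOpen D) {F : Plane → Plane} {G : Fin 2 → Plane → Plane} {d : Plane → ℝ}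
    (hd : HasWeakDiv D F d) (hF : ∀ i, HasWeakGrad D (fun x => F x i) (G i)) :
    d =ᵐ[volume.restrict D] fun x => G 0 x 0 + G 1 x 1 := by
  have hi : ∀ i, LocallyIntegrableOn (fun x => G i x i) D := fun i x hx => by
    obtain ⟨U, hU, hU'⟩ := (hF i).2.1 x hx
    exact ⟨U, hU, (EuclideanSpace.proj i : Plane →L[ℝ] ℝ).integrable_comp hU'⟩
  refine ae_eq_of_forall_testFun hD hd.2.1 ((hi 0).add (hi 1)) fun φ hφ _ => ?_
  have h1 : ∀ i : Fin 2, Integrable (fun x => F x i * gradient φ x i) (volume.restrict D) ∧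
      Integrable (fun x => φ x * G i x i) (volume.restrict D) := fun i =>
    ⟨(EuclideanSpace.proj i : Plane →L[ℝ] ℝ).integrable_comp ((hF i).integrableOn_smul hφ).1,
      (EuclideanSpace.proj i : Plane →L[ℝ] ℝ).integrable_comp ((hF i).integrableOn_smul hφ).2⟩
  have h2 := hd.2.2 φ hφ
  simp only [plane_inner] at h2
  rw [integral_add (h1 0).1 (h1 1).1, (hF 0).integral_apply hφ, (hF 1).integral_apply hφ] at h2
  have h3 : ∫ x in D, φ x • (G 0 x 0 + G 1 x 1) = (∫ x in D, φ x * G 0 x 0) + ∫ x in D, φ x * G 1 x 1 := by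
    rw [← integral_add (h1 0).2 (h1 1).2]
    simp only [smul_eq_mul, mul_add]
  rw [h3]
  simp only [smul_eq_mul, mul_comm (φ _) (d _)]
  linarith

/-- Integration by parts of a Sobolev function against a Sobolev vector field. -/
lemma HasSobolevTrace.integral_inner_add (hJ : IsC1JordanDomain D c) {w : Plane → ℝ} {g : Plane → Plane}
    {r : ℝ → ℝ} (hw : HasSobolevTrace 2 D c w g r) {F : Plane → Plane} {G : Fin 2 → Plane → Plane}
    {k : ℝ → Plane} (hF : ∀ i, HasSobolevTrace 2 D c (fun x => F x i) (G i) (fun θ => k θ i))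
    {d : Plane → ℝ} (hd : HasWeakDiv D F d) :
    Integrable (fun x => w x * d x) (volume.restrict D) ∧
    Integrable (fun x => inner ℝ (F x) (g x)) (volume.restrict D) ∧
      (∫ x in D, inner ℝ (F x) (g x)) + ∫ x in D, w x * d x =
        arcIntegral c fun θ => r θ * inner ℝ (k θ) (outerNormal c θ) := by
  have hd' := hd.ae_eq hJ.isOpen fun i => (hF i).hasWeakGrad hJ.isBounded (by norm_num)
  have hm : ∀ {f k : Plane → ℝ}, MemLp f 2 (volume.restrict D) → MemLp k 2 (volume.restrict D) →
      Integrable (fun x => f x * k x) (volume.restrict D) := fun hf hk =>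
    memLp_one_iff_integrable.1 (MemLp.mul (p := 2) (q := 2) (r := 1) hk hf)
  have hc : ∀ {X : Plane → Plane} (i : Fin 2), MemLp X 2 (volume.restrict D) →
      MemLp (fun x => X x i) 2 (volume.restrict D) := fun i hX =>
    (EuclideanSpace.proj i : Plane →L[ℝ] ℝ).comp_memLp' hX
  have h1 : Integrable (fun x => w x * d x) (volume.restrict D) :=
    (hm hw.memLp ((hc 0 (hF 0).memLp_grad).add (hc 1 (hF 1).memLp_grad))).congr
      (hd'.mono fun x hx => by simp only [hx, Pi.add_apply])
  have h2 : Integrable (fun x => inner ℝ (F x) (g x)) (volume.restrict D) := by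
    simp only [plane_inner]
    exact (hm (hF 0).memLp (hc 0 hw.memLp_grad)).add (hm (hF 1).memLp (hc 1 hw.memLp_grad))
  refine ⟨h1, h2, ?_⟩
  rw [← integral_add h2 h1]
  have h3 := hJ.integral_div_eq (hw.mul (hF 0)) (hw.mul (hF 1))
  have h4 : (fun x => inner ℝ (F x) (g x) + w x * d x) =ᵐ[volume.restrict D] fun x =>
      (w x • G 0 x + F x 0 • g x) 0 + (w x • G 1 x + F x 1 • g x) 1 := by
    filter_upwards [hd'] with x hx
    rw [hx, plane_inner]
    simp only [PiLp.add_apply, PiLp.smul_apply, smul_eq_mul]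
    ring
  rw [integral_congr_ae h4, h3]
  congr 1; ext θ
  rw [plane_inner]; ring

end

/-! ### The area element -/

lemma one_le_areaElt (p : Plane) : 1 ≤ areaElt p := by
  rw [areaElt, Real.one_le_sqrt]; nlinarith [sq_nonneg ‖p‖]

lemma areaElt_pos (p : Plane) : 0 < areaElt p := one_pos.trans_le (one_le_areaElt p)

lemma areaElt_sq (p : Plane) : areaElt p ^ 2 = 1 + ‖p‖ ^ 2 := Real.sq_sqrt (by positivity)

lemma norm_le_areaElt (p : Plane) : ‖p‖ ≤ areaElt p := Real.le_sqrt_of_sq_le (by linarith)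

lemma contDiff_areaElt : ContDiff ℝ 1 areaElt :=
  (contDiff_const.add (contDiff_norm_sq ℝ)).sqrt fun p => by positivity

lemma gradient_areaElt (p : Plane) : gradient areaElt p = (areaElt p)⁻¹ • p := by
  have h : HasFDerivAt (fun p : Plane => 1 + ‖p‖ ^ 2) (2 • innerSL ℝ p) p :=
    (hasStrictFDerivAt_norm_sq p).hasFDerivAt.const_add 1
  refine gradient_eq_of_hasFDerivAt (h.sqrt (by positivity)) fun e => ?_
  have := areaElt_pos p
  simp only [inner_smul_left]
  simp
  field_simp
  rw [show √(1 + ‖p‖ ^ 2) = areaElt p from rfl, mul_comm]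

/-- The `i`-th component of the flux `p / √(1+|p|²)` has a bounded gradient. -/
lemma norm_gradient_flux_le (i : Fin 2) (p : Plane) :
    ‖gradient (fun p : Plane => p i * (areaElt p)⁻¹) p‖ ≤ (2 : NNReal) := by
  have hW := areaElt_pos p
  have h1 : HasFDerivAt (fun p : Plane => p i) (EuclideanSpace.proj i : Plane →L[ℝ] ℝ) p :=
    (EuclideanSpace.proj i : Plane →L[ℝ] ℝ).hasFDerivAt
  have h2 := ((contDiff_areaElt.differentiable one_ne_zero p).hasFDerivAt)
  have h3 := h1.mul ((hasDerivAt_inv hW.ne').comp_hasFDerivAt p h2)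
  have h4 : gradient (fun p : Plane => p i * (areaElt p)⁻¹) p =
      (areaElt p)⁻¹ • planeBasis i - (p i * (areaElt p)⁻¹ ^ 3) • p := by
    refine gradient_eq_of_hasFDerivAt h3 fun e => ?_
    have h5 : fderiv ℝ areaElt p e = (areaElt p)⁻¹ * inner ℝ p e := by
      rw [← inner_gradient_left, gradient_areaElt, inner_smul_left]; rfl
    have h6 : inner ℝ (planeBasis i) e = e i := by
      rw [plane_inner]; fin_cases i <;> simp
    rw [inner_sub_left, inner_smul_left, inner_smul_left, h6]
    simp [h5]
    field_simp
    ring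
  rw [h4]
  have hi : (areaElt p)⁻¹ ≤ 1 := inv_le_one_of_one_le₀ (one_le_areaElt p)
  have hi0 : 0 ≤ (areaElt p)⁻¹ := (inv_pos.2 hW).le
  have hn : ‖p‖ * (areaElt p)⁻¹ ≤ 1 := by
    rw [← div_eq_mul_inv, div_le_one hW]; exact norm_le_areaElt p
  have hn0 : 0 ≤ ‖p‖ * (areaElt p)⁻¹ := by positivity
  have hpi : |p i| * (areaElt p)⁻¹ ≤ 1 :=
    (mul_le_mul_of_nonneg_right (plane_abs_apply_le p i) hi0).trans hn
  have hpi0 : 0 ≤ |p i| * (areaElt p)⁻¹ := by positivity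
  refine (norm_sub_le _ _).trans ?_
  have e1 : ‖(areaElt p)⁻¹ • planeBasis i‖ = (areaElt p)⁻¹ := by
    rw [norm_smul, Real.norm_of_nonneg hi0]; simp
  have e2 : ‖(p i * (areaElt p)⁻¹ ^ 3) • p‖ =
      (|p i| * (areaElt p)⁻¹) * (‖p‖ * (areaElt p)⁻¹) * (areaElt p)⁻¹ := by
    rw [norm_smul, norm_mul, Real.norm_eq_abs, Real.norm_of_nonneg (by positivity)]; ring
  rw [e1, e2]
  have e3 : (|p i| * (areaElt p)⁻¹) * (‖p‖ * (areaElt p)⁻¹) * (areaElt p)⁻¹ ≤ 1 * 1 * 1 := by gcongr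
  norm_num
  linarith

lemma contDiff_flux (i : Fin 2) : ContDiff ℝ 1 fun p : Plane => p i * (areaElt p)⁻¹ :=
  (EuclideanSpace.proj i : Plane →L[ℝ] ℝ).contDiff.mul
    (contDiff_areaElt.inv fun p => (areaElt_pos p).ne')

/-! ### The rate of change of the energy -/

section Static
variable {D : Set Plane} {c : ℝ → Plane} {V : Plane → Plane} {u U' : Plane → ℝ} {a P' : Plane → Plane}
  {b : Fin 2 → Plane → Plane} {q : ℝ → Plane} {d : Plane → ℝ}

/-- The trace of `w = U' - ∇u·V`, the Eulerian time derivative of a profile `u` whose Lagrangian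
time derivative is `U'`. -/
lemma hasSobolevTrace_eulerian (hJ : IsC1JordanDomain D c) (hV : ContDiff ℝ 1 V) (hU : IsH10Lim D U' P')
    (ha : ∀ i, HasSobolevTrace 2 D c (fun x => a x i) (b i) (fun θ => q θ i)) :
    HasSobolevTrace 2 D c (fun x => U' x - inner ℝ (V x) (a x))
      (fun x => P' x - ((V x 0 • b 0 x + a x 0 • gradient (fun x => V x 0) x) +
        (V x 1 • b 1 x + a x 1 • gradient (fun x => V x 1) x)))
      (fun θ => -inner ℝ (V (c θ)) (q θ)) := by
  have h := fun i => (ha i).mul_contDiff hJ.isBounded hJ.contDiff.continuous (by norm_num)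
    (contDiff_component hV i)
  refine ((hU.hasSobolevTrace hJ).sub ((h 0).add (h 1) (by norm_num)) (by norm_num)).congr
    (Eventually.of_forall fun x => ?_) ae_eq_rfl (Eventually.of_forall fun θ => ?_)
  · simp only [plane_inner]
  · simp only [plane_inner, zero_sub]

lemma integral_planeDiv (hJ : IsC1JordanDomain D c) (hV : ContDiff ℝ 1 V) :
    ∫ x in D, planeDiv V x = arcIntegral c fun θ => inner ℝ (V (c θ)) (outerNormal c θ) := by
  have e := ((HasSobolevTrace.of_contDiff hJ.isBounded hJ.contDiff.continuous
    (contDiff_const (c := (1 : ℝ))) 1).integral_div_smul hJ hV).2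
  have hg : gradient (fun _ : Plane => (1 : ℝ)) = fun _ => 0 := by
    ext x : 1; simp [gradient]
  simpa only [hg, inner_zero_right, one_mul, mul_one, add_zero] using e

/-- The first variation of the area. The boundary terms combine to `v / √(1+|q|²)` because the
trace `q` of the gradient is normal to the boundary. -/
lemma area_variation (hJ : IsC1JordanDomain D c) (hV : ContDiff ℝ 1 V) (hU : IsH10Lim D U' P')
    (hu : HasWeakGrad D u a)
    (ha : ∀ i, HasSobolevTrace 2 D c (fun x => a x i) (b i) (fun θ => q θ i))
    (hq : ∀ᵐ θ ∂paramMeasure, q θ = -(‖q θ‖ • outerNormal c θ))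
    (hd : HasWeakDiv D (fun x => (areaElt (a x))⁻¹ • a x) d) :
    Integrable (fun x => (U' x - inner ℝ (V x) (a x)) * d x) (volume.restrict D) ∧
    ∫ y in D, (areaElt (a y) * planeDiv V y +
        inner ℝ (a y) (P' y - transposeDeriv V y (a y)) / areaElt (a y)) =
      arcIntegral c (fun θ => (areaElt (q θ))⁻¹ * inner ℝ (V (c θ)) (outerNormal c θ)) -
        ∫ x in D, (U' x - inner ℝ (V x) (a x)) * d x := by
  have hb := hJ.isBounded
  have hw := hasSobolevTrace_eulerian hJ hV hU ha
  have hW := HasSobolevTrace.comp hb contDiff_areaElt (C := 1) (fun p => by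
    rw [gradient_areaElt, norm_smul, norm_inv, Real.norm_of_nonneg (areaElt_pos p).le,
      inv_mul_le_iff₀ (areaElt_pos p)]
    simpa using norm_le_areaElt p) ha
  have hF : ∀ i : Fin 2, HasSobolevTrace 2 D c (fun x => ((areaElt (a x))⁻¹ • a x) i)
      (fun x => gradient (fun p : Plane => p i * (areaElt p)⁻¹) (a x) 0 • b 0 x +
        gradient (fun p : Plane => p i * (areaElt p)⁻¹) (a x) 1 • b 1 x)
      (fun θ => ((areaElt (q θ))⁻¹ • q θ) i) := fun i =>
    (HasSobolevTrace.comp hb (contDiff_flux i) (norm_gradient_flux_le i) ha).congr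
      (Eventually.of_forall fun x => by simp [mul_comm]) ae_eq_rfl
      (Eventually.of_forall fun θ => by simp [mul_comm])
  obtain ⟨i1, e1⟩ := (hW.mono_exponent hb).integral_div_smul hJ hV
  obtain ⟨i2, i3, e2⟩ := hw.integral_inner_add hJ hF hd
  refine ⟨i2, ?_⟩
  have hsymm := weakHessian_symm hJ.isOpen hu fun i => (ha i).hasWeakGrad hb (by norm_num)
  have hpt : (fun y => areaElt (a y) * planeDiv V y +
      inner ℝ (a y) (P' y - transposeDeriv V y (a y)) / areaElt (a y)) =ᵐ[volume.restrict D]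
      fun x => (planeDiv V x * areaElt (a x) + inner ℝ (V x)
        (gradient areaElt (a x) 0 • b 0 x + gradient areaElt (a x) 1 • b 1 x)) +
      inner ℝ ((areaElt (a x))⁻¹ • a x) (P' x - ((V x 0 • b 0 x + a x 0 • gradient (fun x => V x 0) x) +
        (V x 1 • b 1 x + a x 1 • gradient (fun x => V x 1) x))) := by
    filter_upwards [hsymm] with x hx
    simp only [gradient_areaElt, plane_inner, PiLp.add_apply, PiLp.sub_apply, PiLp.smul_apply, smul_eq_mul,
      gradient_component hV, transposeDeriv_apply, div_eq_mul_inv, hx]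
    ring
  rw [integral_congr_ae hpt, integral_add i1 i3, e1]
  have e3 := hJ.arcIntegral_add (k := fun θ => areaElt (q θ) * inner ℝ (V (c θ)) (outerNormal c θ))
    (k' := fun θ => -inner ℝ (V (c θ)) (q θ) * inner ℝ ((areaElt (q θ))⁻¹ • q θ) (outerNormal c θ))
    (memLp_mul_continuous (hW.mono_exponent hb).memLp_trace
      ((hV.continuous.comp hJ.contDiff.continuous).inner hJ.continuous_outerNormal)) ?_
  · rw [eq_sub_iff_add_eq, add_assoc, e2, ← e3]
    refine arcIntegral_congr c ?_
    filter_upwards [hq] with θ hθ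
    have hn : inner ℝ (outerNormal c θ) (outerNormal c θ) = 1 := by
      rw [real_inner_self_eq_norm_sq, norm_outerNormal hJ, one_pow]
    have hWq := areaElt_sq (q θ)
    have hW0 := (areaElt_pos (q θ)).ne'
    have f1 : inner ℝ (V (c θ)) (q θ) = -(‖q θ‖ * inner ℝ (V (c θ)) (outerNormal c θ)) := by
      conv_lhs => rw [hθ]
      rw [inner_neg_right, inner_smul_right]
    have f2 : inner ℝ ((areaElt (q θ))⁻¹ • q θ) (outerNormal c θ) = -((areaElt (q θ))⁻¹ * ‖q θ‖) := by
      have : inner ℝ (q θ) (outerNormal c θ) = -‖q θ‖ := by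
        conv_lhs => rw [hθ]
        rw [inner_neg_left, inner_smul_left, hn]; simp
      rw [inner_smul_left, this]; simp
    rw [f1, f2]
    field_simp
    linear_combination (inner ℝ (V (c θ)) (outerNormal c θ)) * hWq
  · have hp : ∀ i, MemLp (fun θ => -inner ℝ (V (c θ)) (q θ) * ((areaElt (q θ))⁻¹ • q θ) i) 1 paramMeasure :=
      fun i => (hw.mul (hF i)).memLp_trace
    have hn : ∀ i, Continuous fun θ => outerNormal c θ i := fun i =>
      (EuclideanSpace.proj i : Plane →L[ℝ] ℝ).continuous.comp hJ.continuous_outerNormal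
    refine ((memLp_mul_continuous (hp 0) (hn 0)).add (memLp_mul_continuous (hp 1) (hn 1))).ae_eq
      (Eventually.of_forall fun θ => ?_)
    simp only [Pi.add_apply, plane_inner]
    ring

end Static

namespace IsDropletTrajectory
variable {α β t : ℝ} {D₀ : Set Plane} {Φ : ℝ → Plane ≃ₜ Plane} {D : ℝ → Set Plane}
  {u : ℝ → Plane → ℝ} {c : ℝ → Plane} {a : Plane → Plane} {b : Fin 2 → Plane → Plane} {q : ℝ → Plane}
  {d : Plane → ℝ}

/-- Along a droplet trajectory the Eulerian time derivative `w = ∂ₜu` exists, has the trace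
`|∇u| v_cl`, and determines the rates of change of the volume and of the energy. -/
theorem exists_eulerian (P : DropletParams) (h : IsDropletTrajectory (Icc α β) D₀ Φ D u) (hab : α < β)
    (ht : t ∈ Icc α β) (hJ : IsC1JordanDomain (D t) c)
    (hu : HasSobolevTrace 2 (D t) c (u t) a fun _ => 0)
    (ha : ∀ i, HasSobolevTrace 2 (D t) c (fun x => a x i) (b i) (fun θ => q θ i))
    (hq : ∀ᵐ θ ∂paramMeasure, q θ = -(‖q θ‖ • outerNormal c θ))
    (hd : HasWeakDiv (D t) (fun x => (areaElt (a x))⁻¹ • a x) d) :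
    ∃ (w : Plane → ℝ) (g : Plane → Plane),
      HasSobolevTrace 2 (D t) c w g (fun θ => ‖q θ‖ * normalSpeed (Icc α β) Φ t c θ) ∧
      HasTimeDeriv (Icc α β) D u t w ∧
      HasDerivWithinAt (fun s => ∫ x in D s, u s x) (∫ x in D t, w x) (Icc α β) t ∧
      Integrable (fun x => w x * d x) (volume.restrict (D t)) ∧
      HasDerivWithinAt (fun s => energy P (D s) (u s))
        (P.γlg * (arcIntegral c (fun θ => (areaElt (q θ))⁻¹ * normalSpeed (Icc α β) Φ t c θ) -
            ∫ x in D t, w x * d x) +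
          (P.γsl - P.γsg) * arcIntegral c (normalSpeed (Icc α β) Φ t c) +
          P.ρ * P.g * ∫ x in D t, u t x * w x) (Icc α β) t := by
  obtain ⟨U', P', hU', hUd, hPd⟩ := h.exists_hasLpDeriv hab ht hJ.isOpen hJ.isBounded
  have hb := hJ.isBounded
  have hfin := isFiniteMeasure_restrict hb
  have hm := hJ.isOpen.measurableSet
  have hΨ := h.isotopy.from_time ht
  have hid := isotopyFrom_self Φ t
  set Ψ := isotopyFrom Φ t with hΨdef
  set V := lagrangianVelocity (Icc α β) Ψ t with hVdef
  have hV : ContDiff ℝ 1 V := hΨ.contDiff_velocity t ht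
  have himg : ∀ s ∈ Icc α β, Ψ s '' D t = D s := fun s hs => h.image_isotopyFrom ht hs
  have h12 : (1 : ENNReal) ≤ 2 := by norm_num
  have hw := hasSobolevTrace_eulerian hJ hV hU' ha
  have hspeed : ∀ θ, normalSpeed (Icc α β) Φ t c θ = inner ℝ (V (c θ)) (outerNormal c θ) := fun θ => rfl
  have hu1 := hu.mono_exponent hb
  -- functions with zero trace do not see the motion of the domain
  have hzero : ∀ {z : Plane → ℝ} {gz : Plane → Plane}, HasSobolevTrace 1 (D t) c z gz (fun _ => 0) →
      Integrable (fun x => planeDiv V x * z x + inner ℝ (V x) (gz x)) (volume.restrict (D t)) ∧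
      ∫ x in D t, (planeDiv V x * z x + inner ℝ (V x) (gz x)) = 0 := fun hz => by
    refine ⟨(hz.integral_div_smul hJ hV).1, ?_⟩
    rw [(hz.integral_div_smul hJ hV).2]; simp [arcIntegral]
  have hwa : weakGrad (D t) (u t) =ᵐ[volume.restrict (D t)] a :=
    (hu.hasWeakGrad hb h12).weakGrad_ae hJ.isOpen
  refine ⟨fun x => U' x - inner ℝ (V x) (a x), _, hw.congr ae_eq_rfl ae_eq_rfl ?_,
    ⟨locallyIntegrableOn_of_memLp hb h12 hw.memLp, fun φ hφ => ?_⟩, ?_,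
    (area_variation hJ hV hU' (hu.hasWeakGrad hb h12) ha hq hd).1, ?_⟩
  · filter_upwards [hq] with θ hθ
    rw [hspeed]
    conv_lhs => rw [hθ]
    rw [inner_neg_right, inner_smul_right, neg_neg]
  · have k1 := (hUd.mul (r := 2) le_top h12 (hΨ.hasLpDeriv_comp ht hb hφ.1)).mono_exponent h12 one_ne_zero
    have k2 := (hΨ.hasDerivWithinAt_setIntegral hm hb ht hid (f := fun s x => u s x * φ x) k1).congr
      (f₁ := fun s => ∫ x in D s, u s x * φ x) (fun s hs => by rw [himg s hs]) (by rw [himg t ht])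
    refine k2.congr_deriv ?_
    obtain ⟨i1, e1⟩ := hzero ((hu1.mul_contDiff hb hJ.contDiff.continuous le_rfl hφ.1).congr ae_eq_rfl
      ae_eq_rfl (Eventually.of_forall fun θ => by simp))
    have i2 : Integrable (fun x => (U' x - inner ℝ (V x) (a x)) * φ x) (volume.restrict (D t)) :=
      memLp_one_iff_integrable.1 (MemLp.mul (p := 2) (q := 2) (r := 1)
        (memLp_of_continuous hb hφ.1.continuous 2) hw.memLp)
    rw [← zero_add (∫ x in D t, (U' x - inner ℝ (V x) (a x)) * φ x), ← e1, ← integral_add i1 i2]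
    congr 1; ext x
    rw [hid, ← hVdef, inner_add_right, inner_smul_right, inner_smul_right,
      real_inner_comm (V x) (gradient φ x)]
    ring
  · have k1 := hUd.mono_exponent h12 one_ne_zero
    have k2 := (hΨ.hasDerivWithinAt_setIntegral hm hb ht hid (f := u) k1).congr
      (f₁ := fun s => ∫ x in D s, u s x) (fun s hs => by rw [himg s hs]) (by rw [himg t ht])
    refine k2.congr_deriv ?_
    obtain ⟨i1, e1⟩ := hzero hu1
    have i2 : Integrable (fun x => U' x - inner ℝ (V x) (a x)) (volume.restrict (D t)) :=
      hw.memLp.integrable h12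
    rw [← zero_add (∫ x in D t, (U' x - inner ℝ (V x) (a x))), ← e1, ← integral_add i1 i2]
    congr 1; ext x
    rw [← hVdef]
    ring
  · have A1 := hΨ.hasDerivWithinAt_area hm hb ht hid (p := fun s => weakGrad (D s) (u s)) hPd hVdef
    have A2 : ∫ y in D t, (areaElt (weakGrad (D t) (u t) y) * planeDiv V y +
        inner ℝ (weakGrad (D t) (u t) y) (P' y - transposeDeriv V y (weakGrad (D t) (u t) y)) /
          areaElt (weakGrad (D t) (u t) y)) = _ :=
      (integral_congr_ae (hwa.mono fun x hx => by simp only [hx])).trans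
        (area_variation hJ hV hU' (hu.hasWeakGrad hb h12) ha hq hd).2
    rw [A2] at A1
    have B1 := hΨ.hasDerivWithinAt_setIntegral hm hb ht hid (f := fun _ _ => (1 : ℝ))
      (HasLpDeriv.const (memLp_const 1))
    have B2 : ∫ y in D t, (planeDiv V y * 1 + 0) = arcIntegral c (normalSpeed (Icc α β) Φ t c) := by
      simp only [mul_one, add_zero]
      exact integral_planeDiv hJ hV
    rw [← hVdef, B2] at B1
    have C0 := ((hUd.mul (r := 1) h12 le_rfl hUd).clm ((1 / 2 : ℝ) • ContinuousLinearMap.id ℝ ℝ)).congr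
      (f₁ := fun s y => u s (Ψ s y) ^ 2 / 2) (f₁' := fun y => u t y * U' y)
      (Eventually.of_forall fun s => Eventually.of_forall fun y => by simp; ring)
      (Eventually.of_forall fun y => by simp; ring)
      (Eventually.of_forall fun y => by simp [hid]; ring)
    have C1 := hΨ.hasDerivWithinAt_setIntegral hm hb ht hid (f := fun s x => u s x ^ 2 / 2) C0
    have C2 : ∫ y in D t, (planeDiv V y * (u t y ^ 2 / 2) + u t y * U' y) =
        ∫ x in D t, u t x * (U' x - inner ℝ (V x) (a x)) := by
      obtain ⟨i1, e1⟩ := hzero (((hu.mul hu).const_mul (1 / 2)).congr ae_eq_rfl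
        ae_eq_rfl (Eventually.of_forall fun θ => by simp))
      have i2 : Integrable (fun x => u t x * (U' x - inner ℝ (V x) (a x))) (volume.restrict (D t)) :=
        memLp_one_iff_integrable.1 (MemLp.mul (p := 2) (q := 2) (r := 1) hw.memLp hu.memLp)
      rw [← zero_add (∫ x in D t, u t x * (U' x - inner ℝ (V x) (a x))), ← e1, ← integral_add i1 i2]
      congr 1; ext x
      rw [inner_smul_right, inner_add_right, inner_smul_right]
      ring
    rw [← hVdef, C2] at C1
    have hvol : ∀ s, volume.real (D s) = ∫ _ in D s, (1 : ℝ) := fun s => by simp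
    exact (((A1.const_mul P.γlg).add (B1.const_mul (P.γsl - P.γsg))).add (C1.const_mul (P.ρ * P.g))).congr
      (fun s hs => by simp only [energy, himg s hs, hvol, Pi.add_apply])
      (by simp only [energy, himg t ht, hvol, Pi.add_apply])

end IsDropletTrajectory

/-! ### Droplet solutions -/

lemma HasTimeDeriv.ae_unique {α β t : ℝ} (hab : α < β) (ht : t ∈ Icc α β) {D : ℝ → Set Plane}
    {u : ℝ → Plane → ℝ} (hD : IsOpen (D t)) {w w' : Plane → ℝ} (h : HasTimeDeriv (Icc α β) D u t w)
    (h' : HasTimeDeriv (Icc α β) D u t w') : w =ᵐ[volume.restrict (D t)] w' := by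
  refine ae_eq_of_forall_testFun hD h.1 h'.1 fun φ hφ _ => ?_
  simp only [smul_eq_mul, mul_comm (φ _)]
  exact (uniqueDiffOn_Icc hab t ht).eq_deriv _ (h.2 φ hφ) (h'.2 φ hφ)

lemma IsC1JordanDomain.continuous_normalSpeed {D : Set Plane} {c : ℝ → Plane} (hJ : IsC1JordanDomain D c)
    {J : Set ℝ} {Φ : ℝ → Plane ≃ₜ Plane} (hΦ : IsC1Isotopy J Φ) {t : ℝ} (ht : t ∈ J) :
    Continuous (normalSpeed J Φ t c) :=
  ((hΦ.contDiff_velocity t ht).continuous.comp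
    ((Φ t).symm.continuous.comp hJ.contDiff.continuous)).inner hJ.continuous_outerNormal

lemma cos_contactAngle (p : Plane) : Real.cos (contactAngle p) = 1 / areaElt p :=
  Real.cos_arctan _

lemma contactAngle_mem (p : Plane) : contactAngle p ∈ Icc 0 Real.pi :=
  ⟨Real.arctan_nonneg.2 (norm_nonneg p), (Real.arctan_lt_pi_div_two _).le.trans (by linarith [Real.pi_pos])⟩

namespace IsDropletSolution
variable {P : DropletParams} {T Vol : ℝ} {D₀ : Set Plane} {Φ : ℝ → Plane ≃ₜ Plane} {D : ℝ → Set Plane}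
  {c : ℝ → ℝ → Plane} {u ut : ℝ → Plane → ℝ} {q : ℝ → ℝ → Plane} {lam : ℝ → ℝ} {t : ℝ}

lemma hasSobolevTrace (h : IsDropletSolution P T Vol D₀ Φ D c u ut q lam) (ht : t ∈ Icc 0 T) :
    HasSobolevTrace 2 (D t) (c t) (u t) (weakGrad (D t) (u t)) fun _ => 0 :=
  (MemH10.isH10Lim (h.jordan t ht).isOpen (h.jordan t ht).isBounded
    (h.trajectory.memH10 t ht)).hasSobolevTrace (h.jordan t ht)

lemma hasSobolevTrace_grad (h : IsDropletSolution P T Vol D₀ Φ D c u ut q lam) (ht : t ∈ Icc 0 T)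
    (i : Fin 2) : HasSobolevTrace 2 (D t) (c t) (fun x => weakGrad (D t) (u t) x i)
      (weakGrad (D t) fun x => weakGrad (D t) (u t) x i) fun θ => q t θ i :=
  (h.gradTrace t ht i).hasSobolevTrace (h.jordan t ht)

/-- The gradient of the profile points along the inner normal on the contact line. -/
lemma gradTrace_eq (h : IsDropletSolution P T Vol D₀ Φ D c u ut q lam) (ht : t ∈ Icc 0 T) :
    ∀ᵐ θ ∂paramMeasure, q t θ = -(‖q t θ‖ • outerNormal (c t) θ) :=
  trace_grad_eq (h.jordan t ht) (h.hasSobolevTrace ht) (h.hasSobolevTrace_grad ht)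
    (h.trajectory.nonneg t ht)

/-- The contact line law in the form of a force balance. -/
lemma speed_eq (h : IsDropletSolution P T Vol D₀ Φ D c u ut q lam) (hγ : 0 < P.γlg) (ht : t ∈ Icc 0 T) :
    ∀ᵐ θ ∂paramMeasure, P.R * normalSpeed (Icc 0 T) Φ t (c t) θ =
      -P.γlg * (P.σ + 1 / areaElt (q t θ)) := by
  filter_upwards [h.contactLine t ht] with θ hθ
  rw [div_mul_eq_mul_div, div_eq_iff hγ.ne'] at hθ
  rw [hθ]; ring

/-- The rate of change of the energy along an arbitrary trajectory of constant volume that passes,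
at the time `τ`, through the droplet of the solution at the time `t`. The Lagrange multiplier drops
out because `∫ w = 0`. -/
theorem first_variation (h : IsDropletSolution P T Vol D₀ Φ D c u ut q lam) (hγ : 0 < P.γlg)
    (ht : t ∈ Icc 0 T) {α β τ : ℝ} (hab : α < β) (hτ : τ ∈ Icc α β) {D₀' : Set Plane}
    {Φ' : ℝ → Plane ≃ₜ Plane} {D' : ℝ → Set Plane} {u' : ℝ → Plane → ℝ}
    (h' : IsDropletTrajectory (Icc α β) D₀' Φ' D' u')
    (hvol : ∀ s ∈ Icc α β, ∫ x in D' s, u' s x = Vol) (hD : D' τ = D t)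
    (hu : u' τ =ᵐ[volume.restrict (D t)] u t) :
    ∃ (w : Plane → ℝ) (g : Plane → Plane),
      HasSobolevTrace 2 (D t) (c t) w g (fun θ => ‖q t θ‖ * normalSpeed (Icc α β) Φ' τ (c t) θ) ∧
      HasTimeDeriv (Icc α β) D' u' τ w ∧
      HasDerivWithinAt (fun s => energy P (D' s) (u' s))
        (arcIntegral (c t) (fun θ => P.γlg * (P.σ + 1 / areaElt (q t θ)) *
            normalSpeed (Icc α β) Φ' τ (c t) θ) -
          P.ζ * ∫ x in D t, w x * ut t x / areaElt (weakGrad (D t) (u t) x)) (Icc α β) τ := by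
  have hJ := h.jordan t ht
  obtain ⟨d, hd, hpde⟩ := h.surface t ht
  have hu0 := (h.hasSobolevTrace ht).congr hu.symm ae_eq_rfl ae_eq_rfl
  obtain ⟨w, g, h1, h2, h3, h4, h5⟩ := h'.exists_eulerian P hab hτ (c := c t) (by rwa [hD])
    (by rw [hD]; exact hu0) (by rw [hD]; exact h.hasSobolevTrace_grad ht) (h.gradTrace_eq ht)
    (by rw [hD]; exact hd)
  rw [hD] at h1 h3 h4 h5
  refine ⟨w, g, h1, h2, h5.congr_deriv ?_⟩
  -- constant volume
  have hw0 : ∫ x in D t, w x = 0 :=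
    (uniqueDiffOn_Icc hab τ hτ).eq_deriv _ h3
      ((hasDerivWithinAt_const τ (Icc α β) Vol).congr hvol (hvol τ hτ))
  have hfin := isFiniteMeasure_restrict hJ.isBounded
  have hv := hJ.continuous_normalSpeed h'.isotopy hτ
  have hσ : P.γsl - P.γsg = P.γlg * P.σ := by rw [DropletParams.σ]; field_simp
  -- on the contact line the area element of the solution is continuous
  have hWv : MemLp (fun θ => (areaElt (q t θ))⁻¹ * normalSpeed (Icc α β) Φ' τ (c t) θ) 1 paramMeasure := by
    refine (memLp_param_of_continuous (f := fun θ => (-P.σ - P.R / P.γlg *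
      normalSpeed (Icc 0 T) Φ t (c t) θ) * normalSpeed (Icc α β) Φ' τ (c t) θ) ?_ 1).ae_eq ?_
    · exact (continuous_const.sub (continuous_const.mul
        (hJ.continuous_normalSpeed h.trajectory.isotopy ht))).mul hv
    · filter_upwards [h.contactLine t ht] with θ hθ
      rw [hθ]; simp
  have hbdry : P.γlg * arcIntegral (c t) (fun θ => (areaElt (q t θ))⁻¹ *
      normalSpeed (Icc α β) Φ' τ (c t) θ) + P.γlg * P.σ * arcIntegral (c t)
        (normalSpeed (Icc α β) Φ' τ (c t)) = arcIntegral (c t) (fun θ => P.γlg * (P.σ + 1 / areaElt (q t θ)) *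
            normalSpeed (Icc α β) Φ' τ (c t) θ) := by
    rw [← arcIntegral_const_mul, ← arcIntegral_const_mul, ← hJ.arcIntegral_add (hWv.const_mul _)
      ((memLp_param_of_continuous hv 1).const_mul _)]
    congr 1; ext θ; ring
  have i1 : Integrable (fun x => u' τ x * w x) (volume.restrict (D t)) :=
    memLp_one_iff_integrable.1 (MemLp.mul (p := 2) (q := 2) (r := 1) h1.memLp hu0.memLp)
  have i2 : Integrable w (volume.restrict (D t)) := h1.memLp.integrable (by norm_num)
  -- the equation in `D t`, tested with `w`
  have hbulk : P.ζ * ∫ x in D t, w x * ut t x / areaElt (weakGrad (D t) (u t) x) =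
      (P.γlg * ∫ x in D t, w x * d x) - (P.ρ * P.g * ∫ x in D t, u' τ x * w x) + lam t * ∫ x in D t, w x := by
    rw [← integral_const_mul, ← integral_const_mul, ← integral_const_mul, ← integral_const_mul,
      ← integral_sub (h4.const_mul _) (i1.const_mul _),
      ← integral_add (f := fun x => P.γlg * (w x * d x) - P.ρ * P.g * (u' τ x * w x))
        ((h4.const_mul _).sub (i1.const_mul _)) (i2.const_mul _)]
    refine integral_congr_ae ?_
    filter_upwards [hpde, hu] with x hx hux
    simp only [hux]
    rw [DropletParams.capillary] at hx
    have hx' : P.ζ * (ut t x / areaElt (weakGrad (D t) (u t) x)) =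
        P.γlg * d x - P.ρ * P.g * u t x + lam t := by
      field_simp at hx ⊢
      linear_combination hx
    rw [mul_div_assoc]
    linear_combination w x * hx'
  rw [hbulk, hw0, ← hbdry, hσ]
  ring

end IsDropletSolution

end

theorem mainTheorem5 (P : DropletParams) (hγ : 0 < P.γlg) (hR : 0 < P.R)
    (T V : ℝ) (hT : 0 < T) (D₀ : Set Plane) (Φ : ℝ → Plane ≃ₜ Plane) (D : ℝ → Set Plane)
    (c : ℝ → ℝ → Plane) (u ut : ℝ → Plane → ℝ) (q : ℝ → ℝ → Plane) (lam : ℝ → ℝ)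
    (h : IsDropletSolution P T V D₀ Φ D c u ut q lam)
    (vcl : ℝ → ℝ → ℝ) (hvcl : vcl = fun t => normalSpeed (Icc 0 T) Φ t (c t)) :
    -- velocity relation on the contact line
    (∀ t ∈ Icc 0 T,
      HasTrace (D t) (c t) (ut t)
        (fun θ => -inner ℝ (q t θ) (outerNormal (c t) θ) * vcl t θ) ∧
      HasTrace (D t) (c t) (ut t) (fun θ => ‖q t θ‖ * vcl t θ) ∧
      ∀ᵐ θ ∂paramMeasure, -inner ℝ (q t θ) (outerNormal (c t) θ) = ‖q t θ‖) ∧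
    -- energy dissipation
    (∀ t ∈ Icc 0 T,
      HasDerivWithinAt (fun s => energy P (D s) (u s))
        (-P.R * arcIntegral (c t) (fun θ => vcl t θ ^ 2)
          - P.ζ * ∫ x in D t, ut t x ^ 2 / areaElt (weakGrad (D t) (u t) x))
        (Icc 0 T) t) ∧
    -- quasi-static dynamics as a gradient flow of the contact line
    (P.ζ = 0 → ∀ t ∈ Icc 0 T, ∃ δ : ℝ → ℝ,
      IsFirstVariation P V (D t) (c t) (u t) δ ∧
      (∀ᵐ θ ∂paramMeasure,
        P.R * vcl t θ = -δ θ ∧ -δ θ = -P.γlg * (P.σ + 1 / areaElt (q t θ))) ∧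
      IsQuasiStaticProfile P V (D t) (u t) (lam t)) ∧
    -- Young's angle and the sign of the contact line speed
    (∀ θY ∈ Icc 0 Real.pi, Real.cos θY = -P.σ → ∀ t ∈ Icc 0 T, ∀ᵐ θ ∂paramMeasure,
      (vcl t θ = 0 ↔ contactAngle (q t θ) = θY) ∧
      vcl t θ = P.γlg / P.R * (Real.cos θY - Real.cos (contactAngle (q t θ))) ∧
      (θY < contactAngle (q t θ) → 0 < vcl t θ) ∧
      (contactAngle (q t θ) < θY → vcl t θ < 0)) := by
  subst hvcl
  -- the solution itself is an admissible trajectory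
  have key := fun t (ht : t ∈ Icc 0 T) => h.first_variation hγ ht hT ht h.trajectory h.volume_eq rfl ae_eq_rfl
  have hsign : ∀ t ∈ Icc 0 T, ∀ᵐ θ ∂paramMeasure,
      -inner ℝ (q t θ) (outerNormal (c t) θ) = ‖q t θ‖ := fun t ht => by
    filter_upwards [h.gradTrace_eq ht] with θ hθ
    have hn : inner ℝ (outerNormal (c t) θ) (outerNormal (c t) θ) = 1 := by
      rw [real_inner_self_eq_norm_sq, norm_outerNormal (h.jordan t ht), one_pow]
    conv_lhs => rw [hθ]
    rw [inner_neg_left, inner_smul_left, hn]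
    simp
  refine ⟨fun t ht => ?_, fun t ht => ?_, fun hζ t ht => ?_, fun θY hθY hcos t ht => ?_⟩
  · obtain ⟨w, g, h1, h2, -⟩ := key t ht
    have hw := h2.ae_unique hT ht (h.jordan t ht).isOpen (h.timeDeriv t ht)
    have hs := hsign t ht
    refine ⟨(h1.congr hw ae_eq_rfl ?_).hasTrace (h.jordan t ht),
      (h1.congr hw ae_eq_rfl ae_eq_rfl).hasTrace (h.jordan t ht), hs⟩
    filter_upwards [hs] with θ hθ
    rw [hθ]
  · obtain ⟨w, g, -, h2, h3⟩ := key t ht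
    have hw := h2.ae_unique hT ht (h.jordan t ht).isOpen (h.timeDeriv t ht)
    refine h3.congr_deriv (congrArg₂ _ ?_ (congrArg _ (integral_congr_ae ?_)))
    · rw [← arcIntegral_const_mul]
      refine arcIntegral_congr _ ?_
      filter_upwards [h.speed_eq hγ ht] with θ hθ
      linear_combination (normalSpeed (Icc 0 T) Φ t (c t) θ) * hθ
    · filter_upwards [hw] with x hx
      rw [hx, sq]
  · refine ⟨fun θ => P.γlg * (P.σ + 1 / areaElt (q t θ)), ?_, ?_, h.memH2 t ht, h.trajectory.memH10 t ht,
      h.volume_eq t ht, ?_⟩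
    · intro a b s hab hs D₀' Φ' D' u' h' hvol hD hu
      obtain ⟨w, g, -, -, h3⟩ := h.first_variation hγ ht hab hs h' hvol hD hu
      exact h3.congr_deriv (by rw [hζ, zero_mul, sub_zero])
    · filter_upwards [h.speed_eq hγ ht] with θ hθ
      exact ⟨by rw [hθ]; ring, by ring⟩
    · obtain ⟨d, hd, hpde⟩ := h.surface t ht
      refine ⟨d, hd, ?_⟩
      filter_upwards [hpde] with x hx
      rw [← hx, hζ]; simp
  · filter_upwards [h.speed_eq hγ ht] with θ hθ
    have hv : normalSpeed (Icc 0 T) Φ t (c t) θ =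
        P.γlg / P.R * (Real.cos θY - Real.cos (contactAngle (q t θ))) := by
      rw [cos_contactAngle, hcos, div_mul_eq_mul_div, eq_div_iff hR.ne']
      linear_combination hθ
    have hpos : 0 < P.γlg / P.R := div_pos hγ hR
    have hmem := contactAngle_mem (q t θ)
    have hanti := Real.strictAntiOn_cos
    refine ⟨?_, hv, fun hlt => ?_, fun hlt => ?_⟩
    · rw [hv, mul_eq_zero, or_iff_right hpos.ne', sub_eq_zero]
      exact ⟨fun he => (Real.injOn_cos hθY hmem he).symm, fun he => by rw [he]⟩
    · rw [hv]; exact mul_pos hpos (sub_pos.2 (hanti hθY hmem hlt))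
    · rw [hv]; exact mul_neg_of_pos_of_neg hpos (sub_neg.2 (hanti hmem hθY hlt))
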